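/- Conventions. $\Omega\subseteq\mathbb R$ is an open interval, bounded or not, and $h$ is a probability density with $h>0$ on $\Omega$ and support $\overline\Omega$. Let $\alpha>0$, $\lambda\in\mathbb R\setminus\{1\}$, $\xi=\xi(\lambda,\alpha)=1+\alpha(\lambda-1)$, and let $f$ denote probability densities with $f>0$ on $\Omega$ and support $\overline\Omega$. Put $K_\xi[f\|h]=\int_\Omega f^\xi h^{1-\xi}$, always assumed finite for the densities $f$ considered, and $D_\xi[f\|h]=\frac1{\xi-1}\log K_\xi[f\|h]$. Let $y$ be a primitive on $\Omega$ of $f^{1-\alpha}h^\alpha$ (assumed locally integrable in $\Omega$); the transformed density is $f_\alpha^{[h]}(y(x))=(f(x)/h(x))^\alpha$ on $y(\Omega)$, and zero elsewhere. It is defined up to a translation, the integration constant of $y$; any choice is allowed. For a density $w$ on $\mathbb R$ let $$\sigma_q[w]=\Big(\int|t|^qw\,dt\Big)^{1/q}\ (q>0),\quad \sigma_0[w]=\exp\int w\log|t|\,dt,\quad N_\gamma[w]=\Big(\int_{\{w>0\}}w^\gamma\Big)^{\frac1{1-\gamma}},\quad \phi_{p,\beta}[w]=\Big(\int_{\{w>0\}}|w^{\beta-2}w'|^pw\Big)^{\frac1{p\beta}},$$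 and let $$\sigma_{q,\alpha}[f\|h]=\sigma_q[f_\alpha^{[h]}]^{1/\alpha},\qquad \phi_{p,\nu}[f\|h]=\Big(\int_\Omega f^{1+p(\nu-1)}h^{-\nu p}\big|(\log\tfrac fh)'\big|^p\,dx\Big)^{\frac1{p\nu}}.$$ For $p=1$ the integral in $\phi_{1,\beta}[w]$ is read as the total variation on $\mathbb R$ of $w^\beta/\beta$ (taken as $0$ where $w=0$), and the integral in $\phi_{1,\nu}[f\|h]$ as the total variation of $(f/h)^\nu/\nu$, extended by $0$ from $\Omega$ to $[-\infty,\infty]$. All these functionals take values in $[0,\infty]$. Write $p^*$ for the Hölder conjugate exponent. For $\gamma>\frac1{1+p^*}$, $\gamma\neq1$, $g_{p,\gamma}$ is the probability density proportional to $(1-(\gamma-1)|x|^{p^*})_+^{1/(\gamma-1)}$ if $0<p^*<\infty$, to $(-\log|x|)_+^{1/(\gamma-1)}$ if $p^*=0$, and the uniform density on $(-1,1)$ if $p^*=\infty$. With $\theta=1+\beta-\lambda\ne0$ and $g=g_{p,\beta/\theta}$, $g_{p,\beta,\lambda}$ is the density given by $g_{p,\beta,\lambda}(t(x))=g(x)^{1/\theta}$,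 $t(x)=\int_0^xg^{1-1/\theta}$, for $x$ in the support of $g$, and zero off the range of $t$. Put $$K^{(0)}_{p,\lambda}=\frac{\sigma_{p^*}[g_{p,\lambda}]}{N_\lambda[g_{p,\lambda}]},\qquad K^{(1)}_{p,\beta,\lambda}=\big(\phi_{p,\beta}[g_{p,\beta,\lambda}]\,N_\lambda[g_{p,\beta,\lambda}]\big)^{1+\beta-\lambda}.$$ For a density $g$ with $r=N_{(\alpha-1)/\alpha}[g]<\infty$ put $G(t)=r\,g(rt)$. The inverse transform is $\mathfrak R_\alpha^{-1,[h]}[g](x)=G(y(x))^{1/\alpha}h(x)$, $x\in\Omega$, where $y(x)$ is the point of $\{G>0\}$ with $\int_{\{G>0\}\cap(-\infty,y(x)]}G^{\frac{\alpha-1}\alpha}=\int_{\Omega\cap(-\infty,x]}h$, so that $y'=G(y)^{-\frac{\alpha-1}{\alpha}}h$. **Theorem.** (a) Let $p^*\in[0,\infty)$ and $\lambda>\frac1{1+p^*}$. Then $0<K^{(0)}_{p,\lambda}<\infty$ and, for every $f$ and every choice of $y$ as above, $$e^{D_{\xi(\lambda,\alpha)}[f\|h]}\;\sigma_{p^*,\alpha}[f\|h]\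 \ge\ \big(K^{(0)}_{p,\lambda}\big)^{1/\alpha}.$$ If $N_{(\alpha-1)/\alpha}[g_{p,\lambda}]<\infty$, the inequality is sharp: $f_{\min}=\mathfrak R_\alpha^{-1,[h]}[g_{p,\lambda}]$, with its own $y$, is such a density and attains equality, and every $f$ that attains equality (for some choice of $y$) equals $f_{\min}$ almost everywhere on $\Omega$. (b) Let $p\ge1$ and let $\beta\in\mathbb R$ satisfy $\operatorname{sign}(p^*\beta+\lambda-1)=\operatorname{sign}(\beta+1-\lambda)\ne0$ (for $p=1$, where $p^*=\infty$, the left side is $\operatorname{sign}\beta$), and let $h$ be differentiable on $\Omega$. Then $0<K^{(1)}_{p,\beta,\lambda}<\infty$ and $$\Big[e^{-D_{\xi(\lambda,\alpha)}[f\|h]}\;\phi_{p,\beta\alpha}[f\|h]\Big]^{1+\beta-\lambda}\ \ge\ \alpha^{\frac{\lambda-\beta-1}{\alpha\beta}}\big(K^{(1)}_{p,\beta,\lambda}\big)^{1/\alpha}$$ for every $f$ as above that is differentiable on $\Omega$ and such that one of the following holds: $f_\alpha^{[h]}$ is absolutely continuous on $\mathbb R$ (that is, on every compact interval); or $1+\beta-\lambda<0$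 and $f_\alpha^{[h]}$ is absolutely continuous on every compact subinterval of $y(\Omega)$ and tends to $+\infty$ at both ends of $y(\Omega)$; or $p=1$. If $N_{(\alpha-1)/\alpha}[g_{p,\beta,\lambda}]<\infty$, the inequality is sharp: $f_{\min}=\mathfrak R_\alpha^{-1,[h]}[g_{p,\beta,\lambda}]$ belongs to this class and attains equality, and it is the only density of the class that does. -/

import Mathlib

open MeasureTheory Set
open scoped ENNReal

noncomputable section

namespace RelEscort

/-! ### Densities on an interval -/

/-- `f` is a probability density on `ℝ` that is positive on the open interval `Ω` and whose
support is the closure of `Ω`. -/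
structure IsDensityOn (Ω : Set ℝ) (f : ℝ → ℝ) : Prop where
  aemeasurable : AEMeasurable f volume
  nonneg : ∀ x, 0 ≤ f x
  pos : ∀ x ∈ Ω, 0 < f x
  eq_zero : ∀ x ∉ closure Ω, f x = 0
  lintegral_eq_one : ∫⁻ x, ENNReal.ofReal (f x) = 1

/-- The scaling `S_r[g](x) = r g(r x)`. -/
def scaling (r : ℝ) (g : ℝ → ℝ) (x : ℝ) : ℝ := r * g (r * x)

/-- The index `ξ(l, α) = 1 + α (l - 1)`. -/
def xi (l α : ℝ) : ℝ := 1 + α * (l - 1)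

/-! ### Classical functionals of one density, with values in `[0, ∞]` -/

/-- The `q`-th deviation: `(∫ |t|^q w)^(1/q)` for `q > 0`, and `exp (∫ w log |t|)` for `q = 0`
(the integral being the difference of the integrals of the positive and the negative part). -/
def deviation (q : ℝ) (w : ℝ → ℝ) : ℝ≥0∞ :=
  if q = 0 then
    EReal.exp (((∫⁻ t, ENNReal.ofReal (w t * Real.log |t|) : ℝ≥0∞) : EReal)
      - ((∫⁻ t, ENNReal.ofReal (-(w t * Real.log |t|)) : ℝ≥0∞) : EReal))
  else (∫⁻ t, ENNReal.ofReal (|t| ^ q * w t)) ^ (1 / q)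

/-- The Rényi entropy power `N_l[w] = (∫ w^l)^(1/(1-l))`, `l ≠ 1`; the integral is over the set
where `w` is positive, so that it is meaningful for `l ≤ 0` too (`N_0` is the length of the
support). -/
def renyiPower (l : ℝ) (w : ℝ → ℝ) : ℝ≥0∞ :=
  (∫⁻ t in {t | 0 < w t}, ENNReal.ofReal (w t ^ l)) ^ (1 / (1 - l))

/-- The `(p, l)`-Fisher information `(∫ |w^(l-2) w'|^p w)^(1/(p l))` for `p > 1`; for `p = 1` the
integral is replaced by the total variation of `w^l / l` on the real line. -/
def fisherInfo (p l : ℝ) (w : ℝ → ℝ) : ℝ≥0∞ :=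
  if p = 1 then (eVariationOn (fun t => w t ^ l / l) univ) ^ (1 / l)
  else (∫⁻ t in {t | 0 < w t}, ENNReal.ofReal (|w t ^ (l - 2) * deriv w t| ^ p * w t))
    ^ (1 / (p * l))

/-! ### Functionals of two densities, with values in `[0, ∞]` -/

/-- `K_ξ[f||h] = ∫_Ω f^ξ h^(1-ξ)`. -/
def renyiIntegral (Ω : Set ℝ) (ξ : ℝ) (f h : ℝ → ℝ) : ℝ≥0∞ :=
  ∫⁻ x in Ω, ENNReal.ofReal (f x ^ ξ * h x ^ (1 - ξ))

/-- The Rényi divergence `D_ξ[f||h] = (ξ - 1)⁻¹ log K_ξ[f||h]`, `ξ ≠ 1`. -/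
def renyiDiv (Ω : Set ℝ) (ξ : ℝ) (f h : ℝ → ℝ) : EReal :=
  ((1 / (ξ - 1) : ℝ) : EReal) * ENNReal.log (renyiIntegral Ω ξ f h)

/-- `F_{p,l}[f||h] = ∫_Ω f^(1+p(l-1)) h^(-l p) |(log (f/h))'|^p` for `p > 1`. For `p = 1` this
integral, which is `∫_Ω |((f/h)^l / l)'|`, is replaced by the total variation of `(f/h)^l / l`,
extended by zero from `Ω` to the extended real line (so the boundary jumps at both ends of `Ω`
are counted even where these ends are infinite). -/
def relFisherIntegral (Ω : Set ℝ) (p l : ℝ) (f h : ℝ → ℝ) : ℝ≥0∞ :=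
  if p = 1 then
    eVariationOn (((fun x : ℝ => (x : EReal)) '' Ω).indicator
      (fun x : EReal => (f x.toReal / h x.toReal) ^ l / l)) univ
  else ∫⁻ x in Ω, ENNReal.ofReal
    (f x ^ (1 + p * (l - 1)) * h x ^ (-(l * p)) * |deriv (fun s => Real.log (f s / h s)) x| ^ p)

/-- The relative Fisher divergence `φ_{p,l}[f||h] = F_{p,l}[f||h]^(1/(p l))`. -/
def relFisher (Ω : Set ℝ) (p l : ℝ) (f h : ℝ → ℝ) : ℝ≥0∞ :=
  relFisherIntegral Ω p l f h ^ (1 / (p * l))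

/-! ### The relative differential-escort transformation -/

/-- `y` is a change of variable for the transformation: `y' = f^(1-α) h^α` on `Ω`, in integrated
form. It is determined up to an additive constant. -/
def IsChangeOfVar (Ω : Set ℝ) (f h : ℝ → ℝ) (α : ℝ) (y : ℝ → ℝ) : Prop :=
  ∀ a ∈ Ω, ∀ b ∈ Ω,
    IntervalIntegrable (fun x => f x ^ (1 - α) * h x ^ α) volume a b ∧
    y b - y a = ∫ x in a..b, f x ^ (1 - α) * h x ^ α

/-- The transformed density `t ↦ (f(x(t)) / h(x(t)))^α` on `y(Ω)`, where `x` is the inverse of `y`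
on `Ω`; it is zero off `y(Ω)`. -/
def relTransform (Ω : Set ℝ) (f h : ℝ → ℝ) (α : ℝ) (y : ℝ → ℝ) : ℝ → ℝ :=
  (y '' Ω).indicator
    (fun t => (f (Function.invFunOn y Ω t) / h (Function.invFunOn y Ω t)) ^ α)

/-- The relative cumulative deviation `σ_{q,α}[f||h] = σ_q[f_α^{[h]}]^(1/α)`, for the
transformation with change of variable `y`. -/
def relDeviation (Ω : Set ℝ) (f h : ℝ → ℝ) (α : ℝ) (y : ℝ → ℝ) (q : ℝ) : ℝ≥0∞ :=
  deviation q (relTransform Ω f h α y) ^ (1 / α)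

/-- The scaling parameter `r(α, g) = N_{(α-1)/α}[g]` (the length of the support if `α = 1`). -/
def invScale (α : ℝ) (g : ℝ → ℝ) : ℝ := (renyiPower ((α - 1) / α) g).toReal

/-- The change of variable `y` of the inverse transformation, `y' = S_r[g](y)^(-(α-1)/α) h` on
`Ω`, in integrated form: with `G = S_r[g]`, `y(x)` is the point of the support of `G` with
`∫_{t ≤ y(x)} G^((α-1)/α) = ∫_{s ≤ x} h`. -/
def invVar (Ω : Set ℝ) (h : ℝ → ℝ) (α : ℝ) (g : ℝ → ℝ) (x : ℝ) : ℝ :=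
  Function.invFunOn
    (fun t => ∫ s in {s | 0 < scaling (invScale α g) g s} ∩ Iic t,
      scaling (invScale α g) g s ^ ((α - 1) / α))
    {t | 0 < scaling (invScale α g) g t}
    (∫ s in Ω ∩ Iic x, h s)

/-- The inverse relative differential-escort transform `S_r[g](y(x))^(1/α) h(x)`, `x ∈ Ω`. -/
def invTransform (Ω : Set ℝ) (h : ℝ → ℝ) (α : ℝ) (g : ℝ → ℝ) : ℝ → ℝ :=
  Ω.indicator (fun x => scaling (invScale α g) g (invVar Ω h α g x) ^ (1 / α) * h x)

/-! ### Stretched Gaussians and the optimal constants -/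

/-- The Tsallis exponential `exp_l`. -/
def tsallisExp (l x : ℝ) : ℝ :=
  if l = 1 then Real.exp x else (max (1 + (1 - l) * x) 0) ^ (1 / (1 - l))

/-- The profile of the stretched Gaussian with exponent `q = p^*`: `exp_{2-l}(-|x|^q)` for
`0 < q < ∞`, and the limits `(-log |x|)_+^(1/(l-1))` for `q = 0` (infinite at the origin if
`l > 1`, where it gets an arbitrary positive value) and the indicator of `(-1, 1)` for `q = ∞`. -/
def stretchedProfile (q : ℝ≥0∞) (l x : ℝ) : ℝ :=
  if q = ∞ then (Ioo (-1 : ℝ) 1).indicator (fun _ => 1) x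
  else if q = 0 then
    if x = 0 then 1 else (max (-Real.log |x|) 0) ^ (1 / (l - 1))
  else tsallisExp (2 - l) (-(|x| ^ q.toReal))

/-- The stretched Gaussian density `g_{p,l}`, as a function of `q = p^*`. -/
def stretchedGaussian (q : ℝ≥0∞) (l x : ℝ) : ℝ :=
  stretchedProfile q l x / ∫ s, stretchedProfile q l s

/-- The density `g_{p,β,l}`: the differential-escort transform (reference function `1`) of order
`1/(1+β-l)` of `g_{p,β/(1+β-l)}`, as a function of `q = p^*`. -/
def stamMinimizer (q : ℝ≥0∞) (β l : ℝ) : ℝ → ℝ :=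
  relTransform {x | 0 < stretchedGaussian q (β / (1 + β - l)) x}
    (stretchedGaussian q (β / (1 + β - l))) (fun _ => 1) (1 / (1 + β - l))
    (fun x => ∫ s in (0 : ℝ)..x,
      stretchedGaussian q (β / (1 + β - l)) s ^ (1 - 1 / (1 + β - l)))

/-- The Hölder conjugate of a real number `p ≥ 1`, with `1^* = ∞`. -/
def holderConj (p : ℝ) : ℝ≥0∞ := ENNReal.conjExponent (ENNReal.ofReal p)

/-- `K⁽⁰⁾_{p,l} = σ_{p^*}[g_{p,l}] / N_l[g_{p,l}]`, as a function of `q = p^*`. -/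
def momentConst (q l : ℝ) : ℝ≥0∞ :=
  deviation q (stretchedGaussian (ENNReal.ofReal q) l)
    / renyiPower l (stretchedGaussian (ENNReal.ofReal q) l)

/-- `K⁽¹⁾_{p,β,l} = (φ_{p,β}[g_{p,β,l}] N_l[g_{p,β,l}])^(1+β-l)`. -/
def stamConst (p β l : ℝ) : ℝ≥0∞ :=
  (fisherInfo p β (stamMinimizer (holderConj p) β l)
    * renyiPower l (stamMinimizer (holderConj p) β l)) ^ (1 + β - l)

/-- `sign (p^* β + l - 1) = sign (β + 1 - l) ≠ 0`. -/
def SignCond (p β l : ℝ) : Prop :=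
  SignType.sign ((holderConj p : EReal) * (β : EReal) + ((l - 1 : ℝ) : EReal))
      = SignType.sign (β + 1 - l) ∧
    SignType.sign (β + 1 - l) ≠ 0

/-- The regularity asked of a (transformed) density `w` on an interval `I` (zero off `I`) in the
Stam inequality: `w` is absolutely continuous on (every compact interval of) `ℝ`, or `θ < 0` and
`w` is absolutely continuous on every compact interval inside `I` and tends to `+∞` at both ends
of `I`. For `p = 1`, where the Fisher functional is a total variation, nothing is asked. -/
def StamRegular (p θ : ℝ) (I : Set ℝ) (w : ℝ → ℝ) : Prop :=
  p = 1 ∨ (∀ a b : ℝ, AbsolutelyContinuousOnInterval w a b) ∨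
    (θ < 0 ∧ (∀ a ∈ I, ∀ b ∈ I, AbsolutelyContinuousOnInterval w a b) ∧
      ∀ M : ℝ, ∃ C ⊆ I, IsCompact C ∧ ∀ t ∈ I \ C, M < w t)

end RelEscort

end

open RelEscort

namespace RelEscort

/-! ### Monotone transport between intervals -/

/-! The relative transformation is a change of variable. Under t = y(x) the measure f dx becomes w
dt with w = (f/h)^α, and h dx becomes w^((α-1)/α) dt. Integrals of powers of w are integrals over Ω
of products of powers of f and h (`lintegral_relTransform_rpow`), and for p > 1 the Fisher integral
of w is α^p times the relative one (`lintegral_fisher_relTransform`). So exp(-D_ξ) is N_λ[w]^(1/α),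
and each inequality is a one-density inequality for w raised to the power 1/α. Since f is only
measurable in the first inequality, changes of variable are handled as monotone homeomorphisms
pushing one positive weight to another (`IsTransport`), without derivatives.

Moment-entropy. After a scaling, w has the same moment as the stretched Gaussian g. Since g^(λ-1) is
a multiple of the positive part of a function Φ that is affine in |t|^q (or log |t|), integrating
Bernoulli's inequality in Bregman form between w and g leaves only ∫ w^λ - ∫ g^λ (`bregman_nonneg`,
`integral_rpow_extremal`, `moment_entropy`). The pointwise inequality is strict unless w = g, which
gives rigidity.

Stam. Put θ = 1+β-λ, γ = β/θ, and let s be the increasing map transporting w to g = g_{p,γ}. The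
quantity B = ∫ w^(1+β)/g(s) is estimated twice. From below, a power mean inequality bounds B by ∫
w^λ and ∫ g^γ (`stam_jensen`). From above, s' = w/g(s) turns B into ∫ w^β s', and integration by
parts with Hölder bounds it by the Fisher information of w times a moment of g (`stam_upper`); for p
= 1 the density g is uniform and B is bounded by the supremum of w^β, hence by a total variation
(`stam_upper_one`). The constant is the right one because the corresponding bound for the minimizer
goes the other way (`IsProfileParam.moment_le`, `stam_chain`). Equality is read off the power mean
step alone: w^θ is then a multiple of g(s), so that s composed with the escort variable of g is
affine and w is a translated scaling of the escort transform of g (`stam_rigidity`).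

Uniqueness of f. In both cases w is a scaling of a known density, up to a translation absorbed in y.
The condition ∫ h = 1 reads ∫ w^((α-1)/α) = 1 and fixes the scale; matching distribution functions
of h and of w^((α-1)/α) then fixes y, hence f (`ae_eq_invTransform`). -/

lemma isOpen_image_of_strictMonoOn {Ω : Set ℝ} (hΩo : IsOpen Ω) (hΩc : Ω.OrdConnected)
    {y : ℝ → ℝ} (hm : StrictMonoOn y Ω) (hc : ContinuousOn y Ω) :
    IsOpen (y '' Ω) ∧ (y '' Ω).OrdConnected := by
  have hoc : (y '' Ω).OrdConnected := (hΩc.isPreconnected.image y hc).ordConnected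
  refine ⟨isOpen_iff_mem_nhds.2 ?_, hoc⟩
  rintro _ ⟨x, hx, rfl⟩
  obtain ⟨ε, hε, hb⟩ := Metric.isOpen_iff.1 hΩo x hx
  have ha : x - ε / 2 ∈ Ω := hb (by simp [abs_of_pos hε]; linarith)
  have hb' : x + ε / 2 ∈ Ω := hb (by simp [abs_of_pos hε]; linarith)
  refine Filter.mem_of_superset (Ioo_mem_nhds (hm ha hx (by linarith)) (hm hx hb' (by linarith))) ?_
  exact Ioo_subset_Icc_self.trans (hoc.out (mem_image_of_mem _ ha) (mem_image_of_mem _ hb'))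

/-- A jump of a monotone function would leave a gap in its image, so an open image forces
continuity. -/
lemma continuousOn_of_strictMonoOn_image {Ω : Set ℝ} (hΩo : IsOpen Ω)
    {y : ℝ → ℝ} (hm : StrictMonoOn y Ω) (ho : IsOpen (y '' Ω)) : ContinuousOn y Ω := fun _ hx =>
  (continuousAt_of_monotoneOn_of_image_mem_nhds hm.monotoneOn (hΩo.mem_nhds hx)
    (ho.mem_nhds (mem_image_of_mem _ hx))).continuousWithinAt

lemma strictMonoOn_invFunOn {Ω : Set ℝ} {y : ℝ → ℝ} (hm : StrictMonoOn y Ω) :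
    StrictMonoOn (Function.invFunOn y Ω) (y '' Ω) := by
  rintro _ ⟨a, ha, rfl⟩ _ ⟨b, hb, rfl⟩ hab
  rw [hm.injOn.leftInvOn_invFunOn ha, hm.injOn.leftInvOn_invFunOn hb]
  exact (hm.lt_iff_lt ha hb).1 hab

lemma invFunOn_image_image {Ω : Set ℝ} {y : ℝ → ℝ} (hm : StrictMonoOn y Ω) :
    Function.invFunOn y Ω '' (y '' Ω) = Ω := by
  rw [image_image]
  ext x
  constructor
  · rintro ⟨a, ha, rfl⟩
    exact Function.invFunOn_mem ⟨a, ha, rfl⟩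
  · intro hx
    exact ⟨x, hx, hm.injOn.leftInvOn_invFunOn hx⟩

/-- Rational endpoints keep the cover countable, which is what gluing restricted measures requires.
-/
lemma iUnion_Ioc_rat_eq {J : Set ℝ} (hJo : IsOpen J) (hJc : J.OrdConnected) :
    J = ⋃ i : {i : ℚ × ℚ // (i.1 : ℝ) ∈ J ∧ (i.2 : ℝ) ∈ J}, Ioc (i.1.1 : ℝ) (i.1.2 : ℝ) := by
  ext t
  simp only [mem_iUnion]
  constructor
  · intro ht
    obtain ⟨ε, hε, hb⟩ := Metric.isOpen_iff.1 hJo t ht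
    obtain ⟨c, hc1, hc2⟩ := exists_rat_btwn (show t - ε < t by linarith)
    obtain ⟨d, hd1, hd2⟩ := exists_rat_btwn (show t < t + ε by linarith)
    refine ⟨⟨(c, d), hb ?_, hb ?_⟩, hc2, hd1.le⟩ <;>
      simp only [Metric.mem_ball, Real.dist_eq, abs_lt] <;> constructor <;> linarith
  · rintro ⟨⟨⟨c, d⟩, hc, hd⟩, h1, h2⟩
    exact hJc.out hc hd ⟨h1.le, h2⟩

/-- Two measures agreeing on the half-open intervals inside an open interval agree there. -/
lemma restrict_eq_of_Ioc {J : Set ℝ} (hJo : IsOpen J) (hJc : J.OrdConnected) {μ ν : Measure ℝ}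
    (hfin : ∀ c ∈ J, ∀ d ∈ J, c < d → μ (Ioc c d) ≠ ∞)
    (heq : ∀ c ∈ J, ∀ d ∈ J, c < d → μ (Ioc c d) = ν (Ioc c d)) :
    μ.restrict J = ν.restrict J := by
  -- On a single half-open interval both measures are finite, so uniqueness on the π-system of
  -- half-open intervals applies; the countable cover then glues.
  have key : ∀ c ∈ J, ∀ d ∈ J, μ.restrict (Ioc c d) = ν.restrict (Ioc c d) := by
    intro c hc d hd
    rcases le_or_gt d c with h | h
    · simp [Ioc_eq_empty_of_le h]
    have : IsFiniteMeasure (μ.restrict (Ioc c d)) :=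
      ⟨by simpa using (hfin c hc d hd h).lt_top⟩
    refine Measure.ext_of_Ioc_finite _ _ (by simpa using heq c hc d hd h) ?_
    intro a b _
    rw [Measure.restrict_apply measurableSet_Ioc, Measure.restrict_apply measurableSet_Ioc,
      Ioc_inter_Ioc]
    rcases le_or_gt (b ⊓ d) (a ⊔ c) with h' | h'
    · simp [Ioc_eq_empty_of_le h']
    · have h1 : a ⊔ c ∈ J := hJc.out hc hd ⟨le_sup_right, h'.le.trans inf_le_right⟩
      have h2 : b ⊓ d ∈ J := hJc.out hc hd ⟨le_sup_right.trans h'.le, inf_le_right⟩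
      exact heq _ h1 _ h2 h'
  rw [iUnion_Ioc_rat_eq hJo hJc, Measure.restrict_iUnion_congr]
  rintro ⟨⟨c, d⟩, hc, hd⟩
  exact key _ hc _ hd

/-- `Ω` is an open interval carrying the positive measurable weight `k`. -/
structure IsWeight (Ω : Set ℝ) (k : ℝ → ℝ) : Prop where
  isOpen : IsOpen Ω
  ordConnected : Ω.OrdConnected
  aemeasurable : AEMeasurable k (volume.restrict Ω)
  pos : ∀ x ∈ Ω, 0 < k x

/-- The measure `k dx` on `Ω`. -/
noncomputable def weightMeasure (Ω : Set ℝ) (k : ℝ → ℝ) : Measure ℝ :=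
  (volume.restrict Ω).withDensity (fun x => ENNReal.ofReal (k x))

/-- The weight is finite everywhere, so no measurability of `F` is needed. -/
lemma IsWeight.lintegral {Ω : Set ℝ} {k : ℝ → ℝ} (hk : IsWeight Ω k) (F : ℝ → ℝ≥0∞) :
    ∫⁻ x, F x ∂(weightMeasure Ω k) = ∫⁻ x in Ω, F x * ENNReal.ofReal (k x) := by
  rw [weightMeasure, lintegral_withDensity_eq_lintegral_mul_non_measurable₀ _
    hk.aemeasurable.ennreal_ofReal (by simp)]
  simp [mul_comm]

lemma weightMeasure_ac (Ω : Set ℝ) (k : ℝ → ℝ) : weightMeasure Ω k ≪ volume.restrict Ω :=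
  withDensity_absolutelyContinuous _ _

/-- Positivity of the weight makes the weighted and the Lebesgue measure on `Ω` mutually absolutely
continuous, so null sets need not be distinguished. -/
lemma IsWeight.ac {Ω : Set ℝ} {k : ℝ → ℝ} (hk : IsWeight Ω k) :
    volume.restrict Ω ≪ weightMeasure Ω k := by
  apply withDensity_absolutelyContinuous' hk.aemeasurable.ennreal_ofReal
  filter_upwards [ae_restrict_mem hk.isOpen.measurableSet] with x hx
  simpa using hk.pos x hx

/-- `y` is an increasing homeomorphism of `Ω` onto `J` pushing `k dx` forward to `e dt`. -/
structure IsTransport (Ω : Set ℝ) (k : ℝ → ℝ) (J : Set ℝ) (e : ℝ → ℝ) (y : ℝ → ℝ) : Prop where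
  source : IsWeight Ω k
  target : IsWeight J e
  image : y '' Ω = J
  strictMonoOn : StrictMonoOn y Ω
  map_eq : (weightMeasure Ω k).map y = weightMeasure J e

lemma isWeight_one {Ω : Set ℝ} (hΩo : IsOpen Ω) (hΩc : Ω.OrdConnected) :
    IsWeight Ω (fun _ => 1) := ⟨hΩo, hΩc, aemeasurable_const, fun _ _ => one_pos⟩

lemma weightMeasure_one (Ω : Set ℝ) : weightMeasure Ω (fun _ => 1) = volume.restrict Ω := by
  simp [weightMeasure]

namespace IsTransport

variable {Ω J : Set ℝ} {k e y : ℝ → ℝ}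

lemma mem (hT : IsTransport Ω k J e y) {x : ℝ} (hx : x ∈ Ω) : y x ∈ J :=
  hT.image ▸ mem_image_of_mem y hx

lemma continuousOn (hT : IsTransport Ω k J e y) : ContinuousOn y Ω :=
  continuousOn_of_strictMonoOn_image hT.source.isOpen hT.strictMonoOn
    (hT.image ▸ hT.target.isOpen)

lemma aemeasurable (hT : IsTransport Ω k J e y) : AEMeasurable y (volume.restrict Ω) :=
  aemeasurable_restrict_of_monotoneOn hT.source.isOpen.measurableSet hT.strictMonoOn.monotoneOn

lemma aemeasurable' (hT : IsTransport Ω k J e y) : AEMeasurable y (weightMeasure Ω k) :=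
  hT.aemeasurable.mono_ac (weightMeasure_ac _ _)

/-- Lebesgue-null sets of `J` are null for `e dt`, hence have `k`-null and so Lebesgue-null
preimages. This lets almost-everywhere statements and a.e. measurable functions be composed with
`y`. -/
lemma map_ac (hT : IsTransport Ω k J e y) :
    (volume.restrict Ω).map y ≪ volume.restrict J := by
  refine Measure.AbsolutelyContinuous.trans (μ₂ := (weightMeasure Ω k).map y) ?_ ?_
  · refine Measure.AbsolutelyContinuous.mk fun A hA h0 => ?_
    rw [Measure.map_apply_of_aemeasurable hT.aemeasurable' hA] at h0
    rw [Measure.map_apply_of_aemeasurable hT.aemeasurable hA]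
    exact hT.source.ac h0
  · rw [hT.map_eq]
    exact weightMeasure_ac _ _

lemma ae_comp (hT : IsTransport Ω k J e y) {P : ℝ → Prop} (h : ∀ᵐ t ∂(volume.restrict J), P t) :
    ∀ᵐ x ∂(volume.restrict Ω), P (y x) :=
  ae_of_ae_map hT.aemeasurable (hT.map_ac.ae_le h)

lemma comp_aemeasurable (hT : IsTransport Ω k J e y) {β : Type*} [MeasurableSpace β] {F : ℝ → β}
    (hF : AEMeasurable F (volume.restrict J)) :
    AEMeasurable (fun x => F (y x)) (volume.restrict Ω) :=
  (hF.mono_ac hT.map_ac).comp_aemeasurable hT.aemeasurable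

lemma lintegral (hT : IsTransport Ω k J e y) {F : ℝ → ℝ≥0∞}
    (hF : AEMeasurable F (volume.restrict J)) :
    ∫⁻ x in Ω, F (y x) * ENNReal.ofReal (k x) = ∫⁻ t in J, F t * ENNReal.ofReal (e t) := by
  rw [← hT.source.lintegral (fun x => F (y x)), ← hT.target.lintegral, ← hT.map_eq,
    lintegral_map' _ hT.aemeasurable']
  rw [hT.map_eq]
  exact hF.mono_ac (weightMeasure_ac _ _)

lemma symm (hT : IsTransport Ω k J e y) : IsTransport J e Ω k (Function.invFunOn y Ω) := by
  have hm : StrictMonoOn (Function.invFunOn y Ω) J := hT.image ▸ strictMonoOn_invFunOn hT.strictMonoOn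
  refine ⟨hT.target, hT.source, hT.image ▸ invFunOn_image_image hT.strictMonoOn, hm, ?_⟩
  have hmeas : AEMeasurable (Function.invFunOn y Ω) (weightMeasure J e) :=
    (aemeasurable_restrict_of_monotoneOn hT.target.isOpen.measurableSet hm.monotoneOn).mono_ac
      (weightMeasure_ac _ _)
  rw [← hT.map_eq] at hmeas ⊢
  rw [AEMeasurable.map_map_of_aemeasurable hmeas hT.aemeasurable']
  refine (Measure.map_congr (g := id) ?_).trans Measure.map_id
  refine (weightMeasure_ac _ _).ae_le ?_
  filter_upwards [ae_restrict_mem hT.source.isOpen.measurableSet] with x hx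
  exact hT.strictMonoOn.injOn.leftInvOn_invFunOn hx

lemma trans (hT : IsTransport Ω k J e y) {L : Set ℝ} {m z : ℝ → ℝ} (hT' : IsTransport J e L m z) :
    IsTransport Ω k L m (fun x => z (y x)) := by
  refine ⟨hT.source, hT'.target, ?_, ?_, ?_⟩
  · rw [← hT'.image, ← hT.image, image_image]
  · intro a ha b hb hab
    exact hT'.strictMonoOn (hT.mem ha) (hT.mem hb) (hT.strictMonoOn ha hb hab)
  · rw [← hT'.map_eq, ← hT.map_eq]
    rw [AEMeasurable.map_map_of_aemeasurable _ hT.aemeasurable']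
    · rfl
    · rw [hT.map_eq]; exact hT'.aemeasurable'

lemma congr (hT : IsTransport Ω k J e y) {k' e' : ℝ → ℝ} (hk : ∀ x ∈ Ω, k' x = k x)
    (he : ∀ t ∈ J, e' t = e t) : IsTransport Ω k' J e' y := by
  have h1 : k' =ᵐ[volume.restrict Ω] k := by
    filter_upwards [ae_restrict_mem hT.source.isOpen.measurableSet] with x hx using hk x hx
  have h2 : e' =ᵐ[volume.restrict J] e := by
    filter_upwards [ae_restrict_mem hT.target.isOpen.measurableSet] with x hx using he x hx
  refine ⟨⟨hT.source.isOpen, hT.source.ordConnected, hT.source.aemeasurable.congr h1.symm,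
    fun x hx => hk x hx ▸ hT.source.pos x hx⟩, ⟨hT.target.isOpen, hT.target.ordConnected,
    hT.target.aemeasurable.congr h2.symm, fun x hx => he x hx ▸ hT.target.pos x hx⟩, hT.image,
    hT.strictMonoOn, ?_⟩
  have e1 : weightMeasure Ω k' = weightMeasure Ω k :=
    withDensity_congr_ae (by filter_upwards [h1] with x hx; rw [hx])
  have e2 : weightMeasure J e' = weightMeasure J e :=
    withDensity_congr_ae (by filter_upwards [h2] with x hx; rw [hx])
  rw [e1, e2, hT.map_eq]

/-- Multiplying both weights by the same positive function. -/
lemma mul (hT : IsTransport Ω k J e y) {φ : ℝ → ℝ} (hφ : AEMeasurable φ (volume.restrict J))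
    (hpos : ∀ t ∈ J, 0 < φ t) :
    IsTransport Ω (fun x => φ (y x) * k x) J (fun t => φ t * e t) y := by
  have hs : IsWeight Ω (fun x => φ (y x) * k x) := ⟨hT.source.isOpen, hT.source.ordConnected,
    (hT.comp_aemeasurable hφ).mul hT.source.aemeasurable,
    fun x hx => mul_pos (hpos _ (hT.mem hx)) (hT.source.pos x hx)⟩
  have ht : IsWeight J (fun x => φ x * e x) := ⟨hT.target.isOpen, hT.target.ordConnected,
    hφ.mul hT.target.aemeasurable, fun x hx => mul_pos (hpos _ hx) (hT.target.pos x hx)⟩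
  refine ⟨hs, ht, hT.image, hT.strictMonoOn, ?_⟩
  ext A hA
  have hmeas : AEMeasurable y (weightMeasure Ω fun x => φ (y x) * k x) :=
    hT.aemeasurable.mono_ac (weightMeasure_ac _ _)
  rw [← lintegral_indicator_one hA, ← lintegral_indicator_one hA,
    lintegral_map' ((measurable_one.indicator hA).aemeasurable) hmeas, hs.lintegral, ht.lintegral]
  have h3 := hT.lintegral (F := fun t => A.indicator (1 : ℝ → ℝ≥0∞) t * ENNReal.ofReal (φ t))
    (((measurable_one.indicator hA).aemeasurable).mul hφ.ennreal_ofReal)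
  simp only [mul_assoc] at h3
  rw [setLIntegral_congr_fun hT.source.isOpen.measurableSet
      (g := fun x => A.indicator (1 : ℝ → ℝ≥0∞) (y x) * (ENNReal.ofReal (φ (y x)) * ENNReal.ofReal (k x))) _,
    h3, setLIntegral_congr_fun hT.target.isOpen.measurableSet]
  · intro t ht; simp only; rw [← ENNReal.ofReal_mul (hpos _ ht).le]
  · intro x hx; simp only; rw [← ENNReal.ofReal_mul (hpos _ (hT.mem hx)).le]

/-- A primitive of a positive weight transports it to Lebesgue measure. -/
lemma of_primitive (hk : IsWeight Ω k)
    (hy : ∀ a ∈ Ω, ∀ b ∈ Ω, IntervalIntegrable k volume a b ∧ y b - y a = ∫ x in a..b, k x) :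
    IsTransport Ω k (y '' Ω) (fun _ => 1) y := by
  have hIoc : ∀ a ∈ Ω, ∀ b ∈ Ω, a < b →
      ∫⁻ x in Ioc a b, ENNReal.ofReal (k x) = ENNReal.ofReal (y b - y a) := by
    intro a ha b hb hab
    rw [(hy a ha b hb).2, intervalIntegral.integral_of_le hab.le, ofReal_integral_eq_lintegral_ofReal]
    · exact (intervalIntegrable_iff_integrableOn_Ioc_of_le hab.le).1 (hy a ha b hb).1
    · filter_upwards [ae_restrict_mem measurableSet_Ioc] with x hx
      exact (hk.pos x (hk.ordConnected.out ha hb ⟨hx.1.le, hx.2⟩)).le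
  have hm : StrictMonoOn y Ω := by
    intro a ha b hb hab
    have h1 : 0 < ∫ x in a..b, k x := intervalIntegral.intervalIntegral_pos_of_pos_on
      (hy a ha b hb).1 (fun x hx => hk.pos x (hk.ordConnected.out ha hb ⟨hx.1.le, hx.2.le⟩)) hab
    linarith [(hy a ha b hb).2]
  have hc : ContinuousOn y Ω := by
    intro x hx
    obtain ⟨ε, hε, hb⟩ := Metric.isOpen_iff.1 hk.isOpen x hx
    have ha : x - ε / 2 ∈ Ω := hb (by simp [abs_of_pos hε]; linarith)
    have hb' : x + ε / 2 ∈ Ω := hb (by simp [abs_of_pos hε]; linarith)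
    have h2 := intervalIntegral.continuousOn_primitive_interval'
      (hy _ ha _ hb').1 left_mem_uIcc
    have h3 : ContinuousOn y (Icc (x - ε / 2) (x + ε / 2)) := by
      rw [uIcc_of_le (by linarith)] at h2
      refine (h2.add (continuousOn_const (c := y (x - ε / 2)))).congr fun t ht => ?_
      have := (hy _ ha t (hk.ordConnected.out ha hb' ht)).2
      simp only [Pi.add_apply]
      linarith
    exact (h3.continuousAt (Icc_mem_nhds (by linarith) (by linarith))).continuousWithinAt
  obtain ⟨hJo, hJc⟩ := isOpen_image_of_strictMonoOn hk.isOpen hk.ordConnected hm hc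
  refine ⟨hk, isWeight_one hJo hJc, rfl, hm, ?_⟩
  have hmeas : AEMeasurable y (weightMeasure Ω k) :=
    (aemeasurable_restrict_of_monotoneOn hk.isOpen.measurableSet hm.monotoneOn).mono_ac
      (weightMeasure_ac _ _)
  rw [weightMeasure_one]
  -- The image measure lives on `y '' Ω`, so it suffices to compare it with Lebesgue measure on
  -- half-open intervals inside that set.
  have h0 : (weightMeasure Ω k).map y = ((weightMeasure Ω k).map y).restrict (y '' Ω) := by
    symm
    refine Measure.restrict_eq_self_of_ae_mem ?_
    refine (ae_map_iff (p := fun t => t ∈ y '' Ω) hmeas hJo.measurableSet).2 ?_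
    refine (weightMeasure_ac _ _).ae_le ?_
    filter_upwards [ae_restrict_mem hk.isOpen.measurableSet] with x hx
    exact mem_image_of_mem y hx
  rw [h0]
  have key : ∀ c ∈ y '' Ω, ∀ d ∈ y '' Ω, c < d →
      (weightMeasure Ω k).map y (Ioc c d) = ENNReal.ofReal (d - c) := by
    rintro _ ⟨a, ha, rfl⟩ _ ⟨b, hb, rfl⟩ hcd
    rw [Measure.map_apply_of_aemeasurable hmeas measurableSet_Ioc,
      ← hIoc a ha b hb ((hm.lt_iff_lt ha hb).1 hcd), weightMeasure,
      withDensity_apply' _ _, Measure.restrict_restrict₀' hk.isOpen.measurableSet.nullMeasurableSet]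
    congr 2
    ext x
    simp only [mem_inter_iff, mem_preimage, mem_Ioc]
    constructor
    · rintro ⟨⟨h1, h2⟩, hx⟩
      exact ⟨(hm.lt_iff_lt ha hx).1 h1, (hm.le_iff_le hx hb).1 h2⟩
    · rintro ⟨h1, h2⟩
      have hx : x ∈ Ω := hk.ordConnected.out ha hb ⟨h1.le, h2⟩
      exact ⟨⟨hm ha hx h1, (hm.le_iff_le hx hb).2 h2⟩, hx⟩
  refine restrict_eq_of_Ioc hJo hJc ?_ ?_
  · intro c hc d hd hcd
    rw [key c hc d hd hcd]; simp
  · intro c hc d hd hcd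
    rw [key c hc d hd hcd]; simp

/-- A transport to Lebesgue measure is a primitive of the weight. -/
lemma primitive (hT : IsTransport Ω k J (fun _ => 1) y) :
    ∀ a ∈ Ω, ∀ b ∈ Ω, IntervalIntegrable k volume a b ∧ y b - y a = ∫ x in a..b, k x := by
  have key : ∀ a ∈ Ω, ∀ b ∈ Ω, a ≤ b →
      IntervalIntegrable k volume a b ∧ y b - y a = ∫ x in a..b, k x := by
    intro a ha b hb hab
    have hsub : Ioc a b ⊆ Ω := fun x hx => hT.source.ordConnected.out ha hb ⟨hx.1.le, hx.2⟩
    have hle : y a ≤ y b := hT.strictMonoOn.monotoneOn ha hb hab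
    have h1 : ∫⁻ x in Ioc a b, ENNReal.ofReal (k x) = ENNReal.ofReal (y b - y a) := by
      -- Testing the transport on the indicator of the image interval gives the `k`-mass of the
      -- interval itself.
      have h2 := hT.lintegral (F := (Ioc (y a) (y b)).indicator 1)
        ((measurable_one.indicator measurableSet_Ioc).aemeasurable)
      have h3 : ∀ x ∈ Ω, (Ioc (y a) (y b)).indicator (1 : ℝ → ℝ≥0∞) (y x) * ENNReal.ofReal (k x)
          = (Ioc a b).indicator (fun x => ENNReal.ofReal (k x)) x := by
        intro x hx
        by_cases h : x ∈ Ioc a b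
        · have : y x ∈ Ioc (y a) (y b) := ⟨hT.strictMonoOn ha hx h.1,
            (hT.strictMonoOn.le_iff_le hx hb).2 h.2⟩
          simp [h, this]
        · have : y x ∉ Ioc (y a) (y b) := fun h' => h ⟨(hT.strictMonoOn.lt_iff_lt ha hx).1 h'.1,
            (hT.strictMonoOn.le_iff_le hx hb).1 h'.2⟩
          simp [h, this]
      have hsub' : Ioc (y a) (y b) ⊆ J := fun t ht =>
        hT.target.ordConnected.out (hT.mem ha) (hT.mem hb) ⟨ht.1.le, ht.2⟩
      rw [setLIntegral_congr_fun hT.source.isOpen.measurableSet h3,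
        lintegral_indicator measurableSet_Ioc, Measure.restrict_restrict measurableSet_Ioc,
        inter_eq_left.2 hsub] at h2
      rw [h2]
      simp [lintegral_indicator measurableSet_Ioc, Measure.restrict_restrict measurableSet_Ioc,
        inter_eq_left.2 hsub']
    have hint : IntegrableOn k (Ioc a b) := by
      refine ⟨(hT.source.aemeasurable.mono_measure
        (Measure.restrict_mono hsub le_rfl)).aestronglyMeasurable, ?_⟩
      rw [hasFiniteIntegral_iff_ofReal, h1]
      · exact ENNReal.ofReal_lt_top
      · filter_upwards [ae_restrict_mem measurableSet_Ioc] with x hx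
        exact (hT.source.pos x (hsub hx)).le
    refine ⟨(intervalIntegrable_iff_integrableOn_Ioc_of_le hab).2 hint, ?_⟩
    rw [intervalIntegral.integral_of_le hab, integral_eq_lintegral_of_nonneg_ae _ hint.1, h1,
      ENNReal.toReal_ofReal (by linarith)]
    filter_upwards [ae_restrict_mem measurableSet_Ioc] with x hx
    exact (hT.source.pos x (hsub hx)).le
  intro a ha b hb
  rcases le_total a b with h | h
  · exact key a ha b hb h
  · obtain ⟨h1, h2⟩ := key b hb a ha h
    exact ⟨h1.symm, by rw [intervalIntegral.integral_symm]; linarith⟩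

end IsTransport

lemma IsTransport.hasDerivAt {Ω J : Set ℝ} {k y : ℝ → ℝ} (hT : IsTransport Ω k J (fun _ => 1) y)
    (hk : ContinuousOn k Ω) {x : ℝ} (hx : x ∈ Ω) : HasDerivAt y (k x) x := by
  have hp := hT.primitive
  have hn := hT.source.isOpen.mem_nhds hx
  have hd : HasDerivAt (fun u => ∫ s in x..u, k s) (k x) x := by
    refine intervalIntegral.integral_hasDerivAt_right (by simp) ?_ (hk.continuousAt hn)
    exact hk.stronglyMeasurableAtFilter hT.source.isOpen x hx
  refine (hd.add_const (y x)).congr_of_eventuallyEq ?_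
  filter_upwards [hn] with u hu
  have := (hp x hx u hu).2
  linarith

/-! ### The relative escort transformation as a change of variable -/

section Escort

variable {Ω : Set ℝ} {f h y : ℝ → ℝ} {α : ℝ}

lemma isWeight_escort (hf : IsWeight Ω f) (hh : IsWeight Ω h) (a b : ℝ) :
    IsWeight Ω (fun x => f x ^ a * h x ^ b) :=
  ⟨hf.isOpen, hf.ordConnected, (hf.aemeasurable.pow_const a).mul (hh.aemeasurable.pow_const b),
    fun x hx => mul_pos (Real.rpow_pos_of_pos (hf.pos x hx) _)
      (Real.rpow_pos_of_pos (hh.pos x hx) _)⟩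

lemma IsChangeOfVar.isTransport (hy : IsChangeOfVar Ω f h α y) (hf : IsWeight Ω f)
    (hh : IsWeight Ω h) :
    IsTransport Ω (fun x => f x ^ (1 - α) * h x ^ α) (y '' Ω) (fun _ => 1) y :=
  IsTransport.of_primitive (isWeight_escort hf hh _ _) hy

lemma relTransform_apply (hm : StrictMonoOn y Ω) {x : ℝ} (hx : x ∈ Ω) :
    relTransform Ω f h α y (y x) = (f x / h x) ^ α := by
  rw [relTransform, indicator_of_mem (mem_image_of_mem y hx),
    hm.injOn.leftInvOn_invFunOn hx]

lemma relTransform_eq_zero {t : ℝ} (ht : t ∉ y '' Ω) : relTransform Ω f h α y t = 0 :=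
  indicator_of_notMem ht _

lemma relTransform_pos (hm : StrictMonoOn y Ω) (hf : IsWeight Ω f) (hh : IsWeight Ω h) {t : ℝ}
    (ht : t ∈ y '' Ω) : 0 < relTransform Ω f h α y t := by
  obtain ⟨x, hx, rfl⟩ := ht
  rw [relTransform_apply hm hx]
  exact Real.rpow_pos_of_pos (div_pos (hf.pos x hx) (hh.pos x hx)) _

lemma setOf_relTransform_pos (hm : StrictMonoOn y Ω) (hf : IsWeight Ω f) (hh : IsWeight Ω h) :
    {t | 0 < relTransform Ω f h α y t} = y '' Ω := by
  ext t
  refine ⟨fun ht => ?_, fun ht => relTransform_pos hm hf hh ht⟩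
  by_contra h'
  simp [relTransform_eq_zero h'] at ht

lemma aemeasurable_relTransform (hy : IsChangeOfVar Ω f h α y) (hf : IsWeight Ω f)
    (hh : IsWeight Ω h) : AEMeasurable (relTransform Ω f h α y) volume := by
  have hT := hy.isTransport hf hh
  rw [relTransform, aemeasurable_indicator_iff hT.target.isOpen.measurableSet]
  exact hT.symm.comp_aemeasurable ((hf.aemeasurable.div hh.aemeasurable).pow_const α)

/-- Change of variables for the relative differential-escort transformation. -/
lemma lintegral_escort (hy : IsChangeOfVar Ω f h α y) (hf : IsWeight Ω f)
    (hh : IsWeight Ω h) {F : ℝ → ℝ≥0∞} (hF : AEMeasurable F (volume.restrict (y '' Ω))) :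
    ∫⁻ t in y '' Ω, F t = ∫⁻ x in Ω, F (y x) * ENNReal.ofReal (f x ^ (1 - α) * h x ^ α) := by
  rw [(hy.isTransport hf hh).lintegral hF]
  simp

/-- Since dt = f^(1-α) h^α dx, the exponents add up. Three values of `s` matter: 1 gives the
normalization, `l` gives the Rényi integral of order ξ(l, α), and (α-1)/α gives ∫ h. -/
lemma lintegral_relTransform_rpow (hy : IsChangeOfVar Ω f h α y) (hf : IsWeight Ω f)
    (hh : IsWeight Ω h) (s : ℝ) :
    ∫⁻ t in {t | 0 < relTransform Ω f h α y t}, ENNReal.ofReal (relTransform Ω f h α y t ^ s)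
      = ∫⁻ x in Ω, ENNReal.ofReal (f x ^ (1 + α * (s - 1)) * h x ^ (α * (1 - s))) := by
  have hT := hy.isTransport hf hh
  rw [setOf_relTransform_pos hT.strictMonoOn hf hh, lintegral_escort hy hf hh
    ((aemeasurable_relTransform hy hf hh).restrict.pow_const s).ennreal_ofReal]
  refine setLIntegral_congr_fun hf.isOpen.measurableSet fun x hx => ?_
  have hfx := hf.pos x hx
  have hhx := hh.pos x hx
  rw [relTransform_apply hT.strictMonoOn hx, ← ENNReal.ofReal_mul (by positivity)]
  congr 1
  rw [← Real.rpow_mul (by positivity), Real.div_rpow hfx.le hhx.le, div_mul_eq_mul_div,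
    div_eq_iff (by positivity)]
  rw [show f x ^ (α * s) * (f x ^ (1 - α) * h x ^ α) = (f x ^ (α * s) * f x ^ (1 - α)) * h x ^ α by
    ring, ← Real.rpow_add hfx, mul_assoc, ← Real.rpow_add hhx]
  ring_nf

lemma lintegral_relTransform (hy : IsChangeOfVar Ω f h α y) (hf : IsWeight Ω f)
    (hh : IsWeight Ω h) :
    ∫⁻ t, ENNReal.ofReal (relTransform Ω f h α y t) = ∫⁻ x in Ω, ENNReal.ofReal (f x) := by
  have hT := hy.isTransport hf hh
  have h1 := lintegral_relTransform_rpow hy hf hh 1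
  simp only [Real.rpow_one, sub_self, mul_zero, add_zero, Real.rpow_zero, mul_one] at h1
  rw [← h1, setOf_relTransform_pos hT.strictMonoOn hf hh, setLIntegral_eq_of_support_subset]
  intro t ht
  by_contra h'
  simp [relTransform_eq_zero h'] at ht

lemma hasDerivAt_relTransform (hy : IsChangeOfVar Ω f h α y) (hf : IsWeight Ω f)
    (hh : IsWeight Ω h) (hfd : DifferentiableOn ℝ f Ω) (hhd : DifferentiableOn ℝ h Ω) {x : ℝ}
    (hx : x ∈ Ω) :
    HasDerivAt (relTransform Ω f h α y) (α * (f x / h x) ^ α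
      * deriv (fun s => Real.log (f s / h s)) x / (f x ^ (1 - α) * h x ^ α)) (y x) := by
  have hT := hy.isTransport hf hh
  have hn := hf.isOpen.mem_nhds hx
  have hnJ := hT.target.isOpen.mem_nhds (hT.mem hx)
  have hfx := hf.pos x hx
  have hhx := hh.pos x hx
  have hk : ContinuousOn (fun x => f x ^ (1 - α) * h x ^ α) Ω :=
    (hfd.continuousOn.rpow_const fun z hz => Or.inl (hf.pos z hz).ne').mul
      (hhd.continuousOn.rpow_const fun z hz => Or.inl (hh.pos z hz).ne')
  have hyd := hT.hasDerivAt hk hx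
  have hinv : Function.invFunOn y Ω (y x) = x := hT.strictMonoOn.injOn.leftInvOn_invFunOn hx
  -- The inverse of `y` is continuous as a transport in the other direction, and y' > 0, so it is
  -- differentiable with the reciprocal derivative.
  have hxd : HasDerivAt (Function.invFunOn y Ω) (f x ^ (1 - α) * h x ^ α)⁻¹ (y x) := by
    refine HasDerivAt.of_local_left_inverse (f := y) (hT.symm.continuousOn.continuousAt hnJ)
      (by rwa [hinv]) (by positivity) ?_
    filter_upwards [hnJ] with t ht
    exact Function.invFunOn_eq ht
  have hq : HasDerivAt (fun s => f s / h s) (deriv (fun s => f s / h s) x) x :=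
    (((hfd x hx).differentiableAt hn).div ((hhd x hx).differentiableAt hn) hhx.ne').hasDerivAt
  have hlog : deriv (fun s => Real.log (f s / h s)) x = deriv (fun s => f s / h s) x / (f x / h x) :=
    (hq.log (div_pos hfx hhx).ne').deriv
  have hpow := hq.rpow_const (p := α) (Or.inl (div_pos hfx hhx).ne')
  rw [← hinv] at hpow
  have hc := hpow.comp (y x) hxd
  rw [hinv] at hc
  refine (hc.congr_of_eventuallyEq (f₁ := relTransform Ω f h α y) ?_).congr_deriv ?_
  · filter_upwards [hnJ] with t ht
    simp [relTransform, indicator_of_mem ht]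
  · rw [hlog, Real.rpow_sub (div_pos hfx hhx), Real.rpow_one]
    field_simp

/-- The chain rule gives w^(β-2) w' = α (log(f/h))' f^(αβ-1) h^(-αβ) at t = y(x). The factor α is
the only trace of the derivative of the power, and is the source of the power of α in the final
constant. -/
lemma lintegral_fisher_relTransform (hy : IsChangeOfVar Ω f h α y) (hf : IsWeight Ω f)
    (hh : IsWeight Ω h) (hfd : DifferentiableOn ℝ f Ω) (hhd : DifferentiableOn ℝ h Ω)
    (p β : ℝ) :
    ∫⁻ t in {t | 0 < relTransform Ω f h α y t}, ENNReal.ofReal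
      (|relTransform Ω f h α y t ^ (β - 2) * deriv (relTransform Ω f h α y) t| ^ p
        * relTransform Ω f h α y t)
      = ENNReal.ofReal (|α| ^ p) * ∫⁻ x in Ω, ENNReal.ofReal
    (f x ^ (1 + p * (β * α - 1)) * h x ^ (-(β * α * p))
      * |deriv (fun s => Real.log (f s / h s)) x| ^ p) := by
  have hT := hy.isTransport hf hh
  have hwm := aemeasurable_relTransform hy hf hh
  rw [setOf_relTransform_pos hT.strictMonoOn hf hh, lintegral_escort hy hf hh]
  · rw [← lintegral_const_mul' _ _ ENNReal.ofReal_ne_top]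
    refine setLIntegral_congr_fun hf.isOpen.measurableSet fun x hx => ?_
    have hfx := hf.pos x hx
    have hhx := hh.pos x hx
    rw [(hasDerivAt_relTransform hy hf hh hfd hhd hx).deriv, relTransform_apply hT.strictMonoOn hx,
      ← ENNReal.ofReal_mul (by positivity), ← ENNReal.ofReal_mul (by positivity)]
    congr 1
    set D := deriv (fun s => Real.log (f s / h s)) x
    have e1 : ((f x / h x) ^ α) ^ (β - 2) * (α * (f x / h x) ^ α * D / (f x ^ (1 - α) * h x ^ α))
        = α * D * (f x ^ (α * β - 1) * h x ^ (- (α * β))) := by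
      rw [← Real.rpow_mul (by positivity), Real.div_rpow hfx.le hhx.le, Real.div_rpow hfx.le hhx.le]
      rw [Real.rpow_sub hfx, Real.rpow_sub hfx, Real.rpow_neg hhx.le,
        show α * (β - 2) = α * β - α - α by ring, Real.rpow_sub hfx, Real.rpow_sub hhx,
        Real.rpow_sub hfx, Real.rpow_sub hhx, Real.rpow_one]
      field_simp
    rw [e1, abs_mul, abs_mul, abs_of_pos (show 0 < f x ^ (α * β - 1) * h x ^ (- (α * β)) by positivity),
      Real.mul_rpow (by positivity) (by positivity), Real.mul_rpow (by positivity) (by positivity),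
      Real.mul_rpow (by positivity) (by positivity), ← Real.rpow_mul hfx.le, ← Real.rpow_mul hhx.le,
      Real.div_rpow hfx.le hhx.le]
    rw [show 1 + p * (β * α - 1) = (α * β - 1) * p + 1 by ring, Real.rpow_add hfx, Real.rpow_one,
      show -(β * α * p) = -(α * β) * p by ring, Real.rpow_sub hfx, Real.rpow_one]
    field_simp
  · exact (((((hwm.pow_const _).mul (measurable_deriv _).aemeasurable).norm.pow_const p).mul
      hwm).ennreal_ofReal).restrict

end Escort

/-! ### Distribution functions as transports -/

/-- A missing interior point would confine the interval to one side of it and make its length less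
than 1. -/
lemma eq_Ioo_of_volume_eq_one {J : Set ℝ} (hJo : IsOpen J) (hJc : J.OrdConnected)
    (hsub : J ⊆ Icc 0 1) (hvol : volume J = 1) : J = Ioo 0 1 := by
  apply subset_antisymm
  · rw [← interior_Icc]
    exact interior_maximal hsub hJo
  · intro u hu
    by_contra huJ
    have hlt : volume J < 1 := by
      by_cases h : ∃ v ∈ J, v < u
      · obtain ⟨v, hv, hvu⟩ := h
        have : J ⊆ Icc 0 u := fun z hz => ⟨(hsub hz).1, by
          by_contra hz'
          exact huJ (hJc.out hv hz ⟨hvu.le, (not_le.1 hz').le⟩)⟩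
        calc volume J ≤ volume (Icc 0 u) := measure_mono this
          _ = ENNReal.ofReal u := by simp
          _ < 1 := by simpa using hu.2
      · have : J ⊆ Icc u 1 := fun z hz => ⟨by
          by_contra hz'
          exact h ⟨z, hz, not_le.1 hz'⟩, (hsub hz).2⟩
        calc volume J ≤ volume (Icc u 1) := measure_mono this
          _ = ENNReal.ofReal (1 - u) := by simp
          _ < 1 := by simpa using hu.1
    exact hlt.ne hvol

lemma IsWeight.integrableOn {Ω : Set ℝ} {h : ℝ → ℝ} (hh : IsWeight Ω h)
    (hfin : ∫⁻ x in Ω, ENNReal.ofReal (h x) ≠ ∞) : IntegrableOn h Ω := by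
  refine ⟨hh.aemeasurable.aestronglyMeasurable, ?_⟩
  rw [hasFiniteIntegral_iff_ofReal]
  · exact hfin.lt_top
  · filter_upwards [ae_restrict_mem hh.isOpen.measurableSet] with x hx using (hh.pos x hx).le

/-- The distribution function transports a density to the uniform one. -/
lemma isTransport_cdf {Ω : Set ℝ} {h : ℝ → ℝ} (hh : IsWeight Ω h)
    (h1 : ∫⁻ x in Ω, ENNReal.ofReal (h x) = 1) :
    IsTransport Ω h (Ioo 0 1) (fun _ => 1) (fun x => ∫ s in Ω ∩ Iic x, h s) := by
  have hint : IntegrableOn h Ω := hh.integrableOn (by simp [h1])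
  have htot : ∫ s in Ω, h s = 1 := by
    rw [integral_eq_lintegral_of_nonneg_ae _ hint.1, h1]
    · simp
    · filter_upwards [ae_restrict_mem hh.isOpen.measurableSet] with x hx using (hh.pos x hx).le
  have hprim : ∀ a ∈ Ω, ∀ b ∈ Ω, IntervalIntegrable h volume a b ∧
      (∫ s in Ω ∩ Iic b, h s) - (∫ s in Ω ∩ Iic a, h s) = ∫ x in a..b, h x := by
    have key : ∀ a ∈ Ω, ∀ b ∈ Ω, a ≤ b → IntervalIntegrable h volume a b ∧
        (∫ s in Ω ∩ Iic b, h s) - (∫ s in Ω ∩ Iic a, h s) = ∫ x in a..b, h x := by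
      intro a ha b hb hab
      have hsub : Ioc a b ⊆ Ω := fun x hx => hh.ordConnected.out ha hb ⟨hx.1.le, hx.2⟩
      refine ⟨(intervalIntegrable_iff_integrableOn_Ioc_of_le hab).2 (hint.mono_set hsub), ?_⟩
      rw [intervalIntegral.integral_of_le hab]
      have hd : Ω ∩ Iic b = (Ω ∩ Iic a) ∪ Ioc a b := by
        ext x
        simp only [mem_inter_iff, mem_Iic, mem_union, mem_Ioc]
        constructor
        · rintro ⟨hx, hxb⟩
          rcases le_or_gt x a with h' | h'
          · exact Or.inl ⟨hx, h'⟩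
          · exact Or.inr ⟨h', hxb⟩
        · rintro (⟨hx, hxa⟩ | hx)
          · exact ⟨hx, hxa.trans hab⟩
          · exact ⟨hsub hx, hx.2⟩
      rw [hd, setIntegral_union _ measurableSet_Ioc (hint.mono_set inter_subset_left)
        (hint.mono_set hsub)]
      · ring
      · exact Set.disjoint_left.2 fun x hx hx' => absurd hx.2 (not_le.2 hx'.1)
    intro a ha b hb
    rcases le_total a b with h' | h'
    · exact key a ha b hb h'
    · obtain ⟨h2, h3⟩ := key b hb a ha h'
      exact ⟨h2.symm, by rw [intervalIntegral.integral_symm]; linarith⟩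
  have hT := IsTransport.of_primitive hh hprim
  -- The range is found without limits at the ends of `Ω`: it is an open interval inside [0,1] whose
  -- length is the total mass 1.
  have hJ : (fun x => ∫ s in Ω ∩ Iic x, h s) '' Ω = Ioo 0 1 := by
    refine eq_Ioo_of_volume_eq_one hT.target.isOpen hT.target.ordConnected ?_ ?_
    · rintro _ ⟨x, -, rfl⟩
      have hnn : 0 ≤ᵐ[volume.restrict Ω] h := by
        filter_upwards [ae_restrict_mem hh.isOpen.measurableSet] with x hx using (hh.pos x hx).le
      exact ⟨setIntegral_nonneg (hh.isOpen.measurableSet.inter measurableSet_Iic)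
        fun z hz => (hh.pos z hz.1).le,
        htot ▸ setIntegral_mono_set hint hnn inter_subset_left.eventuallyLE⟩
    · have := hT.lintegral (F := fun _ => 1) aemeasurable_const
      simpa [h1] using this.symm
  rw [hJ] at hT
  exact hT

/-- An increasing transport matches initial segments, hence distribution functions. Together with
injectivity of the target's distribution function this determines the transport. -/
lemma IsTransport.integral_Iic {Ω J : Set ℝ} {k e y : ℝ → ℝ} (hT : IsTransport Ω k J e y) {x : ℝ}
    (hx : x ∈ Ω) : ∫ s in Ω ∩ Iic x, k s = ∫ t in J ∩ Iic (y x), e t := by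
  have h1 : ∀ {A : Set ℝ} {u : ℝ → ℝ}, IsWeight A u → ∀ b : ℝ,
      ∫ s in A ∩ Iic b, u s = (∫⁻ s in A, (Iic b).indicator 1 s * ENNReal.ofReal (u s)).toReal := by
    intro A u hu b
    have hm := hu.isOpen.measurableSet
    rw [integral_eq_lintegral_of_nonneg_ae]
    · rw [inter_comm, ← Measure.restrict_restrict measurableSet_Iic,
        ← lintegral_indicator measurableSet_Iic]
      congr 2
      ext s
      by_cases hs : s ∈ Iic b <;> simp [hs, indicator]
    · filter_upwards [ae_restrict_mem (hm.inter measurableSet_Iic)] with s hs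
      exact (hu.pos s hs.1).le
    · exact (hu.aemeasurable.mono_measure
        (Measure.restrict_mono inter_subset_left le_rfl)).aestronglyMeasurable
  rw [h1 hT.source, h1 hT.target, ← hT.lintegral
    ((measurable_one.indicator measurableSet_Iic).aemeasurable)]
  congr 1
  refine setLIntegral_congr_fun hT.source.isOpen.measurableSet fun z hz => ?_
  have : z ∈ Iic x ↔ y z ∈ Iic (y x) := (hT.strictMonoOn.le_iff_le hz hx).symm
  by_cases hz' : z ∈ Iic x
  · simp [indicator_of_mem hz', indicator_of_mem (this.1 hz')]
  · simp [indicator_of_notMem hz', indicator_of_notMem (fun h' => hz' (this.2 h'))]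

/-! ### Densities on intervals and their scalings -/

/-- `g` is a probability density, positive exactly on an open interval. -/
structure IsIntervalDensity (g : ℝ → ℝ) : Prop where
  isWeight : IsWeight {x | 0 < g x} g
  nonneg : ∀ x, 0 ≤ g x
  lintegral_eq_one : ∫⁻ x, ENNReal.ofReal (g x) = 1

lemma IsIntervalDensity.setLIntegral {g : ℝ → ℝ} (hg : IsIntervalDensity g) :
    ∫⁻ x in {x | 0 < g x}, ENNReal.ofReal (g x) = 1 := by
  rw [← hg.lintegral_eq_one, setLIntegral_eq_of_support_subset]
  intro t ht
  simpa using ht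

lemma IsIntervalDensity.aemeasurable {g : ℝ → ℝ} (hg : IsIntervalDensity g) :
    AEMeasurable g volume := by
  have : g = {x | 0 < g x}.indicator g := by
    ext x
    by_cases hx : 0 < g x
    · rw [indicator_of_mem (show x ∈ {x | 0 < g x} from hx)]
    · rw [indicator_of_notMem (show x ∉ {x | 0 < g x} from hx)]
      exact le_antisymm (not_lt.1 hx) (hg.nonneg x)
  rw [this, aemeasurable_indicator_iff hg.isWeight.isOpen.measurableSet]
  exact hg.isWeight.aemeasurable

lemma lintegral_comp_mul_left' (F : ℝ → ℝ≥0∞) {r : ℝ} (hr : 0 < r) :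
    ∫⁻ t, F (r * t) = ENNReal.ofReal r⁻¹ * ∫⁻ t, F t := by
  have h := Real.map_volume_mul_left hr.ne'
  have h2 : ∫⁻ t, F (r * t) = ∫⁻ t, F t ∂(Measure.map (r * ·) volume) :=
    ((MeasurableEquiv.mulLeft₀ r hr.ne').measurableEmbedding.lintegral_map F).symm
  rw [h2, h, lintegral_smul_measure, abs_of_pos (inv_pos.2 hr), smul_eq_mul]

lemma scaling_pos_iff {g : ℝ → ℝ} {r : ℝ} (hr : 0 < r) (t : ℝ) :
    0 < scaling r g t ↔ 0 < g (r * t) := by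
  simp [scaling, hr]

lemma setOf_scaling_pos {g : ℝ → ℝ} {r : ℝ} (hr : 0 < r) :
    {t | 0 < scaling r g t} = (r * ·) ⁻¹' {t | 0 < g t} := by
  ext t; simp [scaling, hr]

lemma lintegral_scaling_rpow {g : ℝ → ℝ} {r : ℝ} (hr : 0 < r)
    (hgm : MeasurableSet {t | 0 < g t}) (s : ℝ) :
    ∫⁻ t in {t | 0 < scaling r g t}, ENNReal.ofReal (scaling r g t ^ s)
      = ENNReal.ofReal (r ^ (s - 1)) * ∫⁻ t in {t | 0 < g t}, ENNReal.ofReal (g t ^ s) := by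
  have hm : MeasurableSet {t | 0 < scaling r g t} := by
    rw [setOf_scaling_pos hr]; exact (measurable_const_mul r) hgm
  rw [← lintegral_indicator hm, ← lintegral_indicator hgm]
  have h1 : ∀ t, {t | 0 < scaling r g t}.indicator (fun t => ENNReal.ofReal (scaling r g t ^ s)) t
      = ENNReal.ofReal (r ^ s) *
        (fun t => {t | 0 < g t}.indicator (fun t => ENNReal.ofReal (g t ^ s)) t) (r * t) := by
    intro t
    by_cases ht : 0 < g (r * t)
    · have ht' := (scaling_pos_iff hr t).2 ht
      simp only [indicator, mem_ofPred_eq, ht, ht', if_true]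
      rw [← ENNReal.ofReal_mul (by positivity), scaling, Real.mul_rpow hr.le ht.le]
    · have ht' : ¬ 0 < scaling r g t := fun h' => ht ((scaling_pos_iff hr t).1 h')
      simp only [indicator, mem_ofPred_eq, ht, ht', if_false, mul_zero]
  simp_rw [h1]
  rw [lintegral_const_mul' _ _ ENNReal.ofReal_ne_top, lintegral_comp_mul_left' _ hr, ← mul_assoc,
    ← ENNReal.ofReal_mul (by positivity), Real.rpow_sub hr, Real.rpow_one, div_eq_mul_inv]

lemma isWeight_rpow {J : Set ℝ} {g : ℝ → ℝ} (hg : IsWeight J g) (s : ℝ) :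
    IsWeight J (fun x => g x ^ s) :=
  ⟨hg.isOpen, hg.ordConnected, hg.aemeasurable.pow_const s,
    fun x hx => Real.rpow_pos_of_pos (hg.pos x hx) _⟩

lemma aemeasurable_comp_mul_left {g : ℝ → ℝ} (hg : AEMeasurable g volume) {r : ℝ} (hr : r ≠ 0) :
    AEMeasurable (fun t => g (r * t)) volume := by
  refine AEMeasurable.comp_aemeasurable (f := fun t => r * t) ?_ (by fun_prop)
  rw [Real.map_volume_mul_left hr]
  exact hg.smul_measure _

lemma aemeasurable_scaling {g : ℝ → ℝ} (hg : AEMeasurable g volume) {r : ℝ} (hr : r ≠ 0) :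
    AEMeasurable (scaling r g) volume :=
  (aemeasurable_comp_mul_left hg hr).const_mul r

lemma lintegral_scaling {g : ℝ → ℝ} {r : ℝ} (hr : 0 < r) :
    ∫⁻ t, ENNReal.ofReal (scaling r g t) = ∫⁻ t, ENNReal.ofReal (g t) := by
  simp_rw [scaling, ENNReal.ofReal_mul hr.le]
  rw [lintegral_const_mul' _ _ ENNReal.ofReal_ne_top,
    lintegral_comp_mul_left' (fun t => ENNReal.ofReal (g t)) hr, ← mul_assoc,
    ← ENNReal.ofReal_mul hr.le, mul_inv_cancel₀ hr.ne']
  simp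

lemma IsIntervalDensity.scaling {g : ℝ → ℝ} (hg : IsIntervalDensity g) {r : ℝ} (hr : 0 < r) :
    IsIntervalDensity (scaling r g) := by
  refine ⟨⟨?_, ?_, ?_, fun x hx => hx⟩, fun x => mul_nonneg hr.le (hg.nonneg _),
    (lintegral_scaling hr).trans hg.lintegral_eq_one⟩
  · rw [setOf_scaling_pos hr]
    exact hg.isWeight.isOpen.preimage (by fun_prop)
  · rw [setOf_scaling_pos hr]
    exact hg.isWeight.ordConnected.preimage_mono (fun a b hab => by gcongr)
  · exact (aemeasurable_scaling hg.aemeasurable hr.ne').restrict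

lemma IsDensityOn.isWeight {Ω : Set ℝ} {f : ℝ → ℝ} (hf : IsDensityOn Ω f) (hΩo : IsOpen Ω)
    (hΩc : Ω.OrdConnected) : IsWeight Ω f := ⟨hΩo, hΩc, hf.aemeasurable.restrict, hf.pos⟩

/-- An interval is convex and convex sets have null frontier. So the values of a density at the ends
of `Ω`, which `IsDensityOn` leaves free, do not affect its integral. -/
lemma volume_closure_sdiff {Ω : Set ℝ} (hΩc : Ω.OrdConnected) : volume (closure Ω \ Ω) = 0 := by
  refine measure_mono_null (sdiff_subset_sdiff_right interior_subset) ?_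
  exact hΩc.convex.addHaar_frontier volume

lemma setLIntegral_eq_of_zero_off_closure {Ω : Set ℝ} (hΩc : Ω.OrdConnected) {f : ℝ → ℝ}
    (h0 : ∀ x ∉ closure Ω, f x = 0) :
    ∫⁻ x in Ω, ENNReal.ofReal (f x) = ∫⁻ x, ENNReal.ofReal (f x) := by
  have h1 : Ω =ᵐ[volume] closure Ω := by
    refine subset_closure.eventuallyLE.antisymm ?_
    rw [ae_le_set]
    exact volume_closure_sdiff hΩc
  rw [setLIntegral_congr h1, setLIntegral_eq_of_support_subset]
  intro t ht
  by_contra h'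
  simp [h0 t h'] at ht

lemma IsDensityOn.setLIntegral {Ω : Set ℝ} {f : ℝ → ℝ} (hf : IsDensityOn Ω f)
    (hΩc : Ω.OrdConnected) : ∫⁻ x in Ω, ENNReal.ofReal (f x) = 1 :=
  (setLIntegral_eq_of_zero_off_closure hΩc hf.eq_zero).trans hf.lintegral_eq_one

lemma IsIntervalDensity.nonempty {g : ℝ → ℝ} (hg : IsIntervalDensity g) :
    {x | 0 < g x}.Nonempty := by
  rw [nonempty_iff_ne_empty]
  intro h
  have := hg.setLIntegral
  simp [h] at this

lemma IsWeight.lintegral_ne_zero {J : Set ℝ} {k : ℝ → ℝ} (hk : IsWeight J k) (hne : J.Nonempty) :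
    ∫⁻ x in J, ENNReal.ofReal (k x) ≠ 0 := by
  rw [Ne, lintegral_eq_zero_iff' hk.aemeasurable.ennreal_ofReal]
  intro h0
  have : ∀ᵐ x ∂(volume.restrict J), False := by
    filter_upwards [h0, ae_restrict_mem hk.isOpen.measurableSet] with x hx hxJ
    have := hk.pos x hxJ
    simp at hx
    linarith
  rw [ae_iff] at this
  simp only [not_false_eq_true, ofPred_true, Measure.restrict_apply_univ] at this
  exact (hk.isOpen.measure_pos volume hne).ne' this

/-! ### The inverse transformation and its uniqueness -/

section Inverse

variable {Ω : Set ℝ} {h g : ℝ → ℝ} {α : ℝ}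

lemma invScale_pos (hα : 0 < α) (hg : IsIntervalDensity g)
    (hfin : renyiPower ((α - 1) / α) g ≠ ∞) : 0 < invScale α g := by
  refine ENNReal.toReal_pos ?_ hfin
  have h1 : (1 / (1 - (α - 1) / α)) = α := by field_simp; ring
  rw [renyiPower, h1, Ne, ENNReal.rpow_eq_zero_iff_of_pos hα]
  exact (isWeight_rpow hg.isWeight _).lintegral_ne_zero hg.nonempty

/-- With s = (α-1)/α, scaling by r multiplies ∫ g^s by r^(s-1) = r^(-1/α), while the entropy power
is (∫ g^s)^α. The scale is chosen exactly so that the weight G^s has the same total mass as `h`. -/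
lemma lintegral_scaling_invScale (hα : 0 < α) (hg : IsIntervalDensity g)
    (hfin : renyiPower ((α - 1) / α) g ≠ ∞) :
    ∫⁻ t in {t | 0 < scaling (invScale α g) g t},
      ENNReal.ofReal (scaling (invScale α g) g t ^ ((α - 1) / α)) = 1 := by
  have hr := invScale_pos hα hg hfin
  rw [lintegral_scaling_rpow hr hg.isWeight.isOpen.measurableSet]
  have h1 : (1 / (1 - (α - 1) / α)) = α := by field_simp; ring
  have h2 : (α - 1) / α - 1 = -α⁻¹ := by field_simp; ring
  have h3 : ENNReal.ofReal (invScale α g) = renyiPower ((α - 1) / α) g := ENNReal.ofReal_toReal hfin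
  rw [← ENNReal.ofReal_rpow_of_pos hr, h3, h2]
  have h4 := (isWeight_rpow hg.isWeight ((α - 1) / α)).lintegral_ne_zero hg.nonempty
  rw [renyiPower, h1] at hfin ⊢
  rw [← ENNReal.rpow_mul, mul_neg, mul_inv_cancel₀ hα.ne', ENNReal.rpow_neg_one]
  refine ENNReal.inv_mul_cancel h4 fun h' => hfin ?_
  rw [h', ENNReal.top_rpow_of_pos hα]

/-- Both weights have mass 1, so the distribution function of `h` followed by the inverse of that of
G^((α-1)/α) is the wanted map; this is the definition of `invVar`. -/
lemma isTransport_invVar (hα : 0 < α) (hh : IsWeight Ω h)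
    (h1 : ∫⁻ x in Ω, ENNReal.ofReal (h x) = 1) (hg : IsIntervalDensity g)
    (hfin : renyiPower ((α - 1) / α) g ≠ ∞) :
    IsTransport Ω h {t | 0 < scaling (invScale α g) g t}
      (fun t => scaling (invScale α g) g t ^ ((α - 1) / α)) (invVar Ω h α g) := by
  have hG := hg.scaling (invScale_pos hα hg hfin)
  exact (isTransport_cdf hh h1).trans (isTransport_cdf (isWeight_rpow hG.isWeight _)
    (lintegral_scaling_invScale hα hg hfin)).symm

lemma invTransform_apply {x : ℝ} (hx : x ∈ Ω) : invTransform Ω h α g x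
    = scaling (invScale α g) g (invVar Ω h α g x) ^ (1 / α) * h x := indicator_of_mem hx _

/-- Multiplying both weights by G^((1-α)/α) turns the target into Lebesgue measure and, as f =
G(y)^(1/α) h, the source into f^(1-α) h^α. -/
lemma isTransport_invVar_escort (hα : 0 < α) (hh : IsWeight Ω h)
    (h1 : ∫⁻ x in Ω, ENNReal.ofReal (h x) = 1) (hg : IsIntervalDensity g)
    (hfin : renyiPower ((α - 1) / α) g ≠ ∞) :
    IsTransport Ω (fun x => invTransform Ω h α g x ^ (1 - α) * h x ^ α)
      {t | 0 < scaling (invScale α g) g t} (fun _ => 1) (invVar Ω h α g) := by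
  have hG := hg.scaling (invScale_pos hα hg hfin)
  have hT := isTransport_invVar hα hh h1 hg hfin
  refine (hT.mul (isWeight_rpow hG.isWeight ((1 - α) / α)).aemeasurable
    fun t ht => Real.rpow_pos_of_pos ht _).congr ?_ ?_
  · intro x hx
    have hGx : 0 < scaling (invScale α g) g (invVar Ω h α g x) := hT.mem hx
    have hhx := hh.pos x hx
    rw [invTransform_apply hx, Real.mul_rpow (by positivity) hhx.le, ← Real.rpow_mul hGx.le,
      mul_assoc, ← Real.rpow_add hhx, sub_add_cancel, Real.rpow_one, one_div_mul_eq_div]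
  · intro t ht
    rw [← Real.rpow_add ht, ← add_div]
    simp

lemma isChangeOfVar_invVar (hα : 0 < α) (hh : IsWeight Ω h)
    (h1 : ∫⁻ x in Ω, ENNReal.ofReal (h x) = 1) (hg : IsIntervalDensity g)
    (hfin : renyiPower ((α - 1) / α) g ≠ ∞) :
    IsChangeOfVar Ω (invTransform Ω h α g) h α (invVar Ω h α g) :=
  (isTransport_invVar_escort hα hh h1 hg hfin).primitive

lemma invTransform_pos (hα : 0 < α) (hh : IsWeight Ω h)
    (h1 : ∫⁻ x in Ω, ENNReal.ofReal (h x) = 1) (hg : IsIntervalDensity g)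
    (hfin : renyiPower ((α - 1) / α) g ≠ ∞) {x : ℝ} (hx : x ∈ Ω) :
    0 < invTransform Ω h α g x := by
  rw [invTransform_apply hx]
  exact mul_pos (Real.rpow_pos_of_pos ((isTransport_invVar hα hh h1 hg hfin).mem hx) _)
    (hh.pos x hx)

lemma isDensityOn_invTransform (hΩo : IsOpen Ω) (hΩc : Ω.OrdConnected) (hα : 0 < α)
    (hh : IsDensityOn Ω h) (hg : IsIntervalDensity g)
    (hfin : renyiPower ((α - 1) / α) g ≠ ∞) : IsDensityOn Ω (invTransform Ω h α g) := by
  have hw := hh.isWeight hΩo hΩc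
  have h1 := hh.setLIntegral hΩc
  have hG := hg.scaling (invScale_pos hα hg hfin)
  have hT := isTransport_invVar hα hw h1 hg hfin
  have hoff : ∀ x ∉ Ω, invTransform Ω h α g x = 0 := fun x hx => indicator_of_notMem hx _
  refine ⟨?_, fun x => ?_, fun x hx => invTransform_pos hα hw h1 hg hfin hx,
    fun x hx => hoff x fun h' => hx (subset_closure h'), ?_⟩
  · rw [invTransform, aemeasurable_indicator_iff hΩo.measurableSet]
    exact ((hT.comp_aemeasurable hG.isWeight.aemeasurable).pow_const _).mul hw.aemeasurable
  · by_cases hx : x ∈ Ω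
    · exact (invTransform_pos hα hw h1 hg hfin hx).le
    · exact (hoff x hx).ge
  · rw [← setLIntegral_eq_of_zero_off_closure hΩc (fun x hx => hoff x fun h' =>
      hx (subset_closure h')), ← hG.setLIntegral]
    have h2 := hT.lintegral (isWeight_rpow hG.isWeight (1 / α)).aemeasurable.ennreal_ofReal
    refine Eq.trans ?_ (h2.trans ?_)
    · refine setLIntegral_congr_fun hΩo.measurableSet fun x hx => ?_
      have hGx : 0 < scaling (invScale α g) g (invVar Ω h α g x) := hT.mem hx
      rw [invTransform_apply hx, ENNReal.ofReal_mul (by positivity)]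
    · refine setLIntegral_congr_fun hG.isWeight.isOpen.measurableSet fun t ht => ?_
      have ht' : 0 < scaling (invScale α g) g t := ht
      rw [← ENNReal.ofReal_mul (by positivity), ← Real.rpow_add ht', ← add_div]
      simp [hα.ne']

lemma relTransform_invTransform (hα : 0 < α) (hh : IsWeight Ω h)
    (h1 : ∫⁻ x in Ω, ENNReal.ofReal (h x) = 1) (hg : IsIntervalDensity g)
    (hfin : renyiPower ((α - 1) / α) g ≠ ∞) :
    relTransform Ω (invTransform Ω h α g) h α (invVar Ω h α g) = scaling (invScale α g) g := by
  have hG := hg.scaling (invScale_pos hα hg hfin)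
  have hT := isTransport_invVar hα hh h1 hg hfin
  ext t
  by_cases ht : 0 < scaling (invScale α g) g t
  · have : t ∈ invVar Ω h α g '' Ω := by rw [hT.image]; exact ht
    obtain ⟨x, hx, rfl⟩ := this
    rw [relTransform_apply hT.strictMonoOn hx, invTransform_apply hx,
      mul_div_cancel_right₀ _ (hh.pos x hx).ne', ← Real.rpow_mul ht.le, one_div_mul_cancel hα.ne',
      Real.rpow_one]
  · rw [relTransform_eq_zero]
    · exact le_antisymm (hG.nonneg t) (not_lt.1 ht)
    · rw [hT.image]; exact ht

/-- If a point of `J` is missing from the interval `L`, then `L` lies on one side of it, and a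
one-sided neighbourhood of positive length lies in `J \ L`. -/
lemma subset_of_ae_eq_of_isOpen {J L : Set ℝ} (hJo : IsOpen J) (hLc : L.OrdConnected)
    (h : J =ᵐ[volume] L) : J ⊆ L := by
  intro x hx
  by_contra hxL
  obtain ⟨ε, hε, hb⟩ := Metric.isOpen_iff.1 hJo x hx
  have h0 : volume (J \ L) = 0 := (ae_le_set.1 h.le)
  have key : Ioo (x - ε) x ⊆ J \ L ∨ Ioo x (x + ε) ⊆ J \ L := by
    by_contra hcon
    push Not at hcon
    obtain ⟨h1, h2⟩ := hcon
    obtain ⟨u, hu, huJ⟩ := not_subset.1 h1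
    obtain ⟨v, hv, hvJ⟩ := not_subset.1 h2
    have huL : u ∈ L := by
      by_contra h'
      exact huJ ⟨hb (by simp [Real.dist_eq, abs_lt]; constructor <;> linarith [hu.1, hu.2]), h'⟩
    have hvL : v ∈ L := by
      by_contra h'
      exact hvJ ⟨hb (by simp [Real.dist_eq, abs_lt]; constructor <;> linarith [hv.1, hv.2]), h'⟩
    exact hxL (hLc.out huL hvL ⟨hu.2.le, hv.1.le⟩)
  rcases key with h1 | h1
  · have := measure_mono_null h1 h0
    simp at this; linarith
  · have := measure_mono_null h1 h0
    simp at this; linarith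

/-- A density whose transform is a scaling of `g` is the inverse transform of `g`. -/
lemma ae_eq_invTransform (hΩo : IsOpen Ω) (hΩc : Ω.OrdConnected) (hα : 0 < α)
    (hh : IsDensityOn Ω h) (hg : IsIntervalDensity g)
    (hfin : renyiPower ((α - 1) / α) g ≠ ∞) {f y : ℝ → ℝ} (hf : IsDensityOn Ω f)
    (hy : IsChangeOfVar Ω f h α y) {r : ℝ} (hr : 0 < r)
    (hw : relTransform Ω f h α y =ᵐ[volume] scaling r g) :
    ∀ᵐ x ∂(volume.restrict Ω), f x = invTransform Ω h α g x := by
  have hhw := hh.isWeight hΩo hΩc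
  have hfw := hf.isWeight hΩo hΩc
  have hT := hy.isTransport hfw hhw
  have hG := hg.scaling hr
  set G := scaling r g with hGdef
  have hae : (y '' Ω : Set ℝ) =ᵐ[volume] {t | 0 < G t} := by
    rw [← setOf_relTransform_pos (α := α) hT.strictMonoOn hfw hhw]
    filter_upwards [hw] with t ht
    simp only [eq_iff_iff]
    change (0 < relTransform Ω f h α y t ↔ 0 < G t)
    rw [ht]
  have hJ : y '' Ω = {t | 0 < G t} := subset_antisymm
    (subset_of_ae_eq_of_isOpen hT.target.isOpen hG.isWeight.ordConnected hae)
    (subset_of_ae_eq_of_isOpen hG.isWeight.isOpen hT.target.ordConnected hae.symm)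
  have hfG : ∀ᵐ x ∂(volume.restrict Ω), (f x / h x) ^ α = G (y x) := by
    filter_upwards [hT.ae_comp (ae_restrict_of_ae hw), ae_restrict_mem hΩo.measurableSet]
      with x hx hxΩ
    rw [← hx, relTransform_apply hT.strictMonoOn hxΩ]
  -- The total mass of `h` is expressed through the transformed density.
  have hnorm : ∫⁻ t in {t | 0 < G t}, ENNReal.ofReal (G t ^ ((α - 1) / α)) = 1 := by
    have h2 := lintegral_relTransform_rpow hy hfw hhw ((α - 1) / α)
    rw [show 1 + α * ((α - 1) / α - 1) = 0 by field_simp; ring,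
      show α * (1 - (α - 1) / α) = 1 by field_simp; ring] at h2
    simp only [Real.rpow_zero, Real.rpow_one, one_mul] at h2
    rw [hh.setLIntegral hΩc, setOf_relTransform_pos hT.strictMonoOn hfw hhw, hJ] at h2
    rw [← h2]
    refine lintegral_congr_ae ?_
    filter_upwards [ae_restrict_of_ae hw] with t ht
    rw [ht]
  -- The mass of G^((α-1)/α) depends on the scale through the nonzero power r^(-1/α), so mass 1 pins
  -- `r`.
  have hrr : r = invScale α g := by
    have hr' := invScale_pos hα hg hfin
    have h3 := lintegral_scaling_invScale hα hg hfin
    rw [hGdef, lintegral_scaling_rpow hr hg.isWeight.isOpen.measurableSet] at hnorm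
    rw [lintegral_scaling_rpow hr' hg.isWeight.isOpen.measurableSet, ← hnorm] at h3
    have h4 := (isWeight_rpow hg.isWeight ((α - 1) / α)).lintegral_ne_zero hg.nonempty
    have h5 : ∫⁻ t in {t | 0 < g t}, ENNReal.ofReal (g t ^ ((α - 1) / α)) ≠ ∞ := by
      intro h'
      rw [h', ENNReal.mul_top (by simp; positivity)] at hnorm
      simp at hnorm
    rw [ENNReal.mul_left_inj h4 h5, ENNReal.ofReal_eq_ofReal_iff (by positivity) (by positivity)]
      at h3
    have h6 : (α - 1) / α - 1 ≠ 0 := by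
      rw [show (α - 1) / α - 1 = -α⁻¹ by field_simp; ring]
      simp [hα.ne']
    exact (Real.rpow_left_injOn h6 hr'.le hr.le h3).symm
  -- The same `y` transports `h` once both weights are multiplied by w^((α-1)/α) = (f/h)^(α-1).
  have hTh : IsTransport Ω h (y '' Ω) (fun t => relTransform Ω f h α y t ^ ((α - 1) / α)) y := by
    refine (hT.mul (φ := fun t => relTransform Ω f h α y t ^ ((α - 1) / α))
      ((aemeasurable_relTransform hy hfw hhw).restrict.pow_const _)
      fun t ht => Real.rpow_pos_of_pos (relTransform_pos hT.strictMonoOn hfw hhw ht) _).congr ?_ ?_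
    · intro x hx
      have hfx := hfw.pos x hx
      have hhx := hhw.pos x hx
      rw [relTransform_apply hT.strictMonoOn hx, ← Real.rpow_mul (by positivity),
        mul_div_cancel₀ _ hα.ne', Real.div_rpow hfx.le hhx.le, Real.rpow_sub hfx, Real.rpow_sub hfx,
        Real.rpow_sub hhx, Real.rpow_one, Real.rpow_one]
      field_simp
    · intro t _
      simp
  -- The weight transported to has a strictly increasing distribution function, so `y`, and with it
  -- the translation, is forced.
  have hyv : ∀ x ∈ Ω, y x = invVar Ω h α g x := by
    intro x hx
    have hE := isTransport_cdf (isWeight_rpow hG.isWeight ((α - 1) / α)) hnorm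
    have h1 : ∫ s in Ω ∩ Iic x, h s = ∫ t in {t | 0 < G t} ∩ Iic (y x), G t ^ ((α - 1) / α) := by
      rw [hTh.integral_Iic hx, hJ]
      refine integral_congr_ae ?_
      filter_upwards [ae_restrict_of_ae hw] with t ht
      rw [ht]
    rw [invVar, ← hrr, h1]
    exact (hE.strictMonoOn.injOn.leftInvOn_invFunOn (hJ ▸ hT.mem hx)).symm
  filter_upwards [hfG, ae_restrict_mem hΩo.measurableSet] with x hx hxΩ
  rw [invTransform_apply hxΩ, ← hyv x hxΩ, ← hrr, ← hGdef, ← hx, ← Real.rpow_mul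
    (div_pos (hfw.pos x hxΩ) (hhw.pos x hxΩ)).le, mul_one_div_cancel hα.ne', Real.rpow_one,
    div_mul_cancel₀ _ (hhw.pos x hxΩ).ne']

end Inverse

/-! ### The profile of the stretched Gaussian -/

lemma integrable_of_even_of_integrableOn {f : ℝ → ℝ} (hev : ∀ x, f (-x) = f x)
    (hf : IntegrableOn f (Ioi 0)) : Integrable f := by
  have h1 : Integrable ((Ioi 0).indicator f) := (integrable_indicator_iff measurableSet_Ioi).2 hf
  refine (h1.add h1.comp_neg).congr ?_
  have h0 : ∀ᵐ x : ℝ, x ≠ 0 := by simp [ae_iff]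
  filter_upwards [h0] with x hx
  rcases lt_or_gt_of_ne hx with h | h
  · simp [indicator, h, h.le, hev]
  · simp [indicator, h, h.le]

/-- The function whose positive part is the `(l-1)`-th power of the stretched profile. -/
noncomputable def profileBase (q l x : ℝ) : ℝ :=
  if q = 0 then -Real.log |x| else 1 - (l - 1) * |x| ^ q

lemma stretchedProfile_ofReal {q l : ℝ} (hq : 0 ≤ q) (hl : l ≠ 1) {x : ℝ} (hx : q = 0 → x ≠ 0) :
    stretchedProfile (ENNReal.ofReal q) l x = max (profileBase q l x) 0 ^ (1 / (l - 1)) := by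
  rw [stretchedProfile, if_neg ENNReal.ofReal_ne_top]
  by_cases h0 : q = 0
  · simp [h0, hx h0, profileBase]
  · have hq' : 0 < q := lt_of_le_of_ne hq (Ne.symm h0)
    rw [if_neg (by simpa using hq'), tsallisExp, if_neg (by intro h; apply hl; linarith),
      ENNReal.toReal_ofReal hq, profileBase, if_neg h0]
    congr 1
    · ring_nf
    · ring_nf

lemma stretchedProfile_zero_zero (l : ℝ) : stretchedProfile (ENNReal.ofReal 0) l 0 = 1 := by
  simp [stretchedProfile]

lemma integrable_one_add_mul_rpow {k q m : ℝ} (hk : 0 < k) (hq : 0 < q) (hm : 0 < m)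
    (hqm : 1 < q * m) : Integrable (fun x : ℝ => (1 + k * |x| ^ q) ^ (-m)) := by
  have h1 : Integrable (fun x : ℝ => (1 + ‖x‖) ^ (-(q * m))) :=
    integrable_one_add_norm (by simpa using hqm)
  -- The first factor comes from (1+|x|)^q ≤ 2^q (1+|x|^q), the second from 1+|x|^q ≤
  -- (1+1/k)(1+k|x|^q).
  set C : ℝ := 2 ^ q * (1 + 1 / k) with hC
  have hCpos : 0 < C := by positivity
  refine (h1.const_mul (C ^ m)).mono' ?_ ?_
  · exact (by fun_prop : Measurable fun x : ℝ => (1 + k * |x| ^ q) ^ (-m)).aestronglyMeasurable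
  · refine Filter.Eventually.of_forall fun x => ?_
    have hx : 0 ≤ |x| := abs_nonneg x
    have hp : 0 ≤ |x| ^ q := by positivity
    rw [Real.norm_of_nonneg (by positivity), Real.norm_eq_abs]
    have hb : (1 + |x|) ^ q ≤ C * (1 + k * |x| ^ q) := by
      have h2 : (1 + |x|) ^ q ≤ 2 ^ q * (1 + |x| ^ q) := by
        rcases le_total |x| 1 with h | h
        · calc (1 + |x|) ^ q ≤ 2 ^ q := by gcongr; linarith
            _ ≤ 2 ^ q * (1 + |x| ^ q) := le_mul_of_one_le_right (by positivity) (by linarith)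
        · calc (1 + |x|) ^ q ≤ (2 * |x|) ^ q := by gcongr; linarith
            _ = 2 ^ q * |x| ^ q := Real.mul_rpow (by norm_num) hx
            _ ≤ 2 ^ q * (1 + |x| ^ q) := by gcongr; linarith
      refine h2.trans ?_
      rw [hC, mul_assoc]
      gcongr
      have : (1 + 1 / k) * (1 + k * |x| ^ q) = 1 + |x| ^ q + 1 / k + k * |x| ^ q := by
        field_simp; ring
      rw [this]
      have : 0 ≤ 1 / k + k * |x| ^ q := by positivity
      linarith
    rw [Real.rpow_neg (by positivity), Real.rpow_neg (by positivity), ← div_eq_mul_inv,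
      inv_eq_one_div, div_le_div_iff₀ (by positivity) (by positivity), one_mul]
    calc (1 + |x|) ^ (q * m) = ((1 + |x|) ^ q) ^ m := Real.rpow_mul (by positivity) _ _
      _ ≤ (C * (1 + k * |x| ^ q)) ^ m := by gcongr
      _ = C ^ m * (1 + k * |x| ^ q) ^ m := Real.mul_rpow hCpos.le (by positivity)

lemma integrable_neg_log_rpow {s : ℝ} (hs : 0 < s) :
    Integrable (fun x : ℝ => max (-Real.log |x|) 0 ^ s) := by
  refine integrable_of_even_of_integrableOn (by simp) ?_
  have h1 : IntegrableOn (fun x : ℝ => (2 * s) ^ s * x ^ (-(1 / 2) : ℝ)) (Ioo 0 1) :=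
    ((intervalIntegral.integrableOn_Ioo_rpow_iff one_pos).2 (by norm_num)).const_mul _
  have hmeas : Measurable (fun x : ℝ => max (-Real.log |x|) 0 ^ s) := by
    have : Measurable fun x : ℝ => Real.log |x| := Real.measurable_log.comp measurable_abs
    fun_prop
  have h2 : IntegrableOn (fun x : ℝ => max (-Real.log |x|) 0 ^ s) (Ioo 0 1) := by
    refine h1.mono' hmeas.aestronglyMeasurable ?_
    filter_upwards [ae_restrict_mem measurableSet_Ioo] with x hx
    have hx0 := hx.1
    have hlog : 0 ≤ -Real.log x := by linarith [Real.log_nonpos hx.1.le hx.2.le]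
    rw [abs_of_pos hx.1, max_eq_left hlog, Real.norm_of_nonneg (by positivity)]
    -- The exponent 1/(2s) is chosen so that the s-th power is a multiple of the integrable function
    -- x^(-1/2).
    have h3 : -Real.log x ≤ (2 * s) * x ^ (-(1 / (2 * s))) := by
      have := Real.log_le_rpow_div (x := x⁻¹) (by positivity) (show 0 < 1 / (2 * s) by positivity)
      rw [Real.log_inv, Real.inv_rpow hx.1.le, ← Real.rpow_neg hx.1.le] at this
      calc _ ≤ _ := this
        _ = _ := by field_simp
    calc (-Real.log x) ^ s ≤ ((2 * s) * x ^ (-(1 / (2 * s)))) ^ s := by gcongr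
      _ = (2 * s) ^ s * x ^ (-(1 / 2) : ℝ) := by
        rw [Real.mul_rpow (by positivity) (by positivity), ← Real.rpow_mul hx.1.le]
        congr 2
        field_simp
  have h3 : (fun x : ℝ => max (-Real.log |x|) 0 ^ s) =
      (Ioo (-1) 1).indicator (fun x : ℝ => max (-Real.log |x|) 0 ^ s) := by
    ext x
    by_cases hx : x ∈ Ioo (-1 : ℝ) 1
    · rw [indicator_of_mem hx]
    · rw [indicator_of_notMem hx]
      have : 1 ≤ |x| := by
        by_contra h
        exact hx (abs_lt.1 (not_le.1 h))
      rw [max_eq_right (by linarith [Real.log_nonneg this]), Real.zero_rpow hs.ne']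
  rw [h3, integrableOn_indicator_iff measurableSet_Ioo]
  refine h2.mono_set ?_
  rintro x ⟨hx, hx'⟩
  exact ⟨hx', hx.2⟩

/-- Parameters for which the stretched Gaussian `g_{p,l}` with `q = p^*` is integrable. -/
structure IsProfileParam (q l : ℝ) : Prop where
  nonneg : 0 ≤ q
  lt : 1 / (1 + q) < l
  ne_one : l ≠ 1

namespace IsProfileParam

variable {q l : ℝ}

lemma pos (hp : IsProfileParam q l) : 0 < l :=
  lt_of_le_of_lt (by have := hp.nonneg; positivity) hp.lt

lemma one_lt (hp : IsProfileParam q l) (h0 : q = 0) : 1 < l := by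
  have := hp.lt
  rw [h0] at this
  simpa using this

lemma sub_ne (hp : IsProfileParam q l) : l - 1 ≠ 0 := sub_ne_zero.2 hp.ne_one

lemma one_lt_mul (hp : IsProfileParam q l) : 1 < l * (1 + q) :=
  (div_lt_iff₀ (by linarith [hp.nonneg])).1 hp.lt

lemma q_pos (hp : IsProfileParam q l) (hl : l < 1) : 0 < q :=
  lt_of_le_of_ne hp.nonneg fun h => absurd (hp.one_lt h.symm) (not_lt.2 hl.le)

lemma profileBase_pos (hp : IsProfileParam q l) (hl : l < 1) (x : ℝ) : 0 < profileBase q l x := by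
  rw [profileBase, if_neg (hp.q_pos hl).ne']
  have : 0 ≤ (1 - l) * |x| ^ q := mul_nonneg (by linarith) (by positivity)
  linarith

lemma ae_eq (hp : IsProfileParam q l) : ∀ᵐ x, stretchedProfile (ENNReal.ofReal q) l x
    = max (profileBase q l x) 0 ^ (1 / (l - 1)) := by
  have h0 : ∀ᵐ x : ℝ, x ≠ 0 := by simp [ae_iff]
  filter_upwards [h0] with x hx using stretchedProfile_ofReal hp.nonneg hp.ne_one fun _ => hx

lemma nonneg_profile (hp : IsProfileParam q l) (x : ℝ) :
    0 ≤ stretchedProfile (ENNReal.ofReal q) l x := by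
  by_cases h : q = 0 → x ≠ 0
  · rw [stretchedProfile_ofReal hp.nonneg hp.ne_one h]; positivity
  · push Not at h
    rw [h.1, h.2, stretchedProfile_zero_zero]; norm_num

lemma profile_pos_iff (hp : IsProfileParam q l) {x : ℝ} (hx : q = 0 → x ≠ 0) :
    0 < stretchedProfile (ENNReal.ofReal q) l x ↔ 0 < profileBase q l x := by
  rw [stretchedProfile_ofReal hp.nonneg hp.ne_one hx]
  constructor
  · intro h
    by_contra h'
    rw [max_eq_right (not_lt.1 h'), Real.zero_rpow (one_div_ne_zero hp.sub_ne)] at h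
    exact lt_irrefl _ h
  · intro h
    rw [max_eq_left h.le]; positivity

lemma measurable_profileBase (q l : ℝ) : Measurable (profileBase q l) := by
  unfold profileBase
  have : Measurable fun x : ℝ => Real.log |x| := Real.measurable_log.comp measurable_abs
  split_ifs <;> fun_prop

lemma isOpen_ordConnected (hp : IsProfileParam q l) :
    IsOpen {x | 0 < stretchedProfile (ENNReal.ofReal q) l x} ∧
    {x | 0 < stretchedProfile (ENNReal.ofReal q) l x}.OrdConnected ∧
    (0 : ℝ) ∈ {x | 0 < stretchedProfile (ENNReal.ofReal q) l x} := by
  by_cases h0 : q = 0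
  · have : {x | 0 < stretchedProfile (ENNReal.ofReal q) l x} = Ioo (-1) 1 := by
      ext x
      simp only [mem_ofPred_eq]
      -- For q = 0 the arbitrary positive value of the profile at the origin keeps its positivity
      -- set an interval containing 0.
      by_cases hx : x = 0
      · simp [hx, h0, stretchedProfile]
      · rw [hp.profile_pos_iff fun _ => hx, profileBase, if_pos h0, mem_Ioo, ← abs_lt, neg_pos,
          Real.log_neg_iff (abs_pos.2 hx)]
    rw [this]
    exact ⟨isOpen_Ioo, ordConnected_Ioo, by simp⟩
  · have hq : 0 < q := lt_of_le_of_ne hp.nonneg (Ne.symm h0)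
    have : {x | 0 < stretchedProfile (ENNReal.ofReal q) l x} = {x | (l - 1) * |x| ^ q < 1} := by
      ext x
      rw [mem_ofPred_eq, hp.profile_pos_iff (fun h => absurd h h0), profileBase, if_neg h0]
      simp [sub_pos]
    rw [this]
    refine ⟨isOpen_lt ?_ continuous_const, ⟨fun a ha b hb x hx => ?_⟩, by simp [hq.ne']⟩
    · exact continuous_const.mul (continuous_abs.rpow_const fun _ => Or.inr hq.le)
    · simp only [mem_ofPred_eq] at *
      rcases le_total l 1 with hl | hl
      · have : (l - 1) * |x| ^ q ≤ 0 := mul_nonpos_of_nonpos_of_nonneg (by linarith) (by positivity)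
        linarith
      · have hl' : 0 ≤ l - 1 := by linarith
        rcases le_total x 0 with h | h
        · have : |x| ≤ |a| := by
            rw [abs_of_nonpos h, abs_of_nonpos (hx.1.trans h)]; linarith [hx.1]
          calc _ ≤ (l - 1) * |a| ^ q := by gcongr
            _ < 1 := ha
        · have : |x| ≤ |b| := by
            rw [abs_of_nonneg h, abs_of_nonneg (h.trans hx.2)]; linarith [hx.2]
          calc _ ≤ (l - 1) * |b| ^ q := by gcongr
            _ < 1 := hb

lemma ae_rpow_eq (hp : IsProfileParam q l) (s : ℝ) :
    ∀ᵐ x, stretchedProfile (ENNReal.ofReal q) l x ^ s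
      = max (profileBase q l x) 0 ^ (s / (l - 1)) := by
  filter_upwards [hp.ae_eq] with x hx
  rw [hx, ← Real.rpow_mul (le_max_right _ _), one_div_mul_eq_div]

/-- For l < 1 the profile has power tails, of order -qs/(1-l) for its s-th power, and the hypothesis
makes this order less than -1. For l > 1 the support is bounded, and only the logarithmic
singularity at q = 0 needs attention. -/
lemma integrable_rpow (hp : IsProfileParam q l) {s : ℝ} (hs : 0 < s) (hs' : 1 - l < q * s) :
    Integrable (fun x => stretchedProfile (ENNReal.ofReal q) l x ^ s) := by
  refine Integrable.congr ?_ ((hp.ae_rpow_eq s).mono fun x hx => hx.symm)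
  rcases lt_or_gt_of_ne hp.ne_one with hl | hl
  · have hq := hp.q_pos hl
    have h1 := integrable_one_add_mul_rpow (k := 1 - l) (m := s / (1 - l)) (by linarith) hq
      (div_pos hs (by linarith)) (by rw [← mul_div_assoc, lt_div_iff₀ (by linarith)]; linarith)
    refine h1.congr (Filter.Eventually.of_forall fun x => ?_)
    simp only
    rw [max_eq_left (hp.profileBase_pos hl x).le, profileBase, if_neg hq.ne']
    congr 1
    · ring
    · rw [← neg_sub 1 l, div_neg]
  · have hl' : 0 < l - 1 := by linarith
    by_cases h0 : q = 0
    · simp only [profileBase, h0, if_true]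
      exact integrable_neg_log_rpow (div_pos hs hl')
    · have hq : 0 < q := lt_of_le_of_ne hp.nonneg (Ne.symm h0)
      have hmeas : Measurable fun x => max (profileBase q l x) 0 ^ (s / (l - 1)) := by
        have := measurable_profileBase q l
        fun_prop
      set R := (1 / (l - 1)) ^ (1 / q) with hR
      have h1 : (fun x => max (profileBase q l x) 0 ^ (s / (l - 1))) =
          (Icc (-R) R).indicator (fun x => max (profileBase q l x) 0 ^ (s / (l - 1))) := by
        ext x
        by_cases hx : x ∈ Icc (-R) R
        · rw [indicator_of_mem hx]
        · rw [indicator_of_notMem hx]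
          have h2 : R < |x| := by
            by_contra h
            exact hx (abs_le.1 (not_lt.1 h))
          have h3 : 1 / (l - 1) ≤ |x| ^ q := by
            calc 1 / (l - 1) = R ^ q := by
                  rw [hR, ← Real.rpow_mul (by positivity), one_div_mul_cancel h0, Real.rpow_one]
              _ ≤ |x| ^ q := by gcongr
          rw [div_le_iff₀ hl'] at h3
          rw [max_eq_right, Real.zero_rpow (div_pos hs hl').ne']
          rw [profileBase, if_neg h0]
          linarith
      rw [h1, integrable_indicator_iff measurableSet_Icc]
      refine Measure.integrableOn_of_bounded (M := 1) (by simp) hmeas.aestronglyMeasurable ?_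
      refine Filter.Eventually.of_forall fun x => ?_
      rw [Real.norm_of_nonneg (by positivity)]
      refine Real.rpow_le_one (le_max_right _ _) (max_le ?_ zero_le_one) (div_pos hs hl').le
      rw [profileBase, if_neg h0]
      have : 0 ≤ (l - 1) * |x| ^ q := by positivity
      linarith

lemma integrable_profile (hp : IsProfileParam q l) :
    Integrable (stretchedProfile (ENNReal.ofReal q) l) := by
  have h := hp.integrable_rpow (s := 1) one_pos (by
    have := hp.one_lt_mul
    rcases lt_or_gt_of_ne hp.ne_one with hl | hl
    · nlinarith [hp.q_pos hl]
    · nlinarith [hp.nonneg])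
  simpa using h

/-- For s = l the tail condition 1 - l < q l is exactly the assumption l > 1/(1+q). -/
lemma integrable_profile_rpow (hp : IsProfileParam q l) :
    Integrable (fun x => stretchedProfile (ENNReal.ofReal q) l x ^ l) :=
  hp.integrable_rpow hp.pos (by linarith [hp.one_lt_mul])

lemma integral_profile_pos (hp : IsProfileParam q l) :
    0 < ∫ x, stretchedProfile (ENNReal.ofReal q) l x := by
  rw [integral_pos_iff_support_of_nonneg hp.nonneg_profile hp.integrable_profile]
  obtain ⟨ho, -, h0⟩ := hp.isOpen_ordConnected
  refine (ho.measure_pos volume ⟨0, h0⟩).trans_le (measure_mono fun x hx => ?_)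
  exact (show 0 < stretchedProfile (ENNReal.ofReal q) l x from hx).ne'

lemma setOf_gaussian_pos (hp : IsProfileParam q l) :
    {x | 0 < stretchedGaussian (ENNReal.ofReal q) l x}
      = {x | 0 < stretchedProfile (ENNReal.ofReal q) l x} := by
  ext x
  simp only [mem_ofPred_eq, stretchedGaussian]
  exact div_pos_iff_of_pos_right hp.integral_profile_pos

lemma gaussian_nonneg (hp : IsProfileParam q l) (x : ℝ) :
    0 ≤ stretchedGaussian (ENNReal.ofReal q) l x :=
  div_nonneg (hp.nonneg_profile x) hp.integral_profile_pos.le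

lemma integrable_gaussian (hp : IsProfileParam q l) :
    Integrable (stretchedGaussian (ENNReal.ofReal q) l) := hp.integrable_profile.div_const _

lemma integral_gaussian (hp : IsProfileParam q l) :
    ∫ x, stretchedGaussian (ENNReal.ofReal q) l x = 1 := by
  simp only [stretchedGaussian]
  rw [integral_div, div_self hp.integral_profile_pos.ne']

lemma isIntervalDensity (hp : IsProfileParam q l) :
    IsIntervalDensity (stretchedGaussian (ENNReal.ofReal q) l) := by
  obtain ⟨ho, hc, -⟩ := hp.isOpen_ordConnected
  refine ⟨⟨?_, ?_, ?_, fun x hx => hx⟩, hp.gaussian_nonneg, ?_⟩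
  · rwa [hp.setOf_gaussian_pos]
  · rwa [hp.setOf_gaussian_pos]
  · exact hp.integrable_gaussian.aemeasurable.restrict
  · rw [← ofReal_integral_eq_lintegral_ofReal hp.integrable_gaussian
      (Filter.Eventually.of_forall hp.gaussian_nonneg), hp.integral_gaussian]
    simp

lemma integrable_gaussian_rpow (hp : IsProfileParam q l) :
    Integrable (fun x => stretchedGaussian (ENNReal.ofReal q) l x ^ l) := by
  refine (hp.integrable_profile_rpow.div_const
    ((∫ s, stretchedProfile (ENNReal.ofReal q) l s) ^ l)).congr
    (Filter.Eventually.of_forall fun x => ?_)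
  simp only [stretchedGaussian]
  rw [Real.div_rpow (hp.nonneg_profile x) hp.integral_profile_pos.le]

/-- The relation between the Gaussian and its base. -/
lemma gaussian_base (hp : IsProfileParam q l) : ∃ k > 0, ∀ᵐ x,
    (0 < stretchedGaussian (ENNReal.ofReal q) l x ∧
      stretchedGaussian (ENNReal.ofReal q) l x ^ (l - 1) = k * profileBase q l x) ∨
    (stretchedGaussian (ENNReal.ofReal q) l x = 0 ∧ profileBase q l x ≤ 0 ∧ 1 < l) := by
  have hZ := hp.integral_profile_pos
  refine ⟨((∫ s, stretchedProfile (ENNReal.ofReal q) l s) ^ (l - 1))⁻¹, by positivity, ?_⟩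
  have h0 : ∀ᵐ x : ℝ, x ≠ 0 := by simp [ae_iff]
  filter_upwards [h0] with x hx
  by_cases hb : 0 < profileBase q l x
  · left
    have hP := (hp.profile_pos_iff fun _ => hx).2 hb
    refine ⟨div_pos hP hZ, ?_⟩
    rw [stretchedGaussian, Real.div_rpow hP.le hZ.le,
      stretchedProfile_ofReal hp.nonneg hp.ne_one fun _ => hx, max_eq_left hb.le,
      ← Real.rpow_mul hb.le, one_div_mul_cancel hp.sub_ne, Real.rpow_one, div_eq_inv_mul]
  · right
    refine ⟨?_, not_lt.1 hb, ?_⟩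
    · rw [stretchedGaussian, stretchedProfile_ofReal hp.nonneg hp.ne_one fun _ => hx,
        max_eq_right (not_lt.1 hb), Real.zero_rpow (one_div_ne_zero hp.sub_ne), zero_div]
    · by_contra h
      exact hb (hp.profileBase_pos (lt_of_le_of_ne (not_lt.1 h) hp.ne_one) x)

/-- Where g is positive, Φ g is a multiple of g^l, so the moment of the Gaussian is finite because
g^l is integrable. -/
lemma integrable_base_mul_gaussian (hp : IsProfileParam q l) :
    Integrable (fun x => profileBase q l x * stretchedGaussian (ENNReal.ofReal q) l x) := by
  obtain ⟨k, hk, hae⟩ := hp.gaussian_base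
  refine (hp.integrable_gaussian_rpow.const_mul k⁻¹).congr ?_
  filter_upwards [hae] with x hx
  rcases hx with ⟨h1, h2⟩ | ⟨h1, -, -⟩
  · have : stretchedGaussian (ENNReal.ofReal q) l x ^ l
      = stretchedGaussian (ENNReal.ofReal q) l x ^ (l - 1) * stretchedGaussian (ENNReal.ofReal q) l x := by
      rw [← Real.rpow_add_one h1.ne', sub_add_cancel]
    rw [this, h2]
    field_simp
  · rw [h1, Real.zero_rpow hp.pos.ne']; simp

end IsProfileParam

/-! ### The moment-entropy inequality -/

/-- Bernoulli's inequality in Bregman form. -/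
lemma bregman_nonneg {l a b : ℝ} (hl0 : 0 < l) (hl : l ≠ 1) (ha : 0 ≤ a) (hb : 0 < b) :
    0 ≤ (l - 1) * (a ^ l - b ^ l - l * b ^ (l - 1) * (a - b)) ∧
    ((l - 1) * (a ^ l - b ^ l - l * b ^ (l - 1) * (a - b)) = 0 → a = b) := by
  set s := a / b - 1 with hs
  have hs1 : -1 ≤ s := by have : 0 ≤ a / b := by positivity
                          linarith
  have hab : a = b * (1 + s) := by rw [hs]; field_simp; ring
  have hbl : 0 < b ^ l := by positivity
  have hbl1 : b ^ (l - 1) * b = b ^ l := by rw [← Real.rpow_add_one hb.ne', sub_add_cancel]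
  -- Writing a = b(1+s) reduces to Bernoulli's inequality, whose direction changes at l = 1; the
  -- factor l - 1 absorbs the change.
  have key : (l - 1) * (a ^ l - b ^ l - l * b ^ (l - 1) * (a - b))
      = b ^ l * ((l - 1) * ((1 + s) ^ l - (1 + l * s))) := by
    rw [hab, Real.mul_rpow hb.le (by linarith), ← hbl1]
    ring
  rw [key]
  by_cases h0 : s = 0
  · simp [h0, hab]
  · have hpos : 0 < (l - 1) * ((1 + s) ^ l - (1 + l * s)) := by
      rcases lt_or_gt_of_ne hl with h | h
      · have := rpow_one_add_lt_one_add_mul_self hs1 h0 hl0 h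
        exact mul_pos_of_neg_of_neg (by linarith) (by linarith)
      · have := one_add_mul_self_lt_rpow_one_add hs1 h0 h
        exact mul_pos (by linarith) (by linarith)
    have := mul_pos hbl hpos
    exact ⟨this.le, fun h => absurd h this.ne'⟩

/-- If `g^(l-1)` is proportional to the positive part of `Φ` then `g` extremizes `∫ w^l` among
the densities with given `∫ Φ w`. -/
lemma integral_rpow_extremal {l k : ℝ} (hl0 : 0 < l) (hl : l ≠ 1) (hk : 0 < k)
    {Φ w g : ℝ → ℝ} (hw : ∀ x, 0 ≤ w x)
    (hg : ∀ᵐ x, (0 < g x ∧ g x ^ (l - 1) = k * Φ x) ∨ (g x = 0 ∧ Φ x ≤ 0 ∧ 1 < l))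
    (hwl : Integrable fun x => w x ^ l) (hgl : Integrable fun x => g x ^ l)
    (hΦw : Integrable fun x => Φ x * w x) (hΦg : Integrable fun x => Φ x * g x)
    (heq : ∫ x, Φ x * w x = ∫ x, Φ x * g x) :
    0 ≤ (l - 1) * ((∫ x, w x ^ l) - ∫ x, g x ^ l) ∧
    ((∫ x, w x ^ l) = (∫ x, g x ^ l) → w =ᵐ[volume] g) := by
  -- The Bregman gap with g^(l-1) replaced by kΦ. The linear term integrates to zero because w and g
  -- have the same integral against Φ.
  set d : ℝ → ℝ := fun x => (l - 1) * (w x ^ l - g x ^ l - l * k * (Φ x * w x - Φ x * g x)) with hd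
  have hdint : Integrable d := ((hwl.sub hgl).sub ((hΦw.sub hΦg).const_mul (l * k))).const_mul _
  have hdi : ∫ x, d x = (l - 1) * ((∫ x, w x ^ l) - ∫ x, g x ^ l) := by
    rw [hd, integral_const_mul, integral_sub, integral_sub hwl hgl, integral_const_mul,
      integral_sub hΦw hΦg, heq]
    · simp
    · exact hwl.sub hgl
    · exact (hΦw.sub hΦg).const_mul (l * k)
  have hpt : ∀ᵐ x, 0 ≤ d x ∧ (d x = 0 → w x = g x) := by
    filter_upwards [hg] with x hx
    rcases hx with ⟨h1, h2⟩ | ⟨h1, h2, h3⟩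
    · have := bregman_nonneg hl0 hl (hw x) h1
      rw [h2] at this
      have e : d x = (l - 1) * (w x ^ l - g x ^ l - l * (k * Φ x) * (w x - g x)) := by
        simp only [hd]; ring
      rwa [e]
    -- Off the support of g the replacement is not an identity, but there Φ ≤ 0 and l > 1, so the
    -- extra term has the right sign.
    · have e : d x = (l - 1) * (w x ^ l) + (l - 1) * (l * k * (-Φ x) * w x) := by
        simp only [hd, h1, Real.zero_rpow hl0.ne']; ring
      have hwl' := Real.rpow_nonneg (hw x) l
      have h4 : 0 ≤ (l - 1) * (w x ^ l) := mul_nonneg (by linarith) hwl'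
      have h5 : 0 ≤ (l - 1) * (l * k * (-Φ x) * w x) :=
        mul_nonneg (by linarith) (mul_nonneg (mul_nonneg (by positivity) (by linarith)) (hw x))
      rw [e]
      refine ⟨by linarith, fun h => ?_⟩
      have h6 : (l - 1) * (w x ^ l) = 0 := by linarith
      rcases mul_eq_zero.1 h6 with h7 | h7
      · linarith
      · rw [h1]; exact ((Real.rpow_eq_zero (hw x) hl0.ne').1 h7)
  have hnn : 0 ≤ᵐ[volume] d := hpt.mono fun x hx => hx.1
  refine ⟨hdi ▸ integral_nonneg_of_ae hnn, fun h => ?_⟩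
  have h0 : ∫ x, d x = 0 := by rw [hdi, h]; ring
  filter_upwards [(integral_eq_zero_iff_of_nonneg_ae hnn hdint).1 h0, hpt] with x h1 h2
  exact h2.2 h1

/-- The integrand `|t|^q`, or `log |t|` if `q = 0`, of the `q`-th deviation. -/
noncomputable def momentKernel (q t : ℝ) : ℝ := if q = 0 then Real.log |t| else |t| ^ q

/-- The `q`-th deviation in terms of the `q`-th moment. -/
noncomputable def momentRoot (q m : ℝ) : ℝ := if q = 0 then Real.exp m else m ^ (1 / q)

lemma measurable_momentKernel (q : ℝ) : Measurable (momentKernel q) := by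
  unfold momentKernel
  have : Measurable fun x : ℝ => Real.log |x| := Real.measurable_log.comp measurable_abs
  split_ifs <;> fun_prop

/-- Because Φ is affine in the moment kernel, densities of equal moment have equal integral against
Φ. -/
lemma profileBase_eq (q l t : ℝ) : profileBase q l t =
    (if q = 0 then 0 else 1) - (if q = 0 then 1 else l - 1) * momentKernel q t := by
  unfold profileBase momentKernel
  split_ifs <;> ring

/-- `w` is a probability density on `ℝ`. -/
structure IsDensity (w : ℝ → ℝ) : Prop where
  aemeasurable : AEMeasurable w volume
  nonneg : ∀ x, 0 ≤ w x
  lintegral_eq_one : ∫⁻ x, ENNReal.ofReal (w x) = 1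

lemma IsIntervalDensity.isDensity {g : ℝ → ℝ} (hg : IsIntervalDensity g) : IsDensity g :=
  ⟨hg.aemeasurable, hg.nonneg, hg.lintegral_eq_one⟩

namespace IsDensity

variable {w : ℝ → ℝ}

lemma integrable (hw : IsDensity w) : Integrable w := by
  refine ⟨hw.aemeasurable.aestronglyMeasurable, ?_⟩
  rw [hasFiniteIntegral_iff_ofReal (Filter.Eventually.of_forall hw.nonneg), hw.lintegral_eq_one]
  simp

lemma integral (hw : IsDensity w) : ∫ x, w x = 1 := by
  rw [integral_eq_lintegral_of_nonneg_ae (Filter.Eventually.of_forall hw.nonneg)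
    hw.integrable.1, hw.lintegral_eq_one]
  simp

lemma scaling (hw : IsDensity w) {r : ℝ} (hr : 0 < r) : IsDensity (scaling r w) :=
  ⟨aemeasurable_scaling hw.aemeasurable hr.ne', fun _ => mul_nonneg hr.le (hw.nonneg _),
    (lintegral_scaling hr).trans hw.lintegral_eq_one⟩

lemma measure_pos (hw : IsDensity w) : 0 < volume {x | 0 < w x} := by
  rw [pos_iff_ne_zero]
  intro h
  have h1 : ∀ᵐ x, ENNReal.ofReal (w x) = 0 := by
    rw [← compl_compl {x | 0 < w x}, ← mem_ae_iff] at h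
    filter_upwards [h] with x hx
    simpa using hx
  have := hw.lintegral_eq_one
  rw [lintegral_congr_ae h1] at this
  simp at this

lemma integral_pos_of_ae_pos (hw : IsDensity w) {F : ℝ → ℝ} (hF : Integrable F)
    (hnn : ∀ x, 0 ≤ F x) (hpos : ∀ᵐ x, 0 < w x → 0 < F x) : 0 < ∫ x, F x := by
  rw [integral_pos_iff_support_of_nonneg hnn hF]
  refine hw.measure_pos.trans_le (measure_mono_ae ?_)
  filter_upwards [hpos] with x hx h
  exact (hx h).ne'

lemma setLIntegral_rpow (hw : IsDensity w) {l : ℝ} (hl : l ≠ 0) :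
    ∫⁻ t in {t | 0 < w t}, ENNReal.ofReal (w t ^ l) = ∫⁻ t, ENNReal.ofReal (w t ^ l) := by
  rw [setLIntegral_eq_of_support_subset]
  intro t ht
  by_contra h
  have h0 : w t = 0 := le_antisymm (not_lt.1 h) (hw.nonneg t)
  simp [h0, Real.zero_rpow hl] at ht

lemma integrable_rpow (hw : IsDensity w) {l : ℝ} (hl : l ≠ 0)
    (hfin : ∫⁻ t in {t | 0 < w t}, ENNReal.ofReal (w t ^ l) ≠ ∞) :
    Integrable fun t => w t ^ l := by
  refine ⟨(hw.aemeasurable.pow_const l).aestronglyMeasurable, ?_⟩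
  rw [hasFiniteIntegral_iff_ofReal
    (Filter.Eventually.of_forall fun x => Real.rpow_nonneg (hw.nonneg x) l),
    ← hw.setLIntegral_rpow hl]
  exact hfin.lt_top

lemma integral_rpow_pos (hw : IsDensity w) {l : ℝ}
    (hi : Integrable fun t => w t ^ l) : 0 < ∫ t, w t ^ l :=
  hw.integral_pos_of_ae_pos hi (fun x => Real.rpow_nonneg (hw.nonneg x) l)
    (Filter.Eventually.of_forall fun _ hx => Real.rpow_pos_of_pos hx _)

lemma renyiPower_eq (hw : IsDensity w) {l : ℝ} (hl : l ≠ 0)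
    (hi : Integrable fun t => w t ^ l) :
    renyiPower l w = ENNReal.ofReal ((∫ t, w t ^ l) ^ (1 / (1 - l))) := by
  rw [renyiPower, hw.setLIntegral_rpow hl, ← ofReal_integral_eq_lintegral_ofReal hi
    (Filter.Eventually.of_forall fun x => Real.rpow_nonneg (hw.nonneg x) l),
    ENNReal.ofReal_rpow_of_pos (hw.integral_rpow_pos hi)]

lemma moment_pos (hw : IsDensity w) {q : ℝ} (h0 : q ≠ 0)
    (hi : Integrable fun t => momentKernel q t * w t) : 0 < ∫ t, momentKernel q t * w t := by
  refine hw.integral_pos_of_ae_pos hi (fun x => ?_) ?_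
  · rw [momentKernel, if_neg h0]
    exact mul_nonneg (by positivity) (hw.nonneg x)
  · have h1 : ∀ᵐ x : ℝ, x ≠ 0 := by simp [ae_iff]
    filter_upwards [h1] with x hx hwx
    rw [momentKernel, if_neg h0]
    have := abs_pos.2 hx
    positivity

lemma momentRoot_pos (hw : IsDensity w) {q : ℝ}
    (hi : Integrable fun t => momentKernel q t * w t) :
    0 < momentRoot q (∫ t, momentKernel q t * w t) := by
  rw [momentRoot]
  split_ifs with h0
  · positivity
  · exact Real.rpow_pos_of_pos (hw.moment_pos h0 hi) _

lemma deviation_eq (hw : IsDensity w) {q : ℝ}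
    (hi : Integrable fun t => momentKernel q t * w t) :
    deviation q w = ENNReal.ofReal (momentRoot q (∫ t, momentKernel q t * w t)) := by
  rw [deviation, momentRoot]
  split_ifs with h0
  · have e : (fun t => momentKernel q t * w t) = fun t => w t * Real.log |t| := by
      ext t; rw [momentKernel, if_pos h0, mul_comm]
    rw [e] at hi ⊢
    rw [integral_eq_lintegral_pos_part_sub_lintegral_neg_part hi]
    have h1 : ∫⁻ t, ENNReal.ofReal (w t * Real.log |t|) ≠ ∞ := hi.lintegral_lt_top.ne
    have h2 : ∫⁻ t, ENNReal.ofReal (-(w t * Real.log |t|)) ≠ ∞ := hi.neg.lintegral_lt_top.ne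
    rw [← EReal.exp_coe, EReal.coe_sub, EReal.coe_ennreal_toReal h1, EReal.coe_ennreal_toReal h2]
  · have e : (fun t => momentKernel q t * w t) = fun t => |t| ^ q * w t := by
      ext t; rw [momentKernel, if_neg h0]
    have hp := hw.moment_pos h0 hi
    rw [e] at hi hp ⊢
    rw [← ENNReal.ofReal_rpow_of_pos hp, ofReal_integral_eq_lintegral_ofReal hi
      (Filter.Eventually.of_forall fun x => mul_nonneg (by positivity) (hw.nonneg x))]

/-- For q > 0 this is immediate. For q = 0 the integral of w log |t| might diverge to -∞ near the
origin, making the deviation 0; finiteness of ∫ w^l excludes this. -/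
lemma integrable_momentKernel_of_deviation_ne_top (hw : IsDensity w) {q l : ℝ}
    (hp : IsProfileParam q l) (hi : Integrable fun t => w t ^ l) (hfin : deviation q w ≠ ∞) :
    Integrable fun t => momentKernel q t * w t := by
  have hm : AEMeasurable (fun t => momentKernel q t * w t) volume :=
    (measurable_momentKernel q).aemeasurable.mul hw.aemeasurable
  by_cases h0 : q = 0
  · have e : (fun t => momentKernel q t * w t) = fun t => w t * Real.log |t| := by
      ext t; rw [momentKernel, if_pos h0, mul_comm]
    rw [e] at hm ⊢
    have hl1 := hp.one_lt h0
    -- Let P be the profile, so P^(l-1) = -log |t| on |t| < 1. The Bregman inequality between w and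
    -- P bounds l P^(l-1) w by w^l + (l-1) P^l, and both terms are integrable.
    have hneg : ∫⁻ t, ENNReal.ofReal (-(w t * Real.log |t|)) ≠ ∞ := by
      have hdom : Integrable (fun t => w t ^ l
          + (l - 1) * stretchedProfile (ENNReal.ofReal q) l t ^ l) :=
        hi.add (hp.integrable_profile_rpow.const_mul _)
      refine ne_top_of_le_ne_top hdom.lintegral_lt_top.ne (lintegral_mono_ae ?_)
      filter_upwards [hp.ae_eq] with t ht
      refine ENNReal.ofReal_le_ofReal ?_
      have hP0 := hp.nonneg_profile t
      have hwl := Real.rpow_nonneg (hw.nonneg t) l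
      have hbase : profileBase q l t = -Real.log |t| := by rw [profileBase, if_pos h0]
      rcases le_or_gt (-Real.log |t|) 0 with hle | hgt
      · have : -(w t * Real.log |t|) ≤ 0 := by
          rw [← mul_neg]; exact mul_nonpos_of_nonneg_of_nonpos (hw.nonneg t) hle
        have h3 : 0 ≤ (l - 1) * stretchedProfile (ENNReal.ofReal q) l t ^ l :=
          mul_nonneg (by linarith) (Real.rpow_nonneg hP0 l)
        linarith
      · rw [hbase, max_eq_left hgt.le] at ht
        have hP : 0 < stretchedProfile (ENNReal.ofReal q) l t := by
          rw [ht]; exact Real.rpow_pos_of_pos hgt _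
        have hb := (bregman_nonneg hp.pos hp.ne_one (hw.nonneg t) hP).1
        have hb' := nonneg_of_mul_nonneg_right hb (by linarith)
        have h4 : stretchedProfile (ENNReal.ofReal q) l t ^ (l - 1) = -Real.log |t| := by
          rw [ht, ← Real.rpow_mul hgt.le, one_div_mul_cancel hp.sub_ne, Real.rpow_one]
        have h5 : stretchedProfile (ENNReal.ofReal q) l t ^ l
            = -Real.log |t| * stretchedProfile (ENNReal.ofReal q) l t := by
          rw [← h4, ← Real.rpow_add_one hP.ne', sub_add_cancel]
        rw [h4] at hb'
        rw [h5] at hb' ⊢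
        have h6 : 0 ≤ (l - 1) * (-Real.log |t| * w t) :=
          mul_nonneg (by linarith) (mul_nonneg hgt.le (hw.nonneg t))
        nlinarith
    -- The negative part being finite, there is no ∞ - ∞: an infinite positive part would make the
    -- deviation infinite.
    have hpos : ∫⁻ t, ENNReal.ofReal (w t * Real.log |t|) ≠ ∞ := by
      intro htop
      apply hfin
      rw [deviation, if_pos h0, htop, ← EReal.coe_ennreal_toReal hneg]
      simp
    refine ⟨hm.aestronglyMeasurable, ?_⟩
    rw [hasFiniteIntegral_iff_norm]
    refine lt_of_le_of_lt (lintegral_mono (g := fun t => ENNReal.ofReal (w t * Real.log |t|)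
      + ENNReal.ofReal (-(w t * Real.log |t|))) fun t => ?_) ?_
    swap
    · rw [lintegral_add_left' hm.ennreal_ofReal]
      exact ENNReal.add_lt_top.2 ⟨hpos.lt_top, hneg.lt_top⟩
    rcases le_total 0 (w t * Real.log |t|) with h | h
    · rw [Real.norm_of_nonneg h]; exact le_self_add
    · rw [Real.norm_of_nonpos h]; exact le_add_self
  · have e : (fun t => momentKernel q t * w t) = fun t => |t| ^ q * w t := by
      ext t; rw [momentKernel, if_neg h0]
    rw [e] at hm ⊢
    have hq : 0 < q := lt_of_le_of_ne hp.nonneg (Ne.symm h0)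
    refine ⟨hm.aestronglyMeasurable, ?_⟩
    rw [hasFiniteIntegral_iff_ofReal
      (Filter.Eventually.of_forall fun x => mul_nonneg (by positivity) (hw.nonneg x))]
    rw [lt_top_iff_ne_top]
    intro htop
    apply hfin
    rw [deviation, if_neg h0, htop, ENNReal.top_rpow_of_pos (by positivity)]

lemma integrable_moment_scaling (hw : IsDensity w) {q : ℝ}
    (hi : Integrable fun t => momentKernel q t * w t) {r : ℝ} (hr : 0 < r) :
    (Integrable fun t => momentKernel q t * RelEscort.scaling r w t) ∧
    ∫ t, momentKernel q t * RelEscort.scaling r w t =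
      if q = 0 then (∫ t, momentKernel q t * w t) - Real.log r
      else r ^ (-q) * ∫ t, momentKernel q t * w t := by
  have hcomp : ∀ {F : ℝ → ℝ}, Integrable F → Integrable (fun t => r * F (r * t)) ∧
      ∫ t, r * F (r * t) = ∫ t, F t := by
    intro F hF
    refine ⟨((integrable_comp_mul_left_iff F hr.ne').2 hF).const_mul r, ?_⟩
    rw [integral_const_mul, Measure.integral_comp_mul_left, abs_of_pos (inv_pos.2 hr),
      smul_eq_mul, ← mul_assoc, mul_inv_cancel₀ hr.ne', one_mul]
  have h1 : ∀ᵐ x : ℝ, x ≠ 0 := by simp [ae_iff]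
  by_cases h0 : q = 0
  · have hF : Integrable fun t => momentKernel q t * w t - Real.log r * w t :=
      hi.sub (hw.integrable.const_mul _)
    have hae : (fun t => r * ((fun t => momentKernel q t * w t - Real.log r * w t) (r * t)))
        =ᵐ[volume] fun t => momentKernel q t * RelEscort.scaling r w t := by
      filter_upwards [h1] with t ht
      simp only [momentKernel, if_pos h0, RelEscort.scaling]
      rw [abs_mul, abs_of_pos hr, Real.log_mul hr.ne' (abs_pos.2 ht).ne']
      ring
    refine ⟨(hcomp hF).1.congr hae, ?_⟩
    rw [← integral_congr_ae hae, (hcomp hF).2, integral_sub hi (hw.integrable.const_mul _),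
      integral_const_mul, hw.integral, if_pos h0, mul_one]
  · have hae : (fun t => r * ((fun t => r ^ (-q) * (momentKernel q t * w t)) (r * t)))
        = fun t => momentKernel q t * RelEscort.scaling r w t := by
      ext t
      simp only [momentKernel, if_neg h0, RelEscort.scaling]
      rw [abs_mul, abs_of_pos hr, Real.mul_rpow hr.le (abs_nonneg t), Real.rpow_neg hr.le]
      field_simp
    have hF := hi.const_mul (r ^ (-q))
    rw [← hae]
    refine ⟨(hcomp hF).1, ?_⟩
    rw [(hcomp hF).2, integral_const_mul, if_neg h0]

end IsDensity

/-- The additive rule for log moments and the multiplicative rule for power moments become the same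
homogeneity of degree -1 of the deviation. -/
lemma momentRoot_scaling {q r m : ℝ} (hr : 0 < r) (hm : q ≠ 0 → 0 < m) :
    momentRoot q (if q = 0 then m - Real.log r else r ^ (-q) * m) = r⁻¹ * momentRoot q m := by
  unfold momentRoot
  split_ifs with h0
  · rw [Real.exp_sub, Real.exp_log hr]; field_simp
  · rw [Real.mul_rpow (by positivity) (hm h0).le, ← Real.rpow_mul hr.le]
    rw [show -q * (1 / q) = -1 by field_simp, Real.rpow_neg_one]

lemma exists_scaling_moment {q m m' : ℝ} (hm : q ≠ 0 → 0 < m) (hm' : q ≠ 0 → 0 < m') :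
    ∃ r > 0, (if q = 0 then m - Real.log r else r ^ (-q) * m) = m' := by
  by_cases h0 : q = 0
  · refine ⟨Real.exp (m - m'), Real.exp_pos _, ?_⟩
    rw [if_pos h0, Real.log_exp]; ring
  · have h1 := hm h0
    have h2 := hm' h0
    refine ⟨(m / m') ^ (1 / q), by positivity, ?_⟩
    rw [if_neg h0, ← Real.rpow_mul (by positivity), show 1 / q * -q = -1 by field_simp,
      Real.rpow_neg_one]
    field_simp

lemma integrable_base_mul {w : ℝ → ℝ} (hw : IsDensity w) {q : ℝ} (l : ℝ)
    (hi : Integrable fun t => momentKernel q t * w t) :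
    (Integrable fun t => profileBase q l t * w t) ∧ ∫ t, profileBase q l t * w t =
      (if q = 0 then 0 else 1) - (if q = 0 then 1 else l - 1) * ∫ t, momentKernel q t * w t := by
  have e : (fun t => profileBase q l t * w t) = fun t => (if q = 0 then (0 : ℝ) else 1) * w t
      - (if q = 0 then 1 else l - 1) * (momentKernel q t * w t) := by
    ext t; rw [profileBase_eq]; ring
  rw [e]
  refine ⟨(hw.integrable.const_mul _).sub (hi.const_mul _), ?_⟩
  rw [integral_sub (hw.integrable.const_mul _) (hi.const_mul _), integral_const_mul,
    integral_const_mul, hw.integral, mul_one]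

/-- The affine relation between Φ and the moment kernel has nonzero slope (here l ≠ 1 enters), so it
can be solved for the kernel. -/
lemma IsProfileParam.integrable_moment_gaussian {q l : ℝ} (hp : IsProfileParam q l) :
    Integrable fun t => momentKernel q t * stretchedGaussian (ENNReal.ofReal q) l t := by
  have h1 := (hp.integrable_gaussian.const_mul (if q = 0 then (0 : ℝ) else 1)).sub
    hp.integrable_base_mul_gaussian
  have hne : (if q = 0 then (1 : ℝ) else l - 1) ≠ 0 := by
    split_ifs
    · exact one_ne_zero
    · exact hp.sub_ne
  refine (h1.const_mul (if q = 0 then (1 : ℝ) else l - 1)⁻¹).congr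
    (Filter.Eventually.of_forall fun t => ?_)
  simp only [profileBase_eq]
  rw [inv_mul_eq_iff_eq_mul₀ hne]
  simp only [Pi.sub_apply]
  ring

lemma IsProfileParam.momentConst_eq {q l : ℝ} (hp : IsProfileParam q l) :
    momentConst q l = ENNReal.ofReal
      (momentRoot q (∫ t, momentKernel q t * stretchedGaussian (ENNReal.ofReal q) l t) /
      (∫ t, stretchedGaussian (ENNReal.ofReal q) l t ^ l) ^ (1 / (1 - l))) := by
  have hg := hp.isIntervalDensity.isDensity
  rw [momentConst, hg.deviation_eq hp.integrable_moment_gaussian,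
    hg.renyiPower_eq hp.pos.ne' hp.integrable_gaussian_rpow, ENNReal.ofReal_div_of_pos]
  exact Real.rpow_pos_of_pos (hg.integral_rpow_pos hp.integrable_gaussian_rpow) _

lemma IsProfileParam.momentConst_ne {q l : ℝ} (hp : IsProfileParam q l) :
    momentConst q l ≠ 0 ∧ momentConst q l ≠ ∞ := by
  have hg := hp.isIntervalDensity.isDensity
  rw [hp.momentConst_eq]
  refine ⟨?_, ENNReal.ofReal_ne_top⟩
  have h1 := hg.momentRoot_pos hp.integrable_moment_gaussian
  have h2 := hg.integral_rpow_pos hp.integrable_gaussian_rpow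
  simp only [ne_eq, ENNReal.ofReal_eq_zero, not_le]
  positivity

lemma integral_scaling_rpow {w : ℝ → ℝ} (hw : ∀ x, 0 ≤ w x) {r : ℝ} (hr : 0 < r) {l : ℝ}
    (hi : Integrable fun t => w t ^ l) :
    (Integrable fun t => scaling r w t ^ l) ∧
    ∫ t, scaling r w t ^ l = r ^ (l - 1) * ∫ t, w t ^ l := by
  have e : (fun t => scaling r w t ^ l) = fun t => r ^ l * (w (r * t) ^ l) := by
    ext t; rw [scaling, Real.mul_rpow hr.le (hw _)]
  rw [e]
  refine ⟨((integrable_comp_mul_left_iff (fun t => w t ^ l) hr.ne').2 hi).const_mul _, ?_⟩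
  rw [integral_const_mul, Measure.integral_comp_mul_left (fun t => w t ^ l),
    abs_of_pos (inv_pos.2 hr), smul_eq_mul, Real.rpow_sub hr, Real.rpow_one]
  ring

/-- The classical moment-entropy inequality and its equality cases. -/
theorem moment_entropy {q l : ℝ} (hp : IsProfileParam q l) {w : ℝ → ℝ} (hw : IsDensity w)
    (hfin : ∫⁻ t in {t | 0 < w t}, ENNReal.ofReal (w t ^ l) ≠ ∞) :
    momentConst q l ≤ deviation q w / renyiPower l w ∧
    (deviation q w / renyiPower l w = momentConst q l →
      ∃ r > 0, w =ᵐ[volume] scaling r (stretchedGaussian (ENNReal.ofReal q) l)) := by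
  have hwl := hw.integrable_rpow hp.pos.ne' hfin
  have hN := hw.renyiPower_eq hp.pos.ne' hwl
  have hWpos := hw.integral_rpow_pos hwl
  by_cases hdev : deviation q w = ∞
  · have : deviation q w / renyiPower l w = ∞ := by
      rw [hdev, hN, ENNReal.top_div_of_ne_top ENNReal.ofReal_ne_top]
    rw [this]
    exact ⟨le_top, fun h => absurd h.symm hp.momentConst_ne.2⟩
  have hi := hw.integrable_momentKernel_of_deviation_ne_top hp hwl hdev
  set g := stretchedGaussian (ENNReal.ofReal q) l with hgdef
  have hg : IsDensity g := hp.isIntervalDensity.isDensity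
  have hgi : Integrable fun t => momentKernel q t * g t := hp.integrable_moment_gaussian
  have hgl : Integrable fun t => g t ^ l := hp.integrable_gaussian_rpow
  -- The scale is chosen to give w the moment of g, which is what the extremal property needs.
  obtain ⟨r, hr, hrm⟩ := exists_scaling_moment (q := q)
    (m := ∫ t, momentKernel q t * w t) (m' := ∫ t, momentKernel q t * g t)
    (fun h => hw.moment_pos h hi) (fun h => hg.moment_pos h hgi)
  have hroot := momentRoot_scaling (q := q) (m := ∫ t, momentKernel q t * w t) hr
    (fun h => hw.moment_pos h hi)
  rw [hrm] at hroot
  obtain ⟨hsi, hsm⟩ := hw.integrable_moment_scaling hi hr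
  obtain ⟨hsl, hsr⟩ := integral_scaling_rpow hw.nonneg hr hwl
  have hs := hw.scaling hr
  obtain ⟨k, hk, hkae⟩ := hp.gaussian_base
  have hcore := integral_rpow_extremal hp.pos hp.ne_one hk hs.nonneg hkae hsl hgl
    (integrable_base_mul hs l hsi).1 (integrable_base_mul hg l hgi).1
    (by rw [(integrable_base_mul hs l hsi).2, (integrable_base_mul hg l hgi).2, hsm, hrm])
  rw [hsr] at hcore
  set W := ∫ t, w t ^ l with hW
  have hGpos := hg.integral_rpow_pos hgl
  set Gl := ∫ t, g t ^ l with hGl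
  have hdw := hw.momentRoot_pos hi
  rw [hp.momentConst_eq, hw.deviation_eq hi, hN,
    ← ENNReal.ofReal_div_of_pos (Real.rpow_pos_of_pos hWpos _)]
  set d := momentRoot q (∫ t, momentKernel q t * w t)
  rw [← hgdef, hroot]
  have hpow : (r ^ (l - 1) * W) ^ (1 / (1 - l)) = r⁻¹ * W ^ (1 / (1 - l)) := by
    have : (1 : ℝ) - l ≠ 0 := sub_ne_zero.2 hp.ne_one.symm
    rw [Real.mul_rpow (by positivity) hWpos.le, ← Real.rpow_mul hr.le,
      show (l - 1) * (1 / (1 - l)) = -1 by field_simp; ring, Real.rpow_neg_one]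
  -- Deviation and entropy power are both homogeneous of degree -1, so the quotient may be computed
  -- for the scaled density.
  have hrw : d / W ^ (1 / (1 - l)) = r⁻¹ * d / (r ^ (l - 1) * W) ^ (1 / (1 - l)) := by
    rw [hpow, mul_div_mul_left _ _ (inv_pos.2 hr).ne']
  rw [hrw]
  have hrW : 0 < r ^ (l - 1) * W := by positivity
  constructor
  · refine ENNReal.ofReal_le_ofReal ?_
    refine div_le_div_of_nonneg_left (by positivity) (by positivity) ?_
    -- The extremal inequality for ∫ w^l reverses at l = 1, and so does the monotonicity of the
    -- power 1/(1-l); the entropy power of g is the larger one in both cases.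
    rcases lt_or_gt_of_ne hp.ne_one with h | h
    · have h1 : r ^ (l - 1) * W ≤ Gl := by nlinarith [hcore.1]
      exact Real.rpow_le_rpow hrW.le h1 (one_div_nonneg.2 (by linarith))
    · have h1 : Gl ≤ r ^ (l - 1) * W := by nlinarith [hcore.1]
      exact Real.rpow_le_rpow_of_nonpos hGpos h1 (one_div_nonpos.2 (by linarith))
  · intro heq
    rw [ENNReal.ofReal_eq_ofReal_iff (by positivity) (by positivity)] at heq
    have h1 : (r ^ (l - 1) * W) ^ (1 / (1 - l)) = Gl ^ (1 / (1 - l)) := by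
      have h2 : (r⁻¹ * d) ≠ 0 := by positivity
      have h3 : 0 < Gl ^ (1 / (1 - l)) := by positivity
      have h4 : 0 < (r ^ (l - 1) * W) ^ (1 / (1 - l)) := by positivity
      rw [div_eq_div_iff h4.ne' h3.ne'] at heq
      exact (mul_left_cancel₀ h2 heq).symm
    have h2 := Real.rpow_left_injOn (one_div_ne_zero (sub_ne_zero.2 hp.ne_one.symm)) hrW.le
      hGpos.le h1
    have h3 := hcore.2 h2
    refine ⟨r⁻¹, inv_pos.2 hr, ?_⟩
    have hq : Measure.QuasiMeasurePreserving (fun t : ℝ => r⁻¹ * t) volume volume := by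
      refine ⟨by fun_prop, ?_⟩
      rw [Real.map_volume_mul_left (inv_pos.2 hr).ne']
      exact Measure.smul_absolutelyContinuous
    filter_upwards [hq.ae h3] with t ht
    simp only [scaling, hgdef] at ht ⊢
    rw [← ht]
    field_simp

/-! ### From the transformed density back to the relative functionals -/

lemma relTransform_isDensity {Ω : Set ℝ} {f h y : ℝ → ℝ} {α : ℝ} (hy : IsChangeOfVar Ω f h α y)
    (hf : IsWeight Ω f) (hh : IsWeight Ω h) (h1 : ∫⁻ x in Ω, ENNReal.ofReal (f x) = 1) :
    IsDensity (relTransform Ω f h α y) := by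
  have hT := hy.isTransport hf hh
  refine ⟨aemeasurable_relTransform hy hf hh, fun t => ?_,
    (lintegral_relTransform hy hf hh).trans h1⟩
  by_cases ht : t ∈ y '' Ω
  · exact (relTransform_pos hT.strictMonoOn hf hh ht).le
  · exact (relTransform_eq_zero ht).ge

lemma renyiIntegral_eq {Ω : Set ℝ} {f h y : ℝ → ℝ} {α : ℝ} (hy : IsChangeOfVar Ω f h α y)
    (hf : IsWeight Ω f) (hh : IsWeight Ω h) (l : ℝ) :
    renyiIntegral Ω (xi l α) f h = ∫⁻ t in {t | 0 < relTransform Ω f h α y t},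
      ENNReal.ofReal (relTransform Ω f h α y t ^ l) := by
  rw [lintegral_relTransform_rpow hy hf hh, renyiIntegral, xi]
  ring_nf

/-- Since ξ - 1 = α(l-1), the factor 1/(ξ-1) in the divergence is -1/α times the exponent 1/(1-l) of
the entropy power. -/
lemma exp_renyiDiv {Ω : Set ℝ} {f h y : ℝ → ℝ} {α l : ℝ} (hα : 0 < α) (hl : l ≠ 1)
    (hy : IsChangeOfVar Ω f h α y) (hf : IsWeight Ω f) (hh : IsWeight Ω h) :
    EReal.exp (renyiDiv Ω (xi l α) f h) = renyiPower l (relTransform Ω f h α y) ^ (-(1 / α)) := by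
  rw [renyiDiv, renyiIntegral_eq hy hf hh, renyiPower, ← ENNReal.log_rpow, ENNReal.exp_log,
    ← ENNReal.rpow_mul]
  congr 1
  have h1 : l - 1 ≠ 0 := sub_ne_zero.2 hl
  have h2 : 1 - l ≠ 0 := sub_ne_zero.2 hl.symm
  rw [xi]
  have h3 : 1 + α * (l - 1) - 1 ≠ 0 := by simp [hα.ne', h1]
  field_simp
  ring

lemma exp_renyiDiv_mul_relDeviation {Ω : Set ℝ} {f h y : ℝ → ℝ} {α l q : ℝ} (hα : 0 < α)
    (hl : l ≠ 1) (hy : IsChangeOfVar Ω f h α y) (hf : IsWeight Ω f) (hh : IsWeight Ω h) :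
    EReal.exp (renyiDiv Ω (xi l α) f h) * relDeviation Ω f h α y q =
      (deviation q (relTransform Ω f h α y) / renyiPower l (relTransform Ω f h α y)) ^ (1 / α) := by
  rw [exp_renyiDiv hα hl hy hf hh, relDeviation, ENNReal.div_rpow_of_nonneg _ _ (by positivity),
    ENNReal.rpow_neg, mul_comm, ENNReal.div_eq_inv_mul, mul_comm]

lemma rpow_one_div_injective {α : ℝ} (hα : 0 < α) {a b : ℝ≥0∞}
    (h : a ^ (1 / α) = b ^ (1 / α)) : a = b :=
  ENNReal.rpow_left_injective (one_div_ne_zero hα.ne') h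

section MomentEntropy

variable {Ω : Set ℝ} {h : ℝ → ℝ} {α l q : ℝ}

theorem relative_moment_entropy (hΩo : IsOpen Ω) (hΩc : Ω.OrdConnected) (hh : IsDensityOn Ω h)
    (hα : 0 < α) (hp : IsProfileParam q l) {f y : ℝ → ℝ} (hf : IsDensityOn Ω f)
    (hy : IsChangeOfVar Ω f h α y) (hK : renyiIntegral Ω (xi l α) f h ≠ ∞) :
    momentConst q l ^ (1 / α)
      ≤ EReal.exp (renyiDiv Ω (xi l α) f h) * relDeviation Ω f h α y q := by
  have hfw := hf.isWeight hΩo hΩc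
  have hhw := hh.isWeight hΩo hΩc
  rw [exp_renyiDiv_mul_relDeviation hα hp.ne_one hy hfw hhw]
  rw [renyiIntegral_eq hy hfw hhw] at hK
  exact ENNReal.rpow_le_rpow
    (moment_entropy hp (relTransform_isDensity hy hfw hhw (hf.setLIntegral hΩc)) hK).1
    (by positivity)

theorem relative_moment_entropy_eq (hΩo : IsOpen Ω) (hΩc : Ω.OrdConnected) (hh : IsDensityOn Ω h)
    (hα : 0 < α) (hp : IsProfileParam q l) {f y : ℝ → ℝ} (hf : IsDensityOn Ω f)
    (hy : IsChangeOfVar Ω f h α y) (hK : renyiIntegral Ω (xi l α) f h ≠ ∞)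
    (hN : renyiPower ((α - 1) / α) (stretchedGaussian (ENNReal.ofReal q) l) ≠ ∞)
    (heq : EReal.exp (renyiDiv Ω (xi l α) f h) * relDeviation Ω f h α y q
      = momentConst q l ^ (1 / α)) :
    ∀ᵐ x ∂(volume.restrict Ω),
      f x = invTransform Ω h α (stretchedGaussian (ENNReal.ofReal q) l) x := by
  have hfw := hf.isWeight hΩo hΩc
  have hhw := hh.isWeight hΩo hΩc
  rw [exp_renyiDiv_mul_relDeviation hα hp.ne_one hy hfw hhw] at heq
  rw [renyiIntegral_eq hy hfw hhw] at hK
  obtain ⟨r, hr, hae⟩ := (moment_entropy hp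
    (relTransform_isDensity hy hfw hhw (hf.setLIntegral hΩc)) hK).2 (rpow_one_div_injective hα heq)
  exact ae_eq_invTransform hΩo hΩc hα hh hp.isIntervalDensity hN hf hy hr hae

lemma setLIntegral_scaling_rpow_ne_top {g : ℝ → ℝ} (hg : IsIntervalDensity g) {r : ℝ} (hr : 0 < r)
    {s : ℝ} (hfin : ∫⁻ t in {t | 0 < g t}, ENNReal.ofReal (g t ^ s) ≠ ∞) :
    ∫⁻ t in {t | 0 < scaling r g t}, ENNReal.ofReal (scaling r g t ^ s) ≠ ∞ := by
  rw [lintegral_scaling_rpow hr hg.isWeight.isOpen.measurableSet]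
  exact ENNReal.mul_ne_top ENNReal.ofReal_ne_top hfin

lemma renyiPower_scaling {g : ℝ → ℝ} (hg : IsIntervalDensity g) {r : ℝ} (hr : 0 < r)
    (hl : l ≠ 1) (hfin : ∫⁻ t in {t | 0 < g t}, ENNReal.ofReal (g t ^ l) ≠ ∞) :
    renyiPower l (scaling r g) = ENNReal.ofReal r⁻¹ * renyiPower l g := by
  rw [renyiPower, lintegral_scaling_rpow hr hg.isWeight.isOpen.measurableSet, renyiPower,
    ENNReal.mul_rpow_of_ne_top ENNReal.ofReal_ne_top hfin,
    ENNReal.ofReal_rpow_of_pos (by positivity), ← Real.rpow_mul hr.le]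
  congr 2
  have h2 : 1 - l ≠ 0 := sub_ne_zero.2 hl.symm
  rw [show (l - 1) * (1 / (1 - l)) = -1 by field_simp; ring, Real.rpow_neg_one]

theorem relative_moment_entropy_sharp (hΩo : IsOpen Ω) (hΩc : Ω.OrdConnected)
    (hh : IsDensityOn Ω h) (hα : 0 < α) (hp : IsProfileParam q l)
    (hN : renyiPower ((α - 1) / α) (stretchedGaussian (ENNReal.ofReal q) l) ≠ ∞) :
    renyiIntegral Ω (xi l α)
        (invTransform Ω h α (stretchedGaussian (ENNReal.ofReal q) l)) h ≠ ∞ ∧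
    EReal.exp (renyiDiv Ω (xi l α)
        (invTransform Ω h α (stretchedGaussian (ENNReal.ofReal q) l)) h)
      * relDeviation Ω (invTransform Ω h α (stretchedGaussian (ENNReal.ofReal q) l)) h α
        (invVar Ω h α (stretchedGaussian (ENNReal.ofReal q) l)) q = momentConst q l ^ (1 / α) := by
  set g := stretchedGaussian (ENNReal.ofReal q) l with hgdef
  have hg : IsIntervalDensity g := hp.isIntervalDensity
  have hhw := hh.isWeight hΩo hΩc
  have h1 := hh.setLIntegral hΩc
  have hfw := (isDensityOn_invTransform hΩo hΩc hα hh hg hN).isWeight hΩo hΩc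
  have hy := isChangeOfVar_invVar hα hhw h1 hg hN
  have hr := invScale_pos hα hg hN
  have hgl : Integrable fun t => g t ^ l := hp.integrable_gaussian_rpow
  have hfin : ∫⁻ t in {t | 0 < g t}, ENNReal.ofReal (g t ^ l) ≠ ∞ := by
    rw [hg.isDensity.setLIntegral_rpow hp.pos.ne']
    exact hgl.lintegral_lt_top.ne
  rw [exp_renyiDiv_mul_relDeviation hα hp.ne_one hy hfw hhw, renyiIntegral_eq hy hfw hhw,
    relTransform_invTransform hα hhw h1 hg hN]
  set r := invScale α g
  refine ⟨setLIntegral_scaling_rpow_ne_top hg hr hfin, ?_⟩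
  have hgi : Integrable fun t => momentKernel q t * g t := hp.integrable_moment_gaussian
  obtain ⟨hsi, hsm⟩ := hg.isDensity.integrable_moment_scaling hgi hr
  -- The transform of the candidate is a scaling of g, and the factors r⁻¹ in numerator and
  -- denominator cancel.
  rw [renyiPower_scaling hg hr hp.ne_one hfin, momentConst, ← hgdef,
    (hg.isDensity.scaling hr).deviation_eq hsi, hsm,
    momentRoot_scaling hr (fun h0 => hg.isDensity.moment_pos h0 hgi),
    ENNReal.ofReal_mul (inv_pos.2 hr).le, ← hg.isDensity.deviation_eq hgi,
    ENNReal.mul_div_mul_left _ _ (by simpa using hr) ENNReal.ofReal_ne_top]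

end MomentEntropy

/-! ### The Stam inequality -/

/-- The tangent at 1 to x^(1-γ), which is concave for γ < 1 and convex for γ > 1. It is x times the
Bregman inequality for 1/x against 1; the factor 1 - γ unifies the two cases. -/
lemma tangent_rpow {γ x : ℝ} (hγ : 0 < γ) (hγ1 : γ ≠ 1) (hx : 0 < x) :
    0 ≤ (1 - γ) * (1 + (1 - γ) * (x - 1) - x ^ (1 - γ)) ∧
    ((1 - γ) * (1 + (1 - γ) * (x - 1) - x ^ (1 - γ)) = 0 → x = 1) := by
  have h := bregman_nonneg (a := x⁻¹) (b := 1) hγ hγ1 (by positivity) one_pos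
  have e : (1 - γ) * (1 + (1 - γ) * (x - 1) - x ^ (1 - γ))
      = x * ((γ - 1) * (x⁻¹ ^ γ - 1 ^ γ - γ * 1 ^ (γ - 1) * (x⁻¹ - 1))) := by
    rw [Real.rpow_sub hx, Real.inv_rpow hx.le, Real.one_rpow, Real.one_rpow, Real.rpow_one]
    field_simp
    ring
  rw [e]
  refine ⟨mul_nonneg hx.le h.1, fun h0 => ?_⟩
  have := h.2 ((mul_eq_zero.1 h0).resolve_left hx.ne')
  rwa [inv_eq_one] at this

/-- A weighted power mean inequality with its equality case. -/
lemma power_mean {μ : Measure ℝ} {γ : ℝ} (hγ : 0 < γ) (hγ1 : γ ≠ 1) {u ρ : ℝ → ℝ}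
    (hu : ∀ᵐ t ∂μ, 0 < u t) (hρ : ∀ᵐ t ∂μ, 0 < ρ t) (hA : Integrable u μ)
    (hB : Integrable (fun t => u t * ρ t) μ) (hC : Integrable (fun t => u t * ρ t ^ (1 - γ)) μ)
    {a c : ℝ} (ha : ∫ t, u t ∂μ = a) (hc : ∫ t, u t * ρ t ^ (1 - γ) ∂μ = c) (ha0 : 0 < a)
    (hc0 : 0 < c) :
    a * (c / a) ^ (1 / (1 - γ)) ≤ ∫ t, u t * ρ t ∂μ ∧
    (∫ t, u t * ρ t ∂μ = a * (c / a) ^ (1 / (1 - γ)) →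
      ∀ᵐ t ∂μ, ρ t = (c / a) ^ (1 / (1 - γ))) := by
  have hγ' : 1 - γ ≠ 0 := sub_ne_zero.2 hγ1.symm
  set m := (c / a) ^ (1 / (1 - γ)) with hm
  have hm0 : 0 < m := by positivity
  have hmk : m ^ (1 - γ) = c / a := by
    rw [hm, ← Real.rpow_mul (by positivity), one_div_mul_cancel hγ', Real.rpow_one]
  -- The tangent gap at ρ/m, weighted by u. The choice m^(1-γ) = c/a makes the weighted mean of
  -- (ρ/m)^(1-γ) equal to 1, so the integral of `d` is a positive multiple of b - a m.
  set d : ℝ → ℝ := fun t => u t * ((1 - γ) * (1 + (1 - γ) * (ρ t / m - 1) - (ρ t / m) ^ (1 - γ)))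
    with hd
  set b := ∫ t, u t * ρ t ∂μ with hb
  have hde : d =ᵐ[μ] fun t => (1 - γ) * γ * u t + (1 - γ) ^ 2 / m * (u t * ρ t)
      - (1 - γ) * (a / c) * (u t * ρ t ^ (1 - γ)) := by
    filter_upwards [hρ] with t ht
    simp only [hd]
    rw [Real.div_rpow ht.le hm0.le, hmk]
    field_simp
    ring
  have hint : Integrable (fun t => (1 - γ) * γ * u t + (1 - γ) ^ 2 / m * (u t * ρ t)
      - (1 - γ) * (a / c) * (u t * ρ t ^ (1 - γ))) μ :=
    ((hA.const_mul _).add (hB.const_mul _)).sub (hC.const_mul _)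
  have hdi : ∫ t, d t ∂μ = (1 - γ) ^ 2 / m * (b - a * m) := by
    have hAB : Integrable (fun t => (1 - γ) * γ * u t + (1 - γ) ^ 2 / m * (u t * ρ t)) μ :=
      (hA.const_mul _).add (hB.const_mul _)
    rw [integral_congr_ae hde, integral_sub hAB (hC.const_mul _), integral_add (hA.const_mul _) (hB.const_mul _), integral_const_mul,
      integral_const_mul, integral_const_mul, ha, hc, ← hb]
    field_simp
    ring
  have hnn : ∀ᵐ t ∂μ, 0 ≤ d t ∧ (d t = 0 → ρ t = m) := by
    filter_upwards [hu, hρ] with t h1 h2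
    have h3 := tangent_rpow hγ hγ1 (div_pos h2 hm0)
    refine ⟨mul_nonneg h1.le h3.1, fun h0 => ?_⟩
    have h4 := h3.2 ((mul_eq_zero.1 h0).resolve_left h1.ne')
    rwa [div_eq_one_iff_eq hm0.ne'] at h4
  have hcoef : 0 < (1 - γ) ^ 2 / m := by positivity
  have hnn' : 0 ≤ᵐ[μ] d := hnn.mono fun t ht => ht.1
  constructor
  · have h1 : 0 ≤ (1 - γ) ^ 2 / m * (b - a * m) := hdi ▸ integral_nonneg_of_ae hnn'
    have := nonneg_of_mul_nonneg_right h1 hcoef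
    linarith
  · intro heq
    have h0 : ∫ t, d t ∂μ = 0 := by rw [hdi, heq]; ring
    filter_upwards [(integral_eq_zero_iff_of_nonneg_ae hnn' (hint.congr hde.symm)).1 h0, hnn]
      with t h1 h2
    exact h2.2 h1

lemma IsWeight.ofReal_integral {I : Set ℝ} {k : ℝ → ℝ} (hk : IsWeight I k)
    (hfin : ∫⁻ t in I, ENNReal.ofReal (k t) ≠ ∞) :
    ENNReal.ofReal (∫ t in I, k t) = ∫⁻ t in I, ENNReal.ofReal (k t) := by
  rw [ofReal_integral_eq_lintegral_ofReal (hk.integrableOn hfin)]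
  filter_upwards [ae_restrict_mem hk.isOpen.measurableSet] with t ht using (hk.pos t ht).le

/-- The power mean step of the Stam inequality. -/
lemma stam_jensen {I J : Set ℝ} {w g s : ℝ → ℝ} (hT : IsTransport I w J g s) {γ θ β l : ℝ}
    (hγ : 0 < γ) (hγ1 : γ ≠ 1) (hβ : β = γ * θ) (hl : l = 1 + β - θ) {a c : ℝ} (ha0 : 0 < a)
    (hc0 : 0 < c) (hA : ∫⁻ t in I, ENNReal.ofReal (w t ^ l) = ENNReal.ofReal a)
    (hC : ∫⁻ x in J, ENNReal.ofReal (g x ^ γ) = ENNReal.ofReal c) :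
    ENNReal.ofReal (a * (c / a) ^ (1 / (1 - γ)))
      ≤ ∫⁻ t in I, ENNReal.ofReal (w t ^ (1 + β) / g (s t)) ∧
    (∫⁻ t in I, ENNReal.ofReal (w t ^ (1 + β) / g (s t))
        = ENNReal.ofReal (a * (c / a) ^ (1 / (1 - γ))) →
      ∃ m > 0, ∀ᵐ t ∂(volume.restrict I), w t ^ θ = m * g (s t)) := by
  by_cases hB : ∫⁻ t in I, ENNReal.ofReal (w t ^ (1 + β) / g (s t)) = ∞
  · rw [hB]
    exact ⟨le_top, fun h => absurd h.symm ENNReal.ofReal_ne_top⟩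
  have hI := hT.source.isOpen.measurableSet
  have hgs : IsWeight I (fun t => g (s t)) := ⟨hT.source.isOpen, hT.source.ordConnected,
    hT.comp_aemeasurable hT.target.aemeasurable, fun t ht => hT.target.pos _ (hT.mem ht)⟩
  have hWA := isWeight_rpow hT.source l
  have hWB : IsWeight I (fun t => w t ^ (1 + β) / g (s t)) := ⟨hgs.isOpen, hgs.ordConnected,
    (hT.source.aemeasurable.pow_const _).div hgs.aemeasurable, fun t ht =>
      div_pos (Real.rpow_pos_of_pos (hT.source.pos t ht) _) (hgs.pos t ht)⟩
  have hWC : IsWeight I (fun t => g (s t) ^ (γ - 1) * w t) := ⟨hgs.isOpen, hgs.ordConnected,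
    (hgs.aemeasurable.pow_const _).mul hT.source.aemeasurable, fun t ht =>
      mul_pos (Real.rpow_pos_of_pos (hgs.pos t ht) _) (hT.source.pos t ht)⟩
  -- The transport w dt → g dx converts ∫ g^γ into an integral over `I`.
  have hCI : ∫⁻ t in I, ENNReal.ofReal (g (s t) ^ (γ - 1) * w t) = ENNReal.ofReal c := by
    rw [← hC]
    have h1 := hT.lintegral (isWeight_rpow hT.target (γ - 1)).aemeasurable.ennreal_ofReal
    refine Eq.trans ?_ (h1.trans ?_)
    · refine setLIntegral_congr_fun hI fun t ht => ?_
      rw [ENNReal.ofReal_mul (Real.rpow_pos_of_pos (hgs.pos t ht) _).le]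
    · refine setLIntegral_congr_fun hT.target.isOpen.measurableSet fun x hx => ?_
      have hgx := hT.target.pos x hx
      rw [← ENNReal.ofReal_mul (by positivity), ← Real.rpow_add_one hgx.ne', sub_add_cancel]
  -- Against the weight w^l, the first power of ρ gives the quantity to be bounded, and the power
  -- 1-γ gives g(s)^(γ-1) w because l + θ(1-γ) = 1. A constant ρ is the equality case.
  set ρ : ℝ → ℝ := fun t => w t ^ θ / g (s t) with hρ
  have e1 : ∀ t ∈ I, w t ^ l * ρ t = w t ^ (1 + β) / g (s t) := by
    intro t ht
    rw [hρ, mul_div_assoc', ← Real.rpow_add (hT.source.pos t ht), hl, sub_add_cancel]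
  have e2 : ∀ t ∈ I, w t ^ l * ρ t ^ (1 - γ) = g (s t) ^ (γ - 1) * w t := by
    intro t ht
    have hwt := hT.source.pos t ht
    have hgt := hgs.pos t ht
    simp only [hρ]
    rw [Real.div_rpow (by positivity) hgt.le, ← Real.rpow_mul hwt.le, mul_div_assoc',
      ← Real.rpow_add hwt, show l + θ * (1 - γ) = 1 by rw [hl, hβ]; ring, Real.rpow_one,
      show 1 - γ = -(γ - 1) by ring, Real.rpow_neg hgt.le, div_inv_eq_mul, mul_comm]
  have ae1 : (fun t => w t ^ (1 + β) / g (s t)) =ᵐ[volume.restrict I] fun t => w t ^ l * ρ t := by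
    filter_upwards [ae_restrict_mem hI] with t ht using (e1 t ht).symm
  have ae2 : (fun t => g (s t) ^ (γ - 1) * w t) =ᵐ[volume.restrict I]
      fun t => w t ^ l * ρ t ^ (1 - γ) := by
    filter_upwards [ae_restrict_mem hI] with t ht using (e2 t ht).symm
  have iA := hWA.integrableOn (hA ▸ ENNReal.ofReal_ne_top)
  have iB := hWB.integrableOn hB
  have iC := hWC.integrableOn (hCI ▸ ENNReal.ofReal_ne_top)
  have vA : ∫ t in I, w t ^ l = a := by
    have := hWA.ofReal_integral (hA ▸ ENNReal.ofReal_ne_top)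
    rw [hA, ENNReal.ofReal_eq_ofReal_iff _ ha0.le] at this
    · exact this
    · exact setIntegral_nonneg hI fun t ht => (hWA.pos t ht).le
  have vC : ∫ t in I, g (s t) ^ (γ - 1) * w t = c := by
    have := hWC.ofReal_integral (hCI ▸ ENNReal.ofReal_ne_top)
    rw [hCI, ENNReal.ofReal_eq_ofReal_iff _ hc0.le] at this
    · exact this
    · exact setIntegral_nonneg hI fun t ht => (hWC.pos t ht).le
  have hpm := power_mean hγ hγ1 (μ := volume.restrict I) (u := fun t => w t ^ l) (ρ := ρ)
    (by filter_upwards [ae_restrict_mem hI] with t ht using hWA.pos t ht)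
    (by filter_upwards [ae_restrict_mem hI] with t ht using
          div_pos (Real.rpow_pos_of_pos (hT.source.pos t ht) _) (hgs.pos t ht))
    iA (iB.congr ae1) (iC.congr ae2) vA (by rw [← integral_congr_ae ae2]; exact vC) ha0 hc0
  rw [← integral_congr_ae ae1] at hpm
  rw [← hWB.ofReal_integral hB]
  have hBnn : 0 ≤ ∫ t in I, w t ^ (1 + β) / g (s t) :=
    setIntegral_nonneg hI fun t ht => (hWB.pos t ht).le
  refine ⟨ENNReal.ofReal_le_ofReal hpm.1, fun h => ?_⟩
  rw [ENNReal.ofReal_eq_ofReal_iff hBnn (by positivity)] at h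
  refine ⟨(c / a) ^ (1 / (1 - γ)), by positivity, ?_⟩
  filter_upwards [hpm.2 h, ae_restrict_mem hI] with t h1 ht
  rw [← h1, hρ, div_mul_cancel₀ _ (hgs.pos t ht).ne']

/-! #### The upper bound by the Fisher information -/

/-- If the derivative is integrable, the fundamental theorem holds for everywhere differentiable
functions; if not, the right side is infinite. No absolute continuity is required. -/
lemma ofReal_sub_le_lintegral_deriv {I : Set ℝ} (hIc : I.OrdConnected) (hIo : IsOpen I) {v : ℝ → ℝ}
    (hv : DifferentiableOn ℝ v I) {t u : ℝ} (ht : t ∈ I) (hu : u ∈ I) :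
    ENNReal.ofReal |v u - v t| ≤ ∫⁻ τ in uIoc t u, ENNReal.ofReal |deriv v τ| := by
  by_cases hfin : ∫⁻ τ in uIoc t u, ENNReal.ofReal |deriv v τ| = ∞
  · rw [hfin]; exact le_top
  have hint : IntervalIntegrable (deriv v) volume t u := by
    rw [intervalIntegrable_iff]
    refine ⟨(measurable_deriv v).aestronglyMeasurable, ?_⟩
    rw [hasFiniteIntegral_iff_norm]
    exact lt_top_iff_ne_top.2 hfin
  have hsub : uIcc t u ⊆ I := hIc.uIcc_subset ht hu
  have h1 : ∫ τ in t..u, deriv v τ = v u - v t :=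
    intervalIntegral.integral_deriv_eq_sub
      (fun x hx => (hv x (hsub hx)).differentiableAt (hIo.mem_nhds (hsub hx))) hint
  rw [← h1]
  have h2 : |∫ τ in t..u, deriv v τ| ≤ ∫ τ in uIoc t u, |deriv v τ| := by
    have := intervalIntegral.norm_integral_le_integral_norm_uIoc (f := deriv v) (a := t) (b := u)
      (μ := volume)
    simpa [Real.norm_eq_abs] using this
  refine (ENNReal.ofReal_le_ofReal h2).trans ?_
  rw [ofReal_integral_eq_lintegral_ofReal (intervalIntegrable_iff.1 hint).abs
    (Filter.Eventually.of_forall fun _ => abs_nonneg _)]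

lemma le_of_forall_pos_le_add_ofReal {x y : ℝ≥0∞} (h : ∀ ε : ℝ, 0 < ε → x ≤ y + ENNReal.ofReal ε) :
    x ≤ y :=
  ENNReal.le_of_forall_pos_le_add fun ε hε _ => by
    simpa using h ε hε

/-- Half of an integration by parts: if v falls below every ε somewhere beyond t, its value at t is
at most its variation from there on. Inclusion up to null sets allows half-open intervals and open
tails to be mixed. -/
lemma ofReal_le_tail {I : Set ℝ} (hIc : I.OrdConnected) (hIo : IsOpen I) {v : ℝ → ℝ}
    (hv : DifferentiableOn ℝ v I) (S : Set ℝ) {t : ℝ} (ht : t ∈ I)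
    (hend : ∀ ε > 0, ∃ u ∈ I, uIoc t u ≤ᵐ[volume] S ∧ v u < ε) :
    ENNReal.ofReal (v t) ≤ ∫⁻ τ in S, ENNReal.ofReal |deriv v τ| := by
  refine le_of_forall_pos_le_add_ofReal fun ε hε => ?_
  obtain ⟨u, hu, htu, hvu⟩ := hend ε hε
  have h1 := ofReal_sub_le_lintegral_deriv hIc hIo hv ht hu
  calc ENNReal.ofReal (v t) ≤ ENNReal.ofReal (|v u - v t| + ε) := by
        refine ENNReal.ofReal_le_ofReal ?_
        have := neg_abs_le (v u - v t)
        linarith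
    _ = ENNReal.ofReal |v u - v t| + ENNReal.ofReal ε :=
        ENNReal.ofReal_add (abs_nonneg _) hε.le
    _ ≤ _ := by
        gcongr
        exact h1.trans (lintegral_mono_set' htu)

/-- The set of points of `I` beyond `t`, as seen from `c`. -/
def tailSet (I : Set ℝ) (c t : ℝ) : Set ℝ := {τ | τ ∈ I ∧ ((c ≤ t ∧ t < τ) ∨ (t < c ∧ τ < t))}

/-- Tonelli. For fixed τ the points t whose tail contains τ are those between c and τ, and their
`k`-mass is |s(τ) - s(c)| = |s(τ)|. This replaces the boundary terms of an integration by parts. -/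
lemma lintegral_tail {I J : Set ℝ} {k s : ℝ → ℝ} (hT : IsTransport I k J (fun _ => 1) s) {c : ℝ}
    (hc : c ∈ I) (hsc : s c = 0) {D : ℝ → ℝ≥0∞} (hD : Measurable D) :
    ∫⁻ t in I, (∫⁻ τ in tailSet I c t, D τ) * ENNReal.ofReal (k t)
      = ∫⁻ τ in I, D τ * ENNReal.ofReal |s τ| := by
  have hI := hT.source.isOpen.measurableSet
  set χ : Set (ℝ × ℝ) := {z | (c ≤ z.1 ∧ z.1 < z.2) ∨ (z.1 < c ∧ z.2 < z.1)} with hχ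
  have hχm : MeasurableSet χ :=
    ((measurableSet_le measurable_const measurable_fst).inter
      (measurableSet_lt measurable_fst measurable_snd)).union
    ((measurableSet_lt measurable_fst measurable_const).inter
      (measurableSet_lt measurable_snd measurable_fst))
  have h1 : ∀ t, ∫⁻ τ in tailSet I c t, D τ = ∫⁻ τ in I, χ.indicator (fun z => D z.2) (t, τ) := by
    intro t
    have hm : MeasurableSet {τ | (c ≤ t ∧ t < τ) ∨ (t < c ∧ τ < t)} := measurable_prodMk_left hχm
    have : tailSet I c t = {τ | (c ≤ t ∧ t < τ) ∨ (t < c ∧ τ < t)} ∩ I := by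
      ext τ; simp [tailSet, and_comm]
    rw [this, ← Measure.restrict_restrict hm, ← lintegral_indicator hm]
    rfl
  have h2 : ∀ t, (∫⁻ τ in tailSet I c t, D τ) * ENNReal.ofReal (k t)
      = ∫⁻ τ in I, χ.indicator (fun z => D z.2) (t, τ) * ENNReal.ofReal (k t) := by
    intro t
    rw [h1, lintegral_mul_const' _ _ ENNReal.ofReal_ne_top]
  simp_rw [h2]
  have hprod : AEMeasurable (Function.uncurry fun t τ => χ.indicator (fun z => D z.2) (t, τ)
      * ENNReal.ofReal (k t)) ((volume.restrict I).prod (volume.restrict I)) := by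
    refine AEMeasurable.mul ?_ ?_
    · exact ((hD.comp measurable_snd).indicator hχm).aemeasurable
    · exact hT.source.aemeasurable.ennreal_ofReal.comp_fst
  rw [lintegral_lintegral_swap hprod]
  refine setLIntegral_congr_fun hI fun τ hτ => ?_
  -- The section at τ is rewritten as a condition on s(t), so that the transport to Lebesgue measure
  -- reduces its mass to an interval length.
  have h3 : ∀ t ∈ I, χ.indicator (fun z => D z.2) (t, τ) * ENNReal.ofReal (k t)
      = D τ * ((if 0 ≤ s τ then Ico 0 (s τ) else Ioo (s τ) 0).indicator 1 (s t)
        * ENNReal.ofReal (k t)) := by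
    intro t ht
    rw [← mul_assoc]
    congr 1
    have hm := hT.strictMonoOn
    have a1 : c ≤ t ↔ 0 ≤ s t := by rw [← hm.le_iff_le hc ht, hsc]
    have a2 : t < τ ↔ s t < s τ := (hm.lt_iff_lt ht hτ).symm
    have a3 : t < c ↔ s t < 0 := by rw [← hm.lt_iff_lt ht hc, hsc]
    have a4 : τ < t ↔ s τ < s t := (hm.lt_iff_lt hτ ht).symm
    have a5 : (t, τ) ∈ χ ↔ s t ∈ (if 0 ≤ s τ then Ico 0 (s τ) else Ioo (s τ) 0) := by
      simp only [hχ, mem_ofPred_eq, a1, a2, a3, a4]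
      split_ifs with h0
      · simp only [mem_Ico]
        constructor
        · rintro (h | h)
          · exact h
          · linarith [h.1, h.2]
        · exact Or.inl
      · simp only [mem_Ioo]
        constructor
        · rintro (h | h)
          · linarith [h.1, h.2]
          · exact ⟨h.2, h.1⟩
        · exact fun h => Or.inr ⟨h.2, h.1⟩
    by_cases hz : (t, τ) ∈ χ
    · rw [indicator_of_mem hz, indicator_of_mem (a5.1 hz)]; simp
    · rw [indicator_of_notMem hz, indicator_of_notMem (fun h => hz (a5.2 h))]; simp
  rw [setLIntegral_congr_fun hI h3]
  have hset : MeasurableSet (if 0 ≤ s τ then Ico 0 (s τ) else Ioo (s τ) 0) := by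
    split_ifs <;> measurability
  have hind : Measurable ((if 0 ≤ s τ then Ico 0 (s τ) else Ioo (s τ) 0).indicator
      (1 : ℝ → ℝ≥0∞)) := measurable_one.indicator hset
  have hprod' : AEMeasurable (fun t => (if 0 ≤ s τ then Ico 0 (s τ) else Ioo (s τ) 0).indicator
      (1 : ℝ → ℝ≥0∞) (s t) * ENNReal.ofReal (k t)) (volume.restrict I) :=
    (hT.comp_aemeasurable hind.aemeasurable).mul hT.source.aemeasurable.ennreal_ofReal
  rw [lintegral_const_mul'' _ hprod', hT.lintegral hind.aemeasurable]
  congr 1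
  simp only [ENNReal.ofReal_one, mul_one]
  rw [lintegral_indicator_one hset, Measure.restrict_apply hset, inter_eq_left.2]
  · split_ifs with h0
    · rw [Real.volume_Ico, sub_zero, abs_of_nonneg h0]
    · rw [Real.volume_Ioo, zero_sub, abs_of_neg (not_le.1 h0)]
  · have h0J : (0 : ℝ) ∈ J := hsc ▸ hT.mem hc
    split_ifs with h0
    · exact Ico_subset_Icc_self.trans (hT.target.ordConnected.out h0J (hT.mem hτ))
    · exact Ioo_subset_Icc_self.trans (hT.target.ordConnected.out (hT.mem hτ) h0J)

/-- The derivative is split as (w^(β-2) w') times w so that Hölder's inequality can be used against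
w dt. -/
lemma hasDerivAt_rpow_density {I : Set ℝ} (hIo : IsOpen I) {w : ℝ → ℝ} (hw : ∀ t ∈ I, 0 < w t)
    (hd : DifferentiableOn ℝ w I) (β : ℝ) {t : ℝ} (ht : t ∈ I) :
    HasDerivAt (fun t => w t ^ β) (β * (w t ^ (β - 2) * deriv w t) * w t) t := by
  have h1 := ((hd t ht).differentiableAt (hIo.mem_nhds ht)).hasDerivAt.rpow_const (p := β)
    (Or.inl (hw t ht).ne')
  refine h1.congr_deriv ?_
  have hwt := hw t ht
  rw [show β - 1 = (β - 2) + 1 by ring, Real.rpow_add_one hwt.ne']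
  ring

/-- Hölder's inequality against the measure `w dt`. -/
lemma lintegral_weight_holder {I : Set ℝ} {w X Y : ℝ → ℝ} (hw : IsWeight I w) {p q : ℝ}
    (hpq : p.HolderConjugate q) (hX : AEMeasurable X (volume.restrict I))
    (hY : AEMeasurable Y (volume.restrict I)) :
    ∫⁻ t in I, ENNReal.ofReal (|X t| * w t) * ENNReal.ofReal |Y t|
      ≤ (∫⁻ t in I, ENNReal.ofReal (|X t| ^ p * w t)) ^ (1 / p)
        * (∫⁻ t in I, ENNReal.ofReal (|Y t| ^ q * w t)) ^ (1 / q) := by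
  have hI := hw.isOpen.measurableSet
  have h := ENNReal.lintegral_mul_le_Lp_mul_Lq (volume.restrict I) hpq
    (f := fun t => ENNReal.ofReal (|X t| * w t ^ (1 / p)))
    (g := fun t => ENNReal.ofReal (|Y t| * w t ^ (1 / q)))
    ((hX.norm.mul (hw.aemeasurable.pow_const _)).ennreal_ofReal)
    ((hY.norm.mul (hw.aemeasurable.pow_const _)).ennreal_ofReal)
  refine le_trans (le_of_eq ?_) (h.trans (le_of_eq ?_))
  · refine setLIntegral_congr_fun hI fun t ht => ?_
    have hwt := hw.pos t ht
    simp only [Pi.mul_apply]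
    rw [← ENNReal.ofReal_mul (by positivity), ← ENNReal.ofReal_mul (by positivity)]
    congr 1
    have : w t ^ (1 / p) * w t ^ (1 / q) = w t := by
      rw [← Real.rpow_add hwt, one_div, one_div, hpq.inv_add_inv_eq_one, Real.rpow_one]
    linear_combination (-|X t| * |Y t|) * this
  · congr 2
    · refine setLIntegral_congr_fun hI fun t ht => ?_
      have hwt := hw.pos t ht
      rw [ENNReal.ofReal_rpow_of_nonneg (by positivity) hpq.nonneg,
        Real.mul_rpow (abs_nonneg _) (by positivity), ← Real.rpow_mul hwt.le,
        one_div_mul_cancel hpq.ne_zero, Real.rpow_one]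
    · refine setLIntegral_congr_fun hI fun t ht => ?_
      have hwt := hw.pos t ht
      rw [ENNReal.ofReal_rpow_of_nonneg (by positivity) hpq.symm.nonneg,
        Real.mul_rpow (abs_nonneg _) (by positivity), ← Real.rpow_mul hwt.le,
        one_div_mul_cancel hpq.symm.ne_zero, Real.rpow_one]

/-- The integrand is w^β times the derivative w/g(s) of s. As w^β becomes small towards both ends,
it is bounded by the tail variation of w^β; Tonelli yields ∫ |(w^β)'| |s|, and Hölder against w dt
yields the Fisher information and the q-th moment of s, which is that of g. -/
lemma stam_upper {I J : Set ℝ} {w g s : ℝ → ℝ} (hT : IsTransport I w J g s) (h0 : (0 : ℝ) ∈ J)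
    (hd : DifferentiableOn ℝ w I) {p q β : ℝ} (hpq : p.HolderConjugate q)
    (hR : ∀ t ∈ I, ∀ ε > 0, ∃ u ∈ I, t < u ∧ w u ^ β < ε)
    (hL : ∀ t ∈ I, ∀ ε > 0, ∃ u ∈ I, u < t ∧ w u ^ β < ε) :
    ∫⁻ t in I, ENNReal.ofReal (w t ^ (1 + β) / g (s t)) ≤ ENNReal.ofReal |β| *
      ((∫⁻ t in I, ENNReal.ofReal (|w t ^ (β - 2) * deriv w t| ^ p * w t)) ^ (1 / p)
        * (∫⁻ x in J, ENNReal.ofReal (|x| ^ q * g x)) ^ (1 / q)) := by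
  have hI := hT.source.isOpen.measurableSet
  have hIo := hT.source.isOpen
  have hIc := hT.source.ordConnected
  obtain ⟨c, hc, hsc⟩ : ∃ c ∈ I, s c = 0 := by rwa [← hT.image] at h0
  -- Dividing both weights by g expresses s' = w/g(s) without differentiating s.
  have hT1 : IsTransport I (fun t => w t / g (s t)) J (fun _ => 1) s := by
    refine (hT.mul (φ := fun x => (g x)⁻¹) hT.target.aemeasurable.inv
      fun x hx => inv_pos.2 (hT.target.pos x hx)).congr (fun t _ => ?_) fun x hx => ?_
    · rw [div_eq_inv_mul]
    · rw [inv_mul_cancel₀ (hT.target.pos x hx).ne']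
  have hvd : DifferentiableOn ℝ (fun t => w t ^ β) I := fun t ht =>
    (hasDerivAt_rpow_density hIo hT.source.pos hd β ht).differentiableAt.differentiableWithinAt
  have hv : ∀ t ∈ I, deriv (fun t => w t ^ β) t = β * (w t ^ (β - 2) * deriv w t) * w t :=
    fun t ht => (hasDerivAt_rpow_density hIo hT.source.pos hd β ht).deriv
  have htail : ∀ t ∈ I, ENNReal.ofReal (w t ^ β)
      ≤ ∫⁻ τ in tailSet I c t, ENNReal.ofReal |deriv (fun t => w t ^ β) τ| := by
    intro t ht
    refine ofReal_le_tail hIc hIo hvd _ ht fun ε hε => ?_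
    rcases le_or_gt c t with hct | hct
    · obtain ⟨u, hu, htu, hwu⟩ := hR t ht ε hε
      refine ⟨u, hu, LE.le.eventuallyLE fun τ hτ => ?_, hwu⟩
      rw [uIoc_of_le htu.le] at hτ
      exact ⟨hIc.out ht hu ⟨hτ.1.le, hτ.2⟩, Or.inl ⟨hct, hτ.1⟩⟩
    · obtain ⟨u, hu, htu, hwu⟩ := hL t ht ε hε
      refine ⟨u, hu, ?_, hwu⟩
      rw [uIoc_of_ge htu.le]
      refine Ioo_ae_eq_Ioc.symm.le.trans (LE.le.eventuallyLE fun τ hτ => ?_)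
      exact ⟨hIc.out hu ht ⟨hτ.1.le, hτ.2.le⟩, Or.inr ⟨hct, hτ.2⟩⟩
  calc ∫⁻ t in I, ENNReal.ofReal (w t ^ (1 + β) / g (s t))
      = ∫⁻ t in I, ENNReal.ofReal (w t ^ β) * ENNReal.ofReal (w t / g (s t)) := by
        refine setLIntegral_congr_fun hI fun t ht => ?_
        have hwt := hT.source.pos t ht
        rw [← ENNReal.ofReal_mul (by positivity), add_comm, Real.rpow_add_one hwt.ne', mul_div_assoc]
    _ ≤ ∫⁻ t in I, (∫⁻ τ in tailSet I c t, ENNReal.ofReal |deriv (fun t => w t ^ β) τ|)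
          * ENNReal.ofReal (w t / g (s t)) := by
        refine setLIntegral_mono_ae' hI (Filter.Eventually.of_forall fun t ht => ?_)
        gcongr
        exact htail t ht
    _ = ∫⁻ τ in I, ENNReal.ofReal |deriv (fun t => w t ^ β) τ| * ENNReal.ofReal |s τ| :=
        lintegral_tail hT1 hc hsc
          (D := fun τ => ENNReal.ofReal |deriv (fun t => w t ^ β) τ|)
          (measurable_deriv fun t => w t ^ β).norm.ennreal_ofReal
    _ = ENNReal.ofReal |β| * ∫⁻ τ in I, ENNReal.ofReal (|w τ ^ (β - 2) * deriv w τ| * w τ)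
          * ENNReal.ofReal |s τ| := by
        rw [← lintegral_const_mul' _ _ ENNReal.ofReal_ne_top]
        refine setLIntegral_congr_fun hI fun t ht => ?_
        rw [hv t ht, abs_mul, abs_mul, abs_of_pos (hT.source.pos t ht), mul_assoc,
          ENNReal.ofReal_mul (abs_nonneg β), mul_assoc]
    _ ≤ _ := by
        gcongr
        refine (lintegral_weight_holder hT.source hpq
          ((hT.source.aemeasurable.pow_const _).mul (measurable_deriv w).aemeasurable)
          hT.aemeasurable).trans (le_of_eq ?_)
        congr 2
        have h1 := hT.lintegral (F := fun x => ENNReal.ofReal (|x| ^ q)) (by fun_prop)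
        refine Eq.trans ?_ (h1.trans ?_)
        · refine setLIntegral_congr_fun hI fun t _ => ?_
          rw [ENNReal.ofReal_mul (by positivity)]
        · refine setLIntegral_congr_fun hT.target.isOpen.measurableSet fun x _ => ?_
          rw [ENNReal.ofReal_mul (by positivity)]

/-- If `w` gets arbitrarily small on its support and `β < 0`, the Fisher information is infinite. -/
lemma fisher_eq_top {I : Set ℝ} {w : ℝ → ℝ} (hw : IsWeight I w)
    (h1 : ∫⁻ t in I, ENNReal.ofReal (w t) = 1)
    (hd : DifferentiableOn ℝ w I) {p q β : ℝ} (hpq : p.HolderConjugate q) (hβ : β < 0)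
    (hne : I.Nonempty) (hsmall : ∀ δ > 0, ∃ u ∈ I, w u < δ) :
    ∫⁻ t in I, ENNReal.ofReal (|w t ^ (β - 2) * deriv w t| ^ p * w t) = ∞ := by
  by_contra hfin
  obtain ⟨t, ht⟩ := hne
  have hI := hw.isOpen.measurableSet
  have hvd : DifferentiableOn ℝ (fun t => w t ^ β) I := fun t ht =>
    (hasDerivAt_rpow_density hw.isOpen hw.pos hd β ht).differentiableAt.differentiableWithinAt
  -- Hölder against the total mass 1 shows that finite Fisher information would give w^β finite
  -- variation, whereas small values of w make w^β unbounded.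
  have hh := lintegral_weight_holder hw hpq (Y := fun _ => 1)
    ((hw.aemeasurable.pow_const (β - 2)).mul (measurable_deriv w).aemeasurable) aemeasurable_const
  simp only [abs_one, Real.one_rpow, one_mul, ENNReal.ofReal_one, mul_one, h1, ENNReal.one_rpow,
    Pi.mul_apply] at hh
  have hV : ∫⁻ τ in I, ENNReal.ofReal |deriv (fun t => w t ^ β) τ| ≠ ∞ := by
    have : ∫⁻ τ in I, ENNReal.ofReal |deriv (fun t => w t ^ β) τ|
        = ENNReal.ofReal |β| * ∫⁻ τ in I, ENNReal.ofReal (|w τ ^ (β - 2) * deriv w τ| * w τ) := by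
      rw [← lintegral_const_mul' _ _ ENNReal.ofReal_ne_top]
      refine setLIntegral_congr_fun hI fun t ht => ?_
      rw [(hasDerivAt_rpow_density hw.isOpen hw.pos hd β ht).deriv, abs_mul, abs_mul,
        abs_of_pos (hw.pos t ht), mul_assoc, ENNReal.ofReal_mul (abs_nonneg β)]
    rw [this]
    exact ENNReal.mul_ne_top ENNReal.ofReal_ne_top
      (ne_top_of_le_ne_top (ENNReal.rpow_ne_top_of_nonneg (by simp [hpq.nonneg]) hfin) hh)
  set L := (∫⁻ τ in I, ENNReal.ofReal |deriv (fun t => w t ^ β) τ|).toReal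
  have hwt := hw.pos t ht
  have hLp : 0 < w t ^ β + L + 1 := by
    have : 0 ≤ L := ENNReal.toReal_nonneg
    positivity
  -- The threshold makes w^β at u exceed its value at t by more than its variation L.
  obtain ⟨u, hu, hwu⟩ := hsmall ((w t ^ β + L + 1) ^ (1 / β)) (Real.rpow_pos_of_pos hLp _)
  have hbig : w t ^ β + L + 1 < w u ^ β := by
    have := Real.rpow_lt_rpow_of_neg (hw.pos u hu) hwu hβ
    rwa [← Real.rpow_mul hLp.le, one_div_mul_cancel hβ.ne, Real.rpow_one] at this
  have h2 := ofReal_sub_le_lintegral_deriv hw.ordConnected hw.isOpen hvd ht hu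
  have h3 : ENNReal.ofReal |w u ^ β - w t ^ β| ≤ ENNReal.ofReal L := by
    rw [ENNReal.ofReal_toReal hV]
    exact h2.trans (lintegral_mono_set (uIoc_subset_uIcc.trans (hw.ordConnected.uIcc_subset ht hu)))
  rw [ENNReal.ofReal_le_ofReal_iff ENNReal.toReal_nonneg] at h3
  have := le_abs_self (w u ^ β - w t ^ β)
  linarith

/-! #### Behaviour at the ends of the support -/

lemma exists_gt_mem {I : Set ℝ} (hIo : IsOpen I) {t : ℝ} (ht : t ∈ I) : ∃ u ∈ I, t < u := by
  obtain ⟨ε, hε, hb⟩ := Metric.isOpen_iff.1 hIo t ht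
  exact ⟨t + ε / 2, hb (by simp [abs_of_pos hε]; linarith), by linarith⟩

lemma sSup_notMem {I : Set ℝ} (hIo : IsOpen I) (hb : BddAbove I) : sSup I ∉ I := fun h => by
  obtain ⟨u, hu, hlt⟩ := exists_gt_mem hIo h
  exact absurd (le_csSup hb hu) (not_le.2 hlt)

lemma bddAbove_of_volume_ne_top {I : Set ℝ} (hIc : I.OrdConnected) {t : ℝ} (ht : t ∈ I)
    (hfin : volume (I ∩ Ioi t) ≠ ∞) : BddAbove I := by
  by_contra hb
  apply hfin
  have : Ioi t ⊆ I ∩ Ioi t := fun x hx => by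
    obtain ⟨u, hu, hxu⟩ := not_bddAbove_iff.1 hb x
    exact ⟨hIc.out ht hu ⟨(show t < x from hx).le, hxu.le⟩, hx⟩
  rw [← top_le_iff, ← Real.volume_Ioi (a := t)]
  exact measure_mono this

/-- An integrable continuous function vanishing off an interval gets small near its right end. -/
lemma exists_small_right {I : Set ℝ} {w : ℝ → ℝ} (hw : IsWeight I w)
    (hfin : ∫⁻ t in I, ENNReal.ofReal (w t) ≠ ∞) (hc : Continuous w) (h0 : ∀ t ∉ I, w t = 0)
    {t δ : ℝ} (ht : t ∈ I) (hδ : 0 < δ) : ∃ u ∈ I, t < u ∧ w u < δ := by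
  by_contra hcon
  push Not at hcon
  have hm : MeasurableSet (I ∩ Ioi t) := hw.isOpen.measurableSet.inter measurableSet_Ioi
  -- A density bounded below by δ beyond t leaves only finite length there, so the support has a
  -- finite right end, where continuity and the value 0 are contradictory.
  have hvol : volume (I ∩ Ioi t) ≠ ∞ := by
    intro htop
    apply hfin
    rw [← top_le_iff]
    calc ∞ = ENNReal.ofReal δ * volume (I ∩ Ioi t) := by
          rw [htop, ENNReal.mul_top (by simpa using hδ)]
      _ = ∫⁻ u in I ∩ Ioi t, ENNReal.ofReal δ := by rw [setLIntegral_const]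
      _ ≤ ∫⁻ u in I ∩ Ioi t, ENNReal.ofReal (w u) :=
          setLIntegral_mono_ae' hm (Filter.Eventually.of_forall fun u hu =>
            ENNReal.ofReal_le_ofReal (hcon u hu.1 hu.2))
      _ ≤ _ := lintegral_mono_set inter_subset_left
  have hb := bddAbove_of_volume_ne_top hw.ordConnected ht hvol
  have he := sSup_notMem hw.isOpen hb
  have hte : t < sSup I := lt_of_le_of_ne (le_csSup hb ht) fun h => he (h ▸ ht)
  have hcl : ∀ u ∈ Ioo t (sSup I), δ ≤ w u := by
    intro u hu
    obtain ⟨z, hz, huz⟩ := exists_lt_of_lt_csSup ⟨t, ht⟩ hu.2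
    exact hcon u (hw.ordConnected.out ht hz ⟨hu.1.le, huz.le⟩) hu.1
  have hlim : δ ≤ w (sSup I) := by
    have hmem : sSup I ∈ closure (Ioo t (sSup I)) := by
      rw [closure_Ioo hte.ne]; exact right_mem_Icc.2 hte.le
    exact closure_minimal hcl (isClosed_le continuous_const hc) hmem
  rw [h0 _ he] at hlim
  linarith

/-- If w stayed below M beyond t, that part of `I` would lie in a compact subset of `I`, which would
then contain the supremum of `I`; an open interval does not. -/
lemma exists_large_right {I : Set ℝ} (hIo : IsOpen I) (hIc : I.OrdConnected) {w : ℝ → ℝ}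
    (hlim : ∀ M : ℝ, ∃ C ⊆ I, IsCompact C ∧ ∀ t ∈ I \ C, M < w t) {t : ℝ} (ht : t ∈ I) (M : ℝ) :
    ∃ u ∈ I, t < u ∧ M < w u := by
  obtain ⟨C, hCI, hC, hCw⟩ := hlim M
  by_contra hcon
  push Not at hcon
  have hsub : I ∩ Ioi t ⊆ C := fun u hu => by
    by_contra huC
    exact absurd (hCw u ⟨hu.1, huC⟩) (not_lt.2 (hcon u hu.1 hu.2))
  have hb : BddAbove I := bddAbove_of_volume_ne_top hIc ht
    (ne_top_of_le_ne_top hC.measure_lt_top.ne (measure_mono hsub))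
  have he := sSup_notMem hIo hb
  have hte : t < sSup I := lt_of_le_of_ne (le_csSup hb ht) fun h => he (h ▸ ht)
  apply he
  apply hCI
  have hmem : sSup I ∈ closure (Ioo t (sSup I)) := by
    rw [closure_Ioo hte.ne]; exact right_mem_Icc.2 hte.le
  refine closure_minimal (fun u hu => hsub ?_) hC.isClosed hmem
  obtain ⟨z, hz, huz⟩ := exists_lt_of_lt_csSup ⟨t, ht⟩ hu.2
  exact ⟨hIc.out ht hz ⟨hu.1.le, huz.le⟩, hu.1⟩

lemma IsWeight.comp_neg {I : Set ℝ} {w : ℝ → ℝ} (hw : IsWeight I w) :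
    IsWeight (-I) (fun t => w (-t)) := by
  refine ⟨hw.isOpen.neg, ⟨fun a ha b hb x hx => ?_⟩, ?_, fun x hx => hw.pos _ hx⟩
  · exact hw.ordConnected.out hb ha ⟨neg_le_neg hx.2, neg_le_neg hx.1⟩
  · have hmp : MeasurePreserving (fun t : ℝ => -t) (volume.restrict (-I)) (volume.restrict I) :=
      (Measure.measurePreserving_neg volume).restrict_preimage hw.isOpen.measurableSet
    exact hw.aemeasurable.comp_quasiMeasurePreserving hmp.quasiMeasurePreserving

lemma exists_small_left {I : Set ℝ} {w : ℝ → ℝ} (hw : IsWeight I w)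
    (hfin : ∫⁻ t in I, ENNReal.ofReal (w t) ≠ ∞) (hc : Continuous w) (h0 : ∀ t ∉ I, w t = 0)
    {t δ : ℝ} (ht : t ∈ I) (hδ : 0 < δ) : ∃ u ∈ I, u < t ∧ w u < δ := by
  have hmp : MeasurePreserving (fun t : ℝ => -t) (volume.restrict (-I)) (volume.restrict I) :=
      (Measure.measurePreserving_neg volume).restrict_preimage hw.isOpen.measurableSet
  have hfin' : ∫⁻ t in -I, ENNReal.ofReal (w (-t)) ≠ ∞ := by
    rwa [hmp.lintegral_comp_emb (MeasurableEquiv.neg ℝ).measurableEmbedding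
      (fun t => ENNReal.ofReal (w t))]
  obtain ⟨u, hu, htu, hwu⟩ := exists_small_right hw.comp_neg hfin' (hc.comp continuous_neg)
    (fun t ht => h0 _ ht) (t := -t) (by simpa using ht) hδ
  exact ⟨-u, hu, by linarith, hwu⟩

lemma exists_large_left {I : Set ℝ} (hIo : IsOpen I) (hIc : I.OrdConnected) {w : ℝ → ℝ}
    (hlim : ∀ M : ℝ, ∃ C ⊆ I, IsCompact C ∧ ∀ t ∈ I \ C, M < w t) {t : ℝ} (ht : t ∈ I) (M : ℝ) :
    ∃ u ∈ I, u < t ∧ M < w u := by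
  have hoc : (-I).OrdConnected := ⟨fun a ha b hb x hx =>
    hIc.out hb ha ⟨neg_le_neg hx.2, neg_le_neg hx.1⟩⟩
  obtain ⟨u, hu, htu, hwu⟩ := exists_large_right hIo.neg hoc (w := fun t => w (-t))
    (fun M => by
      obtain ⟨C, hCI, hC, hCw⟩ := hlim M
      exact ⟨-C, neg_subset_neg.2 hCI, hC.neg, fun t ht => hCw (-t) ⟨ht.1, fun h => ht.2 h⟩⟩)
    (t := -t) (by simpa using ht) M
  exact ⟨-u, hu, by linarith, hwu⟩

/-- The bound of the Fisher information for regular densities. -/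
lemma stam_upper_of_regular {I J : Set ℝ} {w g s : ℝ → ℝ} (hT : IsTransport I w J g s)
    (h1 : ∫⁻ t in I, ENNReal.ofReal (w t) = 1) (hw0 : ∀ t ∉ I, w t = 0)
    (h0 : (0 : ℝ) ∈ J) (hd : DifferentiableOn ℝ w I) {p q β θ : ℝ} (hpq : p.HolderConjugate q)
    (hβθ : 0 < β * θ) (hreg : StamRegular p θ I w)
    (hM : ∫⁻ x in J, ENNReal.ofReal (|x| ^ q * g x) ≠ 0) :
    ∫⁻ t in I, ENNReal.ofReal (w t ^ (1 + β) / g (s t)) ≤ ENNReal.ofReal |β| *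
      ((∫⁻ t in I, ENNReal.ofReal (|w t ^ (β - 2) * deriv w t| ^ p * w t)) ^ (1 / p)
        * (∫⁻ x in J, ENNReal.ofReal (|x| ^ q * g x)) ^ (1 / q)) := by
  have hβ0 : β ≠ 0 := by rintro rfl; simp at hβθ
  have hfin : ∫⁻ t in I, ENNReal.ofReal (w t) ≠ ∞ := by simp [h1]
  rcases hreg with hp | hac | ⟨hθ, -, hlim⟩
  · exact absurd hp hpq.lt.ne'
  · have hc : Continuous w := continuous_iff_continuousAt.2 fun t =>
      (hac (t - 1) (t + 1)).continuousOn.continuousAt (by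
        rw [uIcc_of_le (by linarith)]
        exact Icc_mem_nhds (by linarith) (by linarith))
    -- A density continuous on the whole line gets small near the ends of its support. For β < 0
    -- this makes the Fisher information infinite and the bound trivial; for β > 0 it makes w^β
    -- small, as integration by parts requires.
    rcases lt_or_gt_of_ne hβ0 with hβ | hβ
    · obtain ⟨c, hc', -⟩ : ∃ c ∈ I, s c = 0 := by rwa [← hT.image] at h0
      rw [fisher_eq_top hT.source h1 hd hpq hβ ⟨c, hc'⟩ fun δ hδ => by
        obtain ⟨u, hu, -, hwu⟩ := exists_small_right hT.source hfin hc hw0 hc' hδ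
        exact ⟨u, hu, hwu⟩]
      rw [ENNReal.top_rpow_of_pos (by simp [hpq.pos]), ENNReal.top_mul, ENNReal.mul_top]
      · exact le_top
      · simpa using hβ0
      · simp [ENNReal.rpow_eq_zero_iff, hM, hpq.symm.nonneg, hpq.symm.pos, not_lt.2]
    · have key : ∀ ε > 0, ∀ u ∈ I, w u < ε ^ (1 / β) → w u ^ β < ε := by
        intro ε hε u hu h
        have := Real.rpow_lt_rpow (hT.source.pos u hu).le h hβ
        rwa [← Real.rpow_mul hε.le, one_div_mul_cancel hβ0, Real.rpow_one] at this
      refine stam_upper hT h0 hd hpq (fun t ht ε hε => ?_) (fun t ht ε hε => ?_)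
      · obtain ⟨u, hu, htu, hwu⟩ := exists_small_right hT.source hfin hc hw0 ht
          (Real.rpow_pos_of_pos hε (1 / β))
        exact ⟨u, hu, htu, key ε hε u hu hwu⟩
      · obtain ⟨u, hu, htu, hwu⟩ := exists_small_left hT.source hfin hc hw0 ht
          (Real.rpow_pos_of_pos hε (1 / β))
        exact ⟨u, hu, htu, key ε hε u hu hwu⟩
  -- Here θ < 0 and βθ > 0 force β < 0, so the blow-up of w at both ends makes w^β small there.
  · have hβ : β < 0 := by
      by_contra h
      exact absurd hβθ (not_lt.2 (mul_nonpos_of_nonneg_of_nonpos (not_lt.1 h) hθ.le))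
    have key : ∀ ε > 0, ∀ u ∈ I, ε ^ (1 / β) < w u → w u ^ β < ε := by
      intro ε hε u hu h
      have := Real.rpow_lt_rpow_of_neg (Real.rpow_pos_of_pos hε _) h hβ
      rwa [← Real.rpow_mul hε.le, one_div_mul_cancel hβ0, Real.rpow_one] at this
    refine stam_upper hT h0 hd hpq (fun t ht ε hε => ?_) (fun t ht ε hε => ?_)
    · obtain ⟨u, hu, htu, hwu⟩ := exists_large_right hT.source.isOpen hT.source.ordConnected hlim
        ht (ε ^ (1 / β))
      exact ⟨u, hu, htu, key ε hε u hu hwu⟩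
    · obtain ⟨u, hu, htu, hwu⟩ := exists_large_left hT.source.isOpen hT.source.ordConnected hlim
        ht (ε ^ (1 / β))
      exact ⟨u, hu, htu, key ε hε u hu hwu⟩

/-! ### Exponents in the Stam inequality -/

/-- For negative exponents the product rule fails only at 0 · ∞, so one factor that is neither is
enough; the Fisher factor may then be degenerate. -/
lemma ennreal_mul_rpow {x : ℝ≥0∞} (h0 : x ≠ 0) (hT : x ≠ ∞) (y : ℝ≥0∞) (z : ℝ) :
    (x * y) ^ z = x ^ z * y ^ z := by
  rw [ENNReal.mul_rpow_eq_ite, if_neg]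
  rintro ⟨⟨h, -⟩ | ⟨h, -⟩, -⟩
  · exact h0 h
  · exact hT h

/-- With X = a (c/a)^(1/(1-γ)), the two bounds of B give X/D ≤ Φ, and the estimate for the minimizer
gives Ψ ≤ c/D. The identity a^k (X/D)^(1/γ) = c^k (c/D)^(1/γ), k = 1/(1-γ), links them. Equality at
the ends forces DΦ ≤ X, hence B = X; equality in Hölder is never analysed. -/
lemma stam_chain {a c D γ : ℝ} (ha : 0 < a) (hc : 0 < c) (hD : 0 < D) (hγ : 0 < γ) (hγ1 : γ ≠ 1)
    {B Φ Ψ : ℝ≥0∞} (h1 : ENNReal.ofReal (a * (c / a) ^ (1 / (1 - γ))) ≤ B)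
    (h2 : B ≤ ENNReal.ofReal D * Φ) (h3 : ENNReal.ofReal D * Ψ ≤ ENNReal.ofReal c) :
    ENNReal.ofReal c ^ (1 / (1 - γ)) * Ψ ^ (1 / γ)
      ≤ ENNReal.ofReal a ^ (1 / (1 - γ)) * Φ ^ (1 / γ) ∧
    (ENNReal.ofReal a ^ (1 / (1 - γ)) * Φ ^ (1 / γ)
        = ENNReal.ofReal c ^ (1 / (1 - γ)) * Ψ ^ (1 / γ) →
      B = ENNReal.ofReal (a * (c / a) ^ (1 / (1 - γ)))) := by
  have hγ' : 1 - γ ≠ 0 := sub_ne_zero.2 hγ1.symm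
  set k := 1 / (1 - γ) with hk
  set X := a * (c / a) ^ k with hX
  have hX0 : 0 < X := by positivity
  have hD0 : ENNReal.ofReal D ≠ 0 := by simpa using hD
  have hkey : ENNReal.ofReal a ^ k * ENNReal.ofReal (X / D) ^ (1 / γ)
      = ENNReal.ofReal c ^ k * ENNReal.ofReal (c / D) ^ (1 / γ) := by
    rw [ENNReal.ofReal_rpow_of_pos ha, ENNReal.ofReal_rpow_of_pos hc,
      ENNReal.ofReal_rpow_of_pos (by positivity), ENNReal.ofReal_rpow_of_pos (by positivity),
      ← ENNReal.ofReal_mul (by positivity), ← ENNReal.ofReal_mul (by positivity)]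
    congr 1
    rw [Real.div_rpow hX0.le hD.le, Real.div_rpow hc.le hD.le, mul_div_assoc', mul_div_assoc']
    congr 1
    rw [hX, Real.mul_rpow ha.le (by positivity), ← Real.rpow_mul (by positivity),
      Real.div_rpow hc.le ha.le]
    have e1 : c ^ (k * (1 / γ)) = c ^ k * c ^ (1 / γ) := by
      rw [← Real.rpow_add hc]
      congr 1
      rw [hk]; field_simp; ring
    have e2 : a ^ (k * (1 / γ)) = a ^ k * a ^ (1 / γ) := by
      rw [← Real.rpow_add ha]
      congr 1
      rw [hk]; field_simp; ring
    rw [e1, e2]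
    field_simp
  have hΨ : Ψ ≤ ENNReal.ofReal (c / D) := by
    rw [ENNReal.ofReal_div_of_pos hD, ENNReal.le_div_iff_mul_le (Or.inl hD0)
      (Or.inl ENNReal.ofReal_ne_top), mul_comm]
    exact h3
  have hle : ENNReal.ofReal c ^ k * Ψ ^ (1 / γ)
      ≤ ENNReal.ofReal a ^ k * ENNReal.ofReal (X / D) ^ (1 / γ) := by
    rw [hkey]
    gcongr
  have hΦ : ENNReal.ofReal (X / D) ≤ Φ := by
    rw [ENNReal.ofReal_div_of_pos hD, ENNReal.div_le_iff_le_mul (Or.inl hD0)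
      (Or.inl ENNReal.ofReal_ne_top), mul_comm]
    exact h1.trans h2
  constructor
  · refine hle.trans ?_
    gcongr
  · intro heq
    rw [← heq, ENNReal.ofReal_rpow_of_pos ha, ENNReal.mul_le_mul_iff_right
      (by simpa using Real.rpow_pos_of_pos ha k) ENNReal.ofReal_ne_top,
      ENNReal.rpow_le_rpow_iff (by positivity)] at hle
    refine le_antisymm (h2.trans ?_) h1
    calc ENNReal.ofReal D * Φ ≤ ENNReal.ofReal D * ENNReal.ofReal (X / D) := by gcongr
      _ = ENNReal.ofReal X := by
        rw [← ENNReal.ofReal_mul hD.le, mul_div_cancel₀ _ hD.ne']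

lemma fisher_mul_renyi_rpow {A Φ : ℝ≥0∞} (h0 : A ≠ 0) (hA : A ≠ ∞) {l β θ γ : ℝ} (hl : l ≠ 1)
    (hθ : θ = 1 + β - l) (hθ0 : θ ≠ 0) (hγ : γ = β / θ) :
    (Φ ^ (1 / β) * A ^ (1 / (1 - l))) ^ θ = A ^ (1 / (1 - γ)) * Φ ^ (1 / γ) := by
  have h1 : 1 - γ = (1 - l) / θ := by rw [hγ]; field_simp; rw [hθ]; ring
  have hl' : 1 - l ≠ 0 := sub_ne_zero.2 hl.symm
  have hA' : A ^ (1 / (1 - l)) ≠ 0 := by simp [ENNReal.rpow_eq_zero_iff, h0, hA]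
  have hA'' : A ^ (1 / (1 - l)) ≠ ∞ := by simp [ENNReal.rpow_eq_top_iff, h0, hA]
  rw [mul_comm, ennreal_mul_rpow hA' hA'', ← ENNReal.rpow_mul, ← ENNReal.rpow_mul, h1, hγ]
  congr 2
  · field_simp
  · rw [one_div_div, one_div_mul_eq_div]

/-- The exponents match through 1 - γ = (1-l)/θ. The factor α inside the Fisher term contributes
α^(θ/(αβ)), exactly compensated by the explicit power of α. -/
lemma relFisher_mul_renyi_rpow {A Φr : ℝ≥0∞} (h0 : A ≠ 0) (hA : A ≠ ∞) {l β θ γ α : ℝ}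
    (hα : 0 < α) (hl : l ≠ 1) (hθ : θ = 1 + β - l) (hθ0 : θ ≠ 0) (hβ : β ≠ 0) (hγ : γ = β / θ) :
    ((A ^ (1 / (1 - l))) ^ (1 / α) * Φr ^ (1 / (β * α))) ^ θ
      = ENNReal.ofReal α ^ ((l - β - 1) / (α * β))
        * (A ^ (1 / (1 - γ)) * (ENNReal.ofReal α * Φr) ^ (1 / γ)) ^ (1 / α) := by
  have h1 : 1 - γ = (1 - l) / θ := by rw [hγ]; field_simp; rw [hθ]; ring
  have hl' : 1 - l ≠ 0 := sub_ne_zero.2 hl.symm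
  have hα0 : ENNReal.ofReal α ≠ 0 := by simpa using hα
  have hpw : ∀ z : ℝ, A ^ z ≠ 0 ∧ A ^ z ≠ ∞ := fun z => by
    simp [ENNReal.rpow_eq_zero_iff, ENNReal.rpow_eq_top_iff, h0, hA]
  have hpw' : ∀ z : ℝ, ENNReal.ofReal α ^ z ≠ 0 ∧ ENNReal.ofReal α ^ z ≠ ∞ := fun z => by
    simp [ENNReal.rpow_eq_zero_iff, ENNReal.rpow_eq_top_iff, hα]
  rw [← ENNReal.rpow_mul, ennreal_mul_rpow (hpw _).1 (hpw _).2, ← ENNReal.rpow_mul,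
    ← ENNReal.rpow_mul, ennreal_mul_rpow (hpw _).1 (hpw _).2,
    ennreal_mul_rpow hα0 ENNReal.ofReal_ne_top, ennreal_mul_rpow (hpw' _).1 (hpw' _).2,
    ← ENNReal.rpow_mul, ← ENNReal.rpow_mul, ← ENNReal.rpow_mul]
  rw [mul_left_comm, ← mul_assoc (ENNReal.ofReal α ^ _), ← ENNReal.rpow_add _ _ hα0
    ENNReal.ofReal_ne_top]
  have e1 : (l - β - 1) / (α * β) + 1 / γ * (1 / α) = 0 := by
    rw [hγ]; field_simp; rw [hθ]; ring
  rw [e1, ENNReal.rpow_zero, one_mul, h1, hγ]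
  congr 2
  · field_simp
  · field_simp

/-- If `w^θ` is proportional to `g ∘ s` then `w` is, up to translation and scaling, the
differential-escort transform of `g` of order `1/θ`. -/
lemma stam_rigidity {I J : Set ℝ} {w g s : ℝ → ℝ} (hT : IsTransport I w J g s)
    (hw0 : ∀ t ∉ I, w t = 0) (h0 : (0 : ℝ) ∈ J) {θ : ℝ} (hθ : θ ≠ 0) {y : ℝ → ℝ}
    (hy : IsChangeOfVar J g (fun _ => 1) (1 / θ) y) (hy0 : y 0 = 0) {m : ℝ} (hm : 0 < m)
    (hae : ∀ᵐ t ∂(volume.restrict I), w t ^ θ = m * g (s t)) :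
    ∃ r > 0, ∃ t₀, ∀ᵐ t, w t = r * relTransform J g (fun _ => 1) (1 / θ) y (r * (t - t₀)) := by
  have hJ1 : IsWeight J (fun _ => 1) := isWeight_one hT.target.isOpen hT.target.ordConnected
  have hTy := hy.isTransport hT.target hJ1
  obtain ⟨t₀, ht₀, hst₀⟩ : ∃ c ∈ I, s c = 0 := by rwa [← hT.image] at h0
  set r := m ^ (1 / θ) with hr
  have hr0 : 0 < r := by positivity
  have hpt : ∀ᵐ t ∂(volume.restrict I), w t = r * g (s t) ^ (1 / θ) := by
    filter_upwards [hae, ae_restrict_mem hT.source.isOpen.measurableSet] with t h1 ht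
    rw [hr, ← Real.mul_rpow hm.le (hT.target.pos _ (hT.mem ht)).le, ← h1,
      ← Real.rpow_mul (hT.source.pos t ht).le, mul_one_div_cancel hθ, Real.rpow_one]
  -- The derivative of y∘s is g(s)^(1-1/θ) · w/g(s) = g(s)^(-1/θ) w.
  have hT2 : IsTransport I (fun t => g (s t) ^ (-(1 / θ)) * w t) (y '' J) (fun _ => 1)
      (fun t => y (s t)) := by
    refine (hT.mul (isWeight_rpow hT.target (-(1 / θ))).aemeasurable
      (isWeight_rpow hT.target (-(1 / θ))).pos).trans (hTy.congr (fun x hx => ?_) fun _ _ => rfl)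
    rw [← Real.rpow_add_one (hT.target.pos x hx).ne', Real.one_rpow, mul_one]
    congr 1
    ring
  -- By the proportionality of w^θ and g(s) this derivative is the constant r, so y∘s is affine, and
  -- it vanishes where s does.
  have hlin : ∀ t ∈ I, y (s t) = r * (t - t₀) := by
    intro t ht
    have h1 := (hT2.primitive t₀ ht₀ t ht).2
    rw [hst₀, hy0, sub_zero] at h1
    rw [h1]
    have h2 : ∫ x in t₀..t, g (s x) ^ (-(1 / θ)) * w x = ∫ x in t₀..t, r := by
      refine intervalIntegral.integral_congr_ae_restrict ?_
      have hsub : uIoc t₀ t ⊆ I := uIoc_subset_uIcc.trans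
        (hT.source.ordConnected.uIcc_subset ht₀ ht)
      filter_upwards [ae_restrict_of_ae_restrict_of_subset hsub hpt,
        ae_restrict_of_ae_restrict_of_subset hsub
          (ae_restrict_mem hT.source.isOpen.measurableSet)] with x h3 hx
      have hgx := hT.target.pos _ (hT.mem hx)
      rw [h3, mul_left_comm, ← Real.rpow_add hgx]
      simp
    rw [h2, intervalIntegral.integral_const, smul_eq_mul, mul_comm]
  refine ⟨r, hr0, t₀, ?_⟩
  filter_upwards [(ae_restrict_iff' hT.source.isOpen.measurableSet).1 hpt] with t ht
  by_cases htI : t ∈ I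
  · rw [ht htI, ← hlin t htI, relTransform_apply hTy.strictMonoOn (hT.mem htI), div_one]
  · rw [hw0 t htI, relTransform_eq_zero, mul_zero]
    intro hmem
    rw [← hT2.image] at hmem
    obtain ⟨t', ht', heq⟩ := hmem
    simp only at heq
    rw [hlin t' ht'] at heq
    have : t' = t := by
      have := mul_left_cancel₀ hr0.ne' heq
      linarith
    exact htI (this ▸ ht')

lemma relTransform_translate {Ω : Set ℝ} {f h y : ℝ → ℝ} {α : ℝ} (hm : StrictMonoOn y Ω) (t₀ t : ℝ) :
    relTransform Ω f h α (fun x => y x - t₀) t = relTransform Ω f h α y (t + t₀) := by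
  have hm' : StrictMonoOn (fun x => y x - t₀) Ω := fun a ha b hb hab =>
    sub_lt_sub_right (hm ha hb hab) _
  by_cases ht : t ∈ (fun x => y x - t₀) '' Ω
  · obtain ⟨x, hx, rfl⟩ := ht
    rw [relTransform_apply hm' hx, sub_add_cancel, relTransform_apply hm hx]
  · rw [relTransform_eq_zero ht, relTransform_eq_zero]
    rintro ⟨x, hx, hxt⟩
    exact ht ⟨x, hx, by simp [hxt]⟩

lemma IsChangeOfVar.sub_const {Ω : Set ℝ} {f h y : ℝ → ℝ} {α : ℝ} (hy : IsChangeOfVar Ω f h α y)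
    (t₀ : ℝ) : IsChangeOfVar Ω f h α (fun x => y x - t₀) := fun a ha b hb =>
  ⟨(hy a ha b hb).1, by rw [← (hy a ha b hb).2]; ring⟩

lemma isIntervalDensity_relTransform {Ω : Set ℝ} {f h y : ℝ → ℝ} {α : ℝ}
    (hy : IsChangeOfVar Ω f h α y) (hf : IsWeight Ω f) (hh : IsWeight Ω h)
    (h1 : ∫⁻ x in Ω, ENNReal.ofReal (f x) = 1) :
    IsIntervalDensity (relTransform Ω f h α y) := by
  have hT := hy.isTransport hf hh
  have hd := relTransform_isDensity hy hf hh h1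
  refine ⟨⟨?_, ?_, hd.aemeasurable.restrict, fun x hx => hx⟩, hd.nonneg, hd.lintegral_eq_one⟩
  · rw [setOf_relTransform_pos hT.strictMonoOn hf hh]; exact hT.target.isOpen
  · rw [setOf_relTransform_pos hT.strictMonoOn hf hh]; exact hT.target.ordConnected

/-! ### The escort density that minimizes the Stam functional -/

/-- The densities `g` and parameters for which the differential-escort transform of `g` of order
`1 / θ` can extremize the Stam inequality. -/
structure StamData (g : ℝ → ℝ) (γ θ : ℝ) : Prop where
  density : IsIntervalDensity g
  zero_pos : 0 < g 0
  differentiableOn : DifferentiableOn ℝ g {x | 0 < g x}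
  gamma_pos : 0 < γ
  gamma_ne : γ ≠ 1
  theta_ne : θ ≠ 0

/-- The change of variable of the differential-escort transformation of order `1 / θ`. -/
noncomputable def escortVar (g : ℝ → ℝ) (θ x : ℝ) : ℝ := ∫ s in (0 : ℝ)..x, g s ^ (1 - 1 / θ)

/-- The differential-escort transform of order `1 / θ`. -/
noncomputable def escort (g : ℝ → ℝ) (θ : ℝ) : ℝ → ℝ :=
  relTransform {x | 0 < g x} g (fun _ => 1) (1 / θ) (escortVar g θ)

namespace StamData

variable {g : ℝ → ℝ} {γ θ : ℝ}

lemma isWeight_one (hg : StamData g γ θ) : IsWeight {x | 0 < g x} (fun _ => 1) :=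
  RelEscort.isWeight_one hg.density.isWeight.isOpen hg.density.isWeight.ordConnected

lemma isChangeOfVar (hg : StamData g γ θ) :
    IsChangeOfVar {x | 0 < g x} g (fun _ => 1) (1 / θ) (escortVar g θ) := by
  have hc : ContinuousOn (fun x => g x ^ (1 - 1 / θ)) {x | 0 < g x} :=
    hg.differentiableOn.continuousOn.rpow_const fun x hx => Or.inl (show 0 < g x from hx).ne'
  have hi : ∀ a ∈ {x | 0 < g x}, ∀ b ∈ {x | 0 < g x},
      IntervalIntegrable (fun x => g x ^ (1 - 1 / θ)) volume a b := fun a ha b hb =>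
    (hc.mono (hg.density.isWeight.ordConnected.uIcc_subset ha hb)).intervalIntegrable
  intro a ha b hb
  simp only [Real.one_rpow, mul_one]
  refine ⟨hi a ha b hb, ?_⟩
  rw [escortVar, escortVar, intervalIntegral.integral_interval_sub_left (hi _ hg.zero_pos _ hb)
    (hi _ hg.zero_pos _ ha)]

lemma isTransport (hg : StamData g γ θ) :
    IsTransport {x | 0 < g x} (fun x => g x ^ (1 - 1 / θ) * 1 ^ (1 / θ))
      (escortVar g θ '' {x | 0 < g x}) (fun _ => 1) (escortVar g θ) :=
  hg.isChangeOfVar.isTransport hg.density.isWeight hg.isWeight_one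

lemma escort_apply (hg : StamData g γ θ) {x : ℝ} (hx : 0 < g x) :
    escort g θ (escortVar g θ x) = g x ^ (1 / θ) := by
  rw [escort, relTransform_apply hg.isTransport.strictMonoOn hx, div_one]

lemma setOf_escort_pos (hg : StamData g γ θ) :
    {t | 0 < escort g θ t} = escortVar g θ '' {x | 0 < g x} :=
  setOf_relTransform_pos hg.isTransport.strictMonoOn hg.density.isWeight hg.isWeight_one

lemma isIntervalDensity_escort (hg : StamData g γ θ) : IsIntervalDensity (escort g θ) :=
  isIntervalDensity_relTransform hg.isChangeOfVar hg.density.isWeight hg.isWeight_one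
    hg.density.setLIntegral

lemma differentiableOn_escort (hg : StamData g γ θ) :
    DifferentiableOn ℝ (escort g θ) {t | 0 < escort g θ t} := by
  rw [hg.setOf_escort_pos]
  rintro _ ⟨x, hx, rfl⟩
  exact (hasDerivAt_relTransform hg.isChangeOfVar hg.density.isWeight hg.isWeight_one
    hg.differentiableOn (differentiableOn_const 1) hx).differentiableAt.differentiableWithinAt

/-- The parameters are matched so that 1 + (l-1)/θ = γ. -/
lemma lintegral_escort_rpow (hg : StamData g γ θ) {β l : ℝ} (hβ : β = γ * θ)
    (hl : l = 1 + β - θ) :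
    ∫⁻ t in {t | 0 < escort g θ t}, ENNReal.ofReal (escort g θ t ^ l)
      = ∫⁻ x in {x | 0 < g x}, ENNReal.ofReal (g x ^ γ) := by
  rw [escort, lintegral_relTransform_rpow hg.isChangeOfVar hg.density.isWeight hg.isWeight_one]
  simp only [Real.one_rpow, mul_one]
  have hθ := hg.theta_ne
  rw [show 1 + 1 / θ * (l - 1) = γ by rw [hl, hβ]; field_simp; ring]

end StamData

/-! ### The relative Stam inequality with unspecified Fisher bounds -/

section Relative

variable {Ω : Set ℝ} {h : ℝ → ℝ} {α l β θ γ : ℝ} {g : ℝ → ℝ}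

lemma exp_neg_renyiDiv {f y : ℝ → ℝ} (hα : 0 < α) (hl : l ≠ 1)
    (hy : IsChangeOfVar Ω f h α y) (hf : IsWeight Ω f) (hh : IsWeight Ω h) :
    EReal.exp (-renyiDiv Ω (xi l α) f h)
      = ((∫⁻ t in {t | 0 < relTransform Ω f h α y t},
          ENNReal.ofReal (relTransform Ω f h α y t ^ l)) ^ (1 / (1 - l))) ^ (1 / α) := by
  rw [EReal.exp_neg, exp_renyiDiv hα hl hy hf hh, ENNReal.rpow_neg, inv_inv, renyiPower]

lemma lintegral_relTransform_rpow_ne_zero {f y : ℝ → ℝ}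
    (hy : IsChangeOfVar Ω f h α y) (hf : IsWeight Ω f) (hh : IsWeight Ω h)
    (h1 : ∫⁻ x in Ω, ENNReal.ofReal (f x) = 1) (l : ℝ) :
    ∫⁻ t in {t | 0 < relTransform Ω f h α y t},
      ENNReal.ofReal (relTransform Ω f h α y t ^ l) ≠ 0 := by
  have hw := isIntervalDensity_relTransform hy hf hh h1
  exact (isWeight_rpow hw.isWeight l).lintegral_ne_zero hw.nonempty

/-- `D`, `Ψ` and `Φr` are kept abstract so that p = 1 and p > 1 share the argument: `D` is the
factor in the upper bound for B, `Ψ` the Fisher value of the minimizer, and `Φr` the relative Fisher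
value of f. -/
theorem relative_stam (hΩo : IsOpen Ω) (hΩc : Ω.OrdConnected) (hh : IsDensityOn Ω h)
    (hα : 0 < α) (hl : l ≠ 1) (hg : StamData g γ θ) (hβ0 : β ≠ 0) (hβ : β = γ * θ)
    (hlθ : l = 1 + β - θ) {c D : ℝ} (hc0 : 0 < c) (hD : 0 < D)
    (hc : ∫⁻ x in {x | 0 < g x}, ENNReal.ofReal (g x ^ γ) = ENNReal.ofReal c)
    {Ψ : ℝ≥0∞} (hΨ : ENNReal.ofReal D * Ψ ≤ ENNReal.ofReal c)
    {f y : ℝ → ℝ} (hf : IsDensityOn Ω f) (hy : IsChangeOfVar Ω f h α y)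
    (hK : renyiIntegral Ω (xi l α) f h ≠ ∞) {p : ℝ} {Φr : ℝ≥0∞}
    (hΦr : relFisher Ω p (β * α) f h = Φr ^ (1 / (β * α)))
    (hB : ∀ s, IsTransport (y '' Ω) (relTransform Ω f h α y) {x | 0 < g x} g s →
      ∫⁻ t in y '' Ω, ENNReal.ofReal (relTransform Ω f h α y t ^ (1 + β) / g (s t))
        ≤ ENNReal.ofReal D * (ENNReal.ofReal α * Φr)) :
    ENNReal.ofReal α ^ ((l - β - 1) / (α * β))
        * (ENNReal.ofReal c ^ (1 / (1 - γ)) * Ψ ^ (1 / γ)) ^ (1 / α)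
      ≤ (EReal.exp (-renyiDiv Ω (xi l α) f h) * relFisher Ω p (β * α) f h) ^ θ ∧
    (renyiPower ((α - 1) / α) (escort g θ) ≠ ∞ →
      (EReal.exp (-renyiDiv Ω (xi l α) f h) * relFisher Ω p (β * α) f h) ^ θ
        = ENNReal.ofReal α ^ ((l - β - 1) / (α * β))
          * (ENNReal.ofReal c ^ (1 / (1 - γ)) * Ψ ^ (1 / γ)) ^ (1 / α) →
      ∀ᵐ x ∂(volume.restrict Ω), f x = invTransform Ω h α (escort g θ) x) := by
  have hfw := hf.isWeight hΩo hΩc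
  have hhw := hh.isWeight hΩo hΩc
  have hf1 := hf.setLIntegral hΩc
  have hT := hy.isTransport hfw hhw
  have hpos := setOf_relTransform_pos (α := α) hT.strictMonoOn hfw hhw
  have hwd := isIntervalDensity_relTransform hy hfw hhw hf1
  have hA0 := lintegral_relTransform_rpow_ne_zero hy hfw hhw hf1 l
  rw [renyiIntegral_eq hy hfw hhw] at hK
  have hγβ : γ = β / θ := by rw [hβ, mul_div_cancel_right₀ _ hg.theta_ne]
  rw [exp_neg_renyiDiv hα hl hy hfw hhw, hΦr, relFisher_mul_renyi_rpow hA0 hK hα hl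
    (by linarith) hg.theta_ne hβ0 hγβ]
  -- The increasing rearrangement: the distribution function of w followed by the quantile function
  -- of g.
  obtain ⟨s, hs⟩ : ∃ s, IsTransport (y '' Ω) (relTransform Ω f h α y) {x | 0 < g x} g s := by
    have hIw : IsWeight (y '' Ω) (relTransform Ω f h α y) := hpos ▸ hwd.isWeight
    exact ⟨_, (isTransport_cdf hIw (hpos ▸ hwd.setLIntegral)).trans
      (isTransport_cdf hg.density.isWeight hg.density.setLIntegral).symm⟩
  set a := (∫⁻ t in {t | 0 < relTransform Ω f h α y t},
    ENNReal.ofReal (relTransform Ω f h α y t ^ l)).toReal with ha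
  have ha0 : 0 < a := ENNReal.toReal_pos hA0 hK
  have hAa := (ENNReal.ofReal_toReal hK).symm
  rw [← ha] at hAa
  rw [hAa]
  rw [hpos] at hAa
  have hj := stam_jensen hs hg.gamma_pos hg.gamma_ne hβ hlθ ha0 hc0 hAa hc
  have hch := stam_chain ha0 hc0 hD hg.gamma_pos hg.gamma_ne hj.1 (hB s hs) hΨ
  have hα0 : ENNReal.ofReal α ≠ 0 := by simpa using hα
  have hpw : ENNReal.ofReal α ^ ((l - β - 1) / (α * β)) ≠ 0 ∧
      ENNReal.ofReal α ^ ((l - β - 1) / (α * β)) ≠ ∞ := by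
    rw [ENNReal.ofReal_rpow_of_pos hα]
    exact ⟨by simpa using Real.rpow_pos_of_pos hα _, ENNReal.ofReal_ne_top⟩
  constructor
  · exact mul_le_mul' le_rfl (ENNReal.rpow_le_rpow hch.1 (by positivity))
  · intro hN heq
    rw [ENNReal.mul_right_inj hpw.1 hpw.2] at heq
    obtain ⟨m, hm, hae⟩ := hj.2 (hch.2 (rpow_one_div_injective hα heq))
    obtain ⟨r, hr, t₀, hw⟩ := stam_rigidity hs (fun t ht => relTransform_eq_zero ht)
      hg.zero_pos hg.theta_ne hg.isChangeOfVar (by simp [escortVar]) hm hae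
    -- Subtracting t₀ from y is again an admissible change of variable and removes the translation
    -- left by rigidity.
    refine ae_eq_invTransform hΩo hΩc hα hh hg.isIntervalDensity_escort hN hf
      (hy.sub_const t₀) hr ?_
    have hq : Measure.QuasiMeasurePreserving (fun t : ℝ => t + t₀) volume volume :=
      (measurePreserving_add_right volume t₀).quasiMeasurePreserving
    filter_upwards [hq.ae hw] with t ht
    rw [relTransform_translate hT.strictMonoOn, ht, add_sub_cancel_right]
    rfl

/-- The inverse transform attains equality. -/
theorem relative_stam_sharp (hΩo : IsOpen Ω) (hΩc : Ω.OrdConnected) (hh : IsDensityOn Ω h)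
    (hα : 0 < α) (hl : l ≠ 1) (hg : StamData g γ θ) (hβ0 : β ≠ 0) (hβ : β = γ * θ)
    (hlθ : l = 1 + β - θ) {c : ℝ} (hc0 : 0 < c)
    (hc : ∫⁻ x in {x | 0 < g x}, ENNReal.ofReal (g x ^ γ) = ENNReal.ofReal c)
    (hN : renyiPower ((α - 1) / α) (escort g θ) ≠ ∞) {Ψ : ℝ≥0∞}
    {p : ℝ} {Φr : ℝ≥0∞}
    (hΦr : relFisher Ω p (β * α) (invTransform Ω h α (escort g θ)) h = Φr ^ (1 / (β * α)))
    (hΦΨ : ENNReal.ofReal α * Φr = ENNReal.ofReal (invScale α (escort g θ) ^ β) * Ψ) :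
    renyiIntegral Ω (xi l α) (invTransform Ω h α (escort g θ)) h ≠ ∞ ∧
    (EReal.exp (-renyiDiv Ω (xi l α) (invTransform Ω h α (escort g θ)) h)
        * relFisher Ω p (β * α) (invTransform Ω h α (escort g θ)) h) ^ θ
      = ENNReal.ofReal α ^ ((l - β - 1) / (α * β))
        * (ENNReal.ofReal c ^ (1 / (1 - γ)) * Ψ ^ (1 / γ)) ^ (1 / α) := by
  have hG := hg.isIntervalDensity_escort
  have hhw := hh.isWeight hΩo hΩc
  have h1 := hh.setLIntegral hΩc
  have hf := isDensityOn_invTransform hΩo hΩc hα hh hG hN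
  have hfw := hf.isWeight hΩo hΩc
  have hf1 := hf.setLIntegral hΩc
  have hy := isChangeOfVar_invVar hα hhw h1 hG hN
  have hr := invScale_pos hα hG hN
  have hA0 := lintegral_relTransform_rpow_ne_zero hy hfw hhw hf1 l
  have hγβ : γ = β / θ := by rw [hβ, mul_div_cancel_right₀ _ hg.theta_ne]
  have hA : ∫⁻ t in {t | 0 < relTransform Ω (invTransform Ω h α (escort g θ)) h α
        (invVar Ω h α (escort g θ)) t}, ENNReal.ofReal (relTransform Ω
        (invTransform Ω h α (escort g θ)) h α (invVar Ω h α (escort g θ)) t ^ l)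
      = ENNReal.ofReal (invScale α (escort g θ) ^ (l - 1) * c) := by
    rw [relTransform_invTransform hα hhw h1 hG hN,
      lintegral_scaling_rpow hr hG.isWeight.isOpen.measurableSet,
      hg.lintegral_escort_rpow hβ hlθ, hc, ENNReal.ofReal_mul (by positivity)]
  have hK : renyiIntegral Ω (xi l α) (invTransform Ω h α (escort g θ)) h ≠ ∞ := by
    rw [renyiIntegral_eq hy hfw hhw, hA]; exact ENNReal.ofReal_ne_top
  refine ⟨hK, ?_⟩
  rw [renyiIntegral_eq hy hfw hhw] at hK
  rw [exp_neg_renyiDiv hα hl hy hfw hhw, hΦr, relFisher_mul_renyi_rpow hA0 hK hα hl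
    (by linarith) hg.theta_ne hβ0 hγβ, hA, hΦΨ]
  congr 2
  set r := invScale α (escort g θ)
  have hrβ : ENNReal.ofReal (r ^ β) ≠ 0 := by simpa using Real.rpow_pos_of_pos hr β
  have hcp : ENNReal.ofReal c ≠ 0 := by simpa using hc0
  have hrl : ENNReal.ofReal (r ^ (l - 1)) ≠ 0 := by simpa using Real.rpow_pos_of_pos hr (l - 1)
  rw [ENNReal.ofReal_mul (by positivity), ennreal_mul_rpow hrl ENNReal.ofReal_ne_top,
    ennreal_mul_rpow hrβ ENNReal.ofReal_ne_top, mul_mul_mul_comm]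
  -- Scale invariance: the powers of r from ∫ w^l and from the Fisher term cancel.
  have hone : ENNReal.ofReal (r ^ (l - 1)) ^ (1 / (1 - γ)) * ENNReal.ofReal (r ^ β) ^ (1 / γ)
      = 1 := by
    rw [ENNReal.ofReal_rpow_of_pos (by positivity), ENNReal.ofReal_rpow_of_pos (by positivity),
      ← ENNReal.ofReal_mul (by positivity), ← Real.rpow_mul hr.le, ← Real.rpow_mul hr.le,
      ← Real.rpow_add hr]
    have hγ1 : 1 - γ ≠ 0 := sub_ne_zero.2 hg.gamma_ne.symm
    have hγ0 := hg.gamma_pos.ne'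
    have : (l - 1) * (1 / (1 - γ)) + β * (1 / γ) = 0 := by
      rw [hlθ, hβ]; field_simp; ring
    rw [this]; simp
  rw [hone, one_mul]

/-- A bootstrap. The transport is continuous, so f is continuous; hence y has a continuous density
f^(1-α) h^α and is differentiable; hence f = G(y)^(1/α) h is differentiable. -/
lemma differentiableOn_invTransform (hα : 0 < α) (hh : IsWeight Ω h)
    (h1 : ∫⁻ x in Ω, ENNReal.ofReal (h x) = 1) (hhd : DifferentiableOn ℝ h Ω)
    (hg : IsIntervalDensity g) (hgd : DifferentiableOn ℝ g {x | 0 < g x})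
    (hfin : renyiPower ((α - 1) / α) g ≠ ∞) :
    DifferentiableOn ℝ (invTransform Ω h α g) Ω := by
  have hr := invScale_pos hα hg hfin
  have hT := isTransport_invVar hα hh h1 hg hfin
  have hT1 := isTransport_invVar_escort hα hh h1 hg hfin
  have hGd : DifferentiableOn ℝ (scaling (invScale α g) g)
      {t | 0 < scaling (invScale α g) g t} := by
    intro t ht
    have ht' : 0 < g (invScale α g * t) := (scaling_pos_iff hr t).1 ht
    have h2 : DifferentiableAt ℝ g (invScale α g * t) :=
      (hgd _ ht').differentiableAt (hg.isWeight.isOpen.mem_nhds ht')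
    have h3 : DifferentiableAt ℝ (fun t => g (invScale α g * t)) t :=
      h2.comp t ((differentiableAt_id).const_mul _)
    exact (h3.const_mul _).differentiableWithinAt
  have hGy : ContinuousOn (fun x => scaling (invScale α g) g (invVar Ω h α g x)) Ω :=
    hGd.continuousOn.comp hT.continuousOn fun x hx => hT.mem hx
  have hfc : ContinuousOn (invTransform Ω h α g) Ω := by
    refine ContinuousOn.congr (f := fun x => scaling (invScale α g) g (invVar Ω h α g x) ^ (1 / α)
      * h x) ?_ fun x hx => invTransform_apply hx
    exact (hGy.rpow_const fun x hx => Or.inl (show 0 < scaling (invScale α g) g _ from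
      hT.mem hx).ne').mul hhd.continuousOn
  have hk : ContinuousOn (fun x => invTransform Ω h α g x ^ (1 - α) * h x ^ α) Ω :=
    (hfc.rpow_const fun x hx => Or.inl (invTransform_pos hα hh h1 hg hfin hx).ne').mul
      (hhd.continuousOn.rpow_const fun x hx => Or.inl (hh.pos x hx).ne')
  intro x hx
  have hn := hh.isOpen.mem_nhds hx
  have hyd := (hT1.hasDerivAt hk hx).differentiableAt
  have hGx : 0 < scaling (invScale α g) g (invVar Ω h α g x) := hT.mem hx
  have hGdx : DifferentiableAt ℝ (scaling (invScale α g) g) (invVar Ω h α g x) :=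
    (hGd _ hGx).differentiableAt (hT.target.isOpen.mem_nhds hGx)
  have h4 : DifferentiableAt ℝ (fun x => scaling (invScale α g) g (invVar Ω h α g x) ^ (1 / α)
      * h x) x :=
    ((hGdx.comp x hyd).rpow_const (Or.inl hGx.ne')).mul ((hhd x hx).differentiableAt hn)
  refine (h4.congr_of_eventuallyEq ?_).differentiableWithinAt
  filter_upwards [hn] with z hz using invTransform_apply hz

end Relative

/-! ### Stretched Gaussians with finite conjugate exponent: shape, score and moments -/

namespace IsProfileParam

variable {q γ : ℝ}

lemma gaussian_eq (hp : IsProfileParam q γ) (h0 : q ≠ 0) (x : ℝ) :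
    stretchedGaussian (ENNReal.ofReal q) γ x
      = max (1 - (γ - 1) * |x| ^ q) 0 ^ (1 / (γ - 1))
        / ∫ s, stretchedProfile (ENNReal.ofReal q) γ s := by
  rw [stretchedGaussian, stretchedProfile_ofReal hp.nonneg hp.ne_one fun h => absurd h h0,
    profileBase, if_neg h0]

lemma gaussian_pos_iff (hp : IsProfileParam q γ) (h0 : q ≠ 0) {x : ℝ} :
    0 < stretchedGaussian (ENNReal.ofReal q) γ x ↔ 0 < 1 - (γ - 1) * |x| ^ q := by
  rw [stretchedGaussian, div_pos_iff_of_pos_right hp.integral_profile_pos,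
    hp.profile_pos_iff fun h => absurd h h0, profileBase, if_neg h0]

lemma gaussian_lt (hp : IsProfileParam q γ) (h0 : q ≠ 0) {x y : ℝ} (hxy : |x| < |y|)
    (hx : 0 < stretchedGaussian (ENNReal.ofReal q) γ x) :
    stretchedGaussian (ENNReal.ofReal q) γ y < stretchedGaussian (ENNReal.ofReal q) γ x := by
  by_cases hy : 0 < stretchedGaussian (ENNReal.ofReal q) γ y
  · rw [hp.gaussian_eq h0, hp.gaussian_eq h0]
    rw [hp.gaussian_pos_iff h0] at hx hy
    rw [max_eq_left hx.le, max_eq_left hy.le]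
    refine div_lt_div_of_pos_right ?_ hp.integral_profile_pos
    have h1 : |x| ^ q < |y| ^ q :=
      Real.rpow_lt_rpow (abs_nonneg x) hxy (lt_of_le_of_ne hp.nonneg h0.symm)
    rcases lt_or_gt_of_ne hp.ne_one with hl | hl
    · refine Real.rpow_lt_rpow_of_neg hx ?_ (one_div_neg.2 (by linarith))
      nlinarith
    · refine Real.rpow_lt_rpow hy.le ?_ (one_div_pos.2 (by linarith))
      nlinarith
  · exact (not_lt.1 hy).trans_lt hx

lemma gaussian_le (hp : IsProfileParam q γ) (h0 : q ≠ 0) {x y : ℝ} (hxy : |x| ≤ |y|) :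
    stretchedGaussian (ENNReal.ofReal q) γ y ≤ stretchedGaussian (ENNReal.ofReal q) γ x := by
  by_cases hx : 0 < stretchedGaussian (ENNReal.ofReal q) γ x
  · rcases hxy.lt_or_eq with h | h
    · exact (hp.gaussian_lt h0 h hx).le
    · rw [hp.gaussian_eq h0, hp.gaussian_eq h0, h]
  · have h1 := hx
    rw [hp.gaussian_pos_iff h0, not_lt] at h1
    have hxy' : |x| ^ q ≤ |y| ^ q := Real.rpow_le_rpow (abs_nonneg x) hxy hp.nonneg
    have h2 : ¬ 0 < stretchedGaussian (ENNReal.ofReal q) γ y := by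
      rw [hp.gaussian_pos_iff h0, not_lt]
      have : 0 < γ - 1 := by
        by_contra h
        have : 0 ≤ |x| ^ q := by positivity
        nlinarith
      nlinarith
    exact (not_lt.1 h2).trans (hp.gaussian_nonneg x)

lemma continuous_gaussian (hp : IsProfileParam q γ) (h0 : q ≠ 0) :
    Continuous (stretchedGaussian (ENNReal.ofReal q) γ) := by
  rw [show stretchedGaussian (ENNReal.ofReal q) γ = _ from funext (hp.gaussian_eq h0)]
  have hq : 0 < q := lt_of_le_of_ne hp.nonneg h0.symm
  refine Continuous.div_const ?_ _
  have hc : Continuous fun x : ℝ => max (1 - (γ - 1) * |x| ^ q) 0 :=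
    (continuous_const.sub (continuous_const.mul
      (continuous_abs.rpow_const fun _ => Or.inr hq.le))).max continuous_const
  refine hc.rpow_const fun x => ?_
  rcases lt_or_gt_of_ne hp.ne_one with hl | hl
  · left
    have h1 := hp.profileBase_pos hl x
    rw [profileBase, if_neg h0] at h1
    exact (lt_max_of_lt_left h1).ne'
  · exact Or.inr (one_div_pos.2 (by linarith)).le

/-- The level sets of the Gaussian are compact. -/
lemma isCompact_level (hp : IsProfileParam q γ) (h0 : q ≠ 0) {ε : ℝ} (hε : 0 < ε) :
    IsCompact {x | ε ≤ stretchedGaussian (ENNReal.ofReal q) γ x} := by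
  refine Metric.isCompact_of_isClosed_isBounded
    (isClosed_le continuous_const (hp.continuous_gaussian h0)) ?_
  refine (Metric.isBounded_closedBall (x := (0 : ℝ)) (r := 1 / ε)).subset fun x hx => ?_
  -- If g(x) ≥ ε then g ≥ ε on an interval of length 2|x|, and the total mass is 1. The bound does
  -- not depend on whether the support is bounded.
  have h1 : ENNReal.ofReal ε * volume (Ioo (-|x|) |x|) ≤ 1 := by
    rw [← hp.isIntervalDensity.lintegral_eq_one, ← setLIntegral_const]
    refine (setLIntegral_mono' measurableSet_Ioo fun s hs => ?_).trans (setLIntegral_le_lintegral _ _)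
    refine ENNReal.ofReal_le_ofReal ((show ε ≤ _ from hx).trans (hp.gaussian_le h0 ?_))
    exact (abs_lt.2 hs).le
  rw [Real.volume_Ioo, ← ENNReal.ofReal_mul hε.le, ← ENNReal.ofReal_one,
    ENNReal.ofReal_le_ofReal_iff zero_le_one] at h1
  rw [mem_closedBall_zero_iff, Real.norm_eq_abs, le_div_iff₀ hε]
  nlinarith [abs_nonneg x]

lemma hasDerivAt_gaussian (hp : IsProfileParam q γ) (hq : 1 < q) {x : ℝ}
    (hx : 0 < stretchedGaussian (ENNReal.ofReal q) γ x) :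
    HasDerivAt (stretchedGaussian (ENNReal.ofReal q) γ)
      (-(q * |x| ^ (q - 2) * x) / (1 - (γ - 1) * |x| ^ q)
        * stretchedGaussian (ENNReal.ofReal q) γ x) x := by
  have h0 : q ≠ 0 := by positivity
  have hx' := (hp.gaussian_pos_iff h0).1 hx
  have hs := hp.sub_ne
  have h1 : HasDerivAt (fun x : ℝ => 1 - (γ - 1) * |x| ^ q)
      (-((γ - 1) * (q * |x| ^ (q - 2) * x))) x := by
    simpa using ((hasDerivAt_abs_rpow x hq).const_mul (γ - 1)).const_sub 1
  have h2 := (h1.rpow_const (p := 1 / (γ - 1)) (Or.inl hx'.ne')).div_const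
    (∫ s, stretchedProfile (ENNReal.ofReal q) γ s)
  have hpos : ∀ᶠ z in nhds x, 0 < 1 - (γ - 1) * |z| ^ q :=
    h1.continuousAt.eventually (isOpen_Ioi.mem_nhds hx')
  refine (h2.congr_of_eventuallyEq ?_).congr_deriv ?_
  · filter_upwards [hpos] with z hz
    rw [hp.gaussian_eq h0, max_eq_left hz.le]
  · rw [hp.gaussian_eq h0, max_eq_left hx'.le, Real.rpow_sub_one hx'.ne']
    field_simp

lemma differentiableOn_gaussian (hp : IsProfileParam q γ) (hq : 1 < q) :
    DifferentiableOn ℝ (stretchedGaussian (ENNReal.ofReal q) γ)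
      {x | 0 < stretchedGaussian (ENNReal.ofReal q) γ x} :=
  fun _ hx => (hp.hasDerivAt_gaussian hq hx).differentiableAt.differentiableWithinAt

lemma lintegral_gaussian_rpow (hp : IsProfileParam q γ) :
    ∫⁻ x in {x | 0 < stretchedGaussian (ENNReal.ofReal q) γ x},
      ENNReal.ofReal (stretchedGaussian (ENNReal.ofReal q) γ x ^ γ)
      = ENNReal.ofReal (∫ x, stretchedGaussian (ENNReal.ofReal q) γ x ^ γ) := by
  rw [ofReal_integral_eq_lintegral_ofReal hp.integrable_gaussian_rpow
    (Filter.Eventually.of_forall fun x => Real.rpow_nonneg (hp.gaussian_nonneg x) _),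
    setLIntegral_eq_of_support_subset]
  intro x hx
  by_contra h
  have h1 : stretchedGaussian (ENNReal.ofReal q) γ x = 0 :=
    le_antisymm (not_lt.1 h) (hp.gaussian_nonneg x)
  simp [h1, Real.zero_rpow hp.pos.ne'] at hx

lemma stamData (hp : IsProfileParam q γ) (hq : 1 < q) {θ : ℝ} (hθ : θ ≠ 0) :
    StamData (stretchedGaussian (ENNReal.ofReal q) γ) γ θ where
  density := hp.isIntervalDensity
  zero_pos := by
    have := hp.isOpen_ordConnected.2.2
    rwa [← hp.setOf_gaussian_pos] at this
  differentiableOn := hp.differentiableOn_gaussian hq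
  gamma_pos := hp.pos
  gamma_ne := hp.ne_one
  theta_ne := hθ

/-- The score of the Gaussian. -/
lemma gaussian_score (hp : IsProfileParam q γ) (hq : 1 < q) {x : ℝ}
    (hx : 0 < stretchedGaussian (ENNReal.ofReal q) γ x) :
    stretchedGaussian (ENNReal.ofReal q) γ x ^ (γ - 1)
      * |deriv (stretchedGaussian (ENNReal.ofReal q) γ) x
        / stretchedGaussian (ENNReal.ofReal q) γ x|
      = (∫ s, stretchedProfile (ENNReal.ofReal q) γ s) ^ (1 - γ) * q * |x| ^ (q - 1) := by
  have h0 : q ≠ 0 := by positivity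
  have hx' := (hp.gaussian_pos_iff h0).1 hx
  have hZ := hp.integral_profile_pos
  have hpow : stretchedGaussian (ENNReal.ofReal q) γ x ^ (γ - 1)
      = (1 - (γ - 1) * |x| ^ q) * (∫ s, stretchedProfile (ENNReal.ofReal q) γ s) ^ (1 - γ) := by
    rw [hp.gaussian_eq h0, max_eq_left hx'.le, Real.div_rpow (by positivity) hZ.le,
      ← Real.rpow_mul hx'.le, one_div_mul_cancel hp.sub_ne, Real.rpow_one, div_eq_mul_inv,
      ← Real.rpow_neg hZ.le, neg_sub]
  have habs : |x| ^ (q - 2) * |x| = |x| ^ (q - 1) := by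
    rcases eq_or_ne x 0 with rfl | hx0
    · rw [abs_zero, mul_zero, Real.zero_rpow (by linarith)]
    · rw [← Real.rpow_add_one (abs_ne_zero.2 hx0)]; ring_nf
  rw [(hp.hasDerivAt_gaussian hq hx).deriv, mul_div_cancel_right₀ _ hx.ne', hpow, abs_div,
    abs_neg, abs_mul, abs_mul, abs_of_pos hx', abs_of_pos (by positivity : (0 : ℝ) < q),
    abs_of_nonneg (by positivity : 0 ≤ |x| ^ (q - 2)), mul_assoc q, habs]
  field_simp

lemma setLIntegral_moment (hp : IsProfileParam q γ) (h0 : q ≠ 0) :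
    ∫⁻ x in {x | 0 < stretchedGaussian (ENNReal.ofReal q) γ x},
      ENNReal.ofReal (|x| ^ q * stretchedGaussian (ENNReal.ofReal q) γ x)
      = ENNReal.ofReal (∫ x, |x| ^ q * stretchedGaussian (ENNReal.ofReal q) γ x) := by
  have hi := hp.integrable_moment_gaussian
  simp only [momentKernel, if_neg h0] at hi
  rw [ofReal_integral_eq_lintegral_ofReal hi
    (Filter.Eventually.of_forall fun x => mul_nonneg (by positivity) (hp.gaussian_nonneg x)),
    setLIntegral_eq_of_support_subset]
  intro x hx
  by_contra h
  have h1 : stretchedGaussian (ENNReal.ofReal q) γ x = 0 :=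
    le_antisymm (not_lt.1 h) (hp.gaussian_nonneg x)
  simp [h1] at hx

lemma integral_moment_pos (hp : IsProfileParam q γ) (h0 : q ≠ 0) :
    0 < ∫ x, |x| ^ q * stretchedGaussian (ENNReal.ofReal q) γ x := by
  have h := hp.isIntervalDensity.isDensity.moment_pos h0 hp.integrable_moment_gaussian
  simpa only [momentKernel, if_neg h0] using h

/-- The integration by parts `∫ x (g^γ)' = -∫ g^γ`, as an inequality. -/
lemma moment_le (hp : IsProfileParam q γ) (hq : 1 < q) :
    γ * ((∫ s, stretchedProfile (ENNReal.ofReal q) γ s) ^ (1 - γ) * q)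
        * ∫ x, |x| ^ q * stretchedGaussian (ENNReal.ofReal q) γ x
      ≤ ∫ x, stretchedGaussian (ENNReal.ofReal q) γ x ^ γ := by
  have h0 : q ≠ 0 := by positivity
  have hγ := hp.pos
  have hZ := hp.integral_profile_pos
  set k := (∫ s, stretchedProfile (ENNReal.ofReal q) γ s) ^ (1 - γ) * q with hk
  have hk0 : 0 < k := by positivity
  set g := stretchedGaussian (ENNReal.ofReal q) γ with hg
  set J := {x | 0 < g x} with hJ
  have hJw := (hp.stamData hq one_ne_zero).isWeight_one
  have hd : ∀ x ∈ J, HasDerivAt (fun x => g x ^ γ) (deriv g x * γ * g x ^ (γ - 1)) x := fun x hx =>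
    (hp.hasDerivAt_gaussian hq hx).differentiableAt.hasDerivAt.rpow_const
      (Or.inl (show 0 < g x from hx).ne')
  have hderiv : ∀ x ∈ J, |deriv (fun x => g x ^ γ) x| = γ * (k * (|x| ^ (q - 1) * g x)) := by
    intro x hx
    have hgx : 0 < g x := hx
    have h1 := hp.gaussian_score hq hx
    rw [← hg, abs_div, abs_of_pos hgx] at h1
    rw [(hd x hx).deriv, abs_mul, abs_mul, abs_of_pos hγ, abs_of_pos (Real.rpow_pos_of_pos hgx _)]
    have h2 : g x ^ (γ - 1) * |deriv g x| = k * |x| ^ (q - 1) * g x := by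
      rw [hk, ← h1]; field_simp
    linear_combination γ * h2
  have hT : IsTransport J (fun _ => 1) (id '' J) (fun _ => 1) id := by
    refine IsTransport.of_primitive hJw fun a _ b _ => ⟨intervalIntegrable_const, by simp⟩
  -- The Tonelli identity for the identity map, with center 0, expresses ∫ |x| |(g^γ)'| through the
  -- tails of |(g^γ)'|.
  have htail := lintegral_tail hT (hp.stamData hq one_ne_zero).zero_pos rfl
    (D := fun x => ENNReal.ofReal |deriv (fun x => g x ^ γ) x|) (by fun_prop)
  have hbound : ∀ t ∈ J, ∫⁻ τ in tailSet J 0 t, ENNReal.ofReal |deriv (fun x => g x ^ γ) τ|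
      ≤ ENNReal.ofReal (g t ^ γ) := by
    intro t ht
    have habs : ∀ τ ∈ tailSet J 0 t, |t| < |τ| ∧ 0 < τ * (if 0 ≤ t then 1 else -1) := by
      rintro τ ⟨-, ⟨h1, h2⟩ | ⟨h1, h2⟩⟩
      · rw [abs_of_nonneg h1, abs_of_pos (h1.trans_lt h2), if_pos h1]
        exact ⟨h2, by linarith⟩
      · rw [abs_of_neg h1, abs_of_neg (h2.trans h1), if_neg (not_le.2 h1)]
        exact ⟨by linarith, by linarith⟩
    have hm : MeasurableSet (tailSet J 0 t) := by
      refine hJw.isOpen.measurableSet.inter (MeasurableSet.union ?_ ?_)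
      · exact (MeasurableSet.const _).inter measurableSet_Ioi
      · exact (MeasurableSet.const _).inter measurableSet_Iio
    have hlt : ∀ a b, 0 < g a → |a| < |b| → g b ^ γ < g a ^ γ := fun a b ha hab =>
      Real.rpow_lt_rpow (hp.gaussian_nonneg b) (hp.gaussian_lt h0 hab ha) hγ
    -- On one side of the origin g^γ is strictly monotone, so the integral of |(g^γ)'| over a tail
    -- is the length of its image, which lies in (0, g(t)^γ).
    have hinj : InjOn (fun x => g x ^ γ) (tailSet J 0 t) := by
      intro a ha b hb hab
      have h1 := habs a ha
      have h2 := habs b hb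
      have h3 : |a| = |b| := by
        rcases lt_trichotomy |a| |b| with h | h | h
        · exact absurd hab (hlt a b ha.1 h).ne'
        · exact h
        · exact absurd hab (hlt b a hb.1 h).ne
      rcases abs_eq_abs.1 h3 with h | h
      · exact h
      · rw [h] at h1
        linarith [h1.2, h2.2]
    have himg := lintegral_image_eq_lintegral_abs_deriv_mul hm
      (fun x hx => ((hd x hx.1).differentiableAt.hasDerivAt.hasDerivWithinAt
        (s := tailSet J 0 t))) hinj (fun _ => 1)
    simp only [mul_one, lintegral_const, Measure.restrict_apply_univ, one_mul] at himg
    rw [← himg]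
    calc volume ((fun x => g x ^ γ) '' tailSet J 0 t) ≤ volume (Ioo 0 (g t ^ γ)) := by
          refine measure_mono ?_
          rintro _ ⟨τ, hτ, rfl⟩
          exact ⟨Real.rpow_pos_of_pos hτ.1 _, hlt t τ ht (habs τ hτ).1⟩
      _ = ENNReal.ofReal (g t ^ γ) := by rw [Real.volume_Ioo, sub_zero]
  have hle : ∫⁻ τ in J, ENNReal.ofReal |deriv (fun x => g x ^ γ) τ| * ENNReal.ofReal |id τ|
      ≤ ∫⁻ x in J, ENNReal.ofReal (g x ^ γ) := by
    rw [← htail]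
    refine setLIntegral_mono' hJw.isOpen.measurableSet fun t ht => ?_
    simpa using hbound t ht
  have heq : ∫⁻ τ in J, ENNReal.ofReal |deriv (fun x => g x ^ γ) τ| * ENNReal.ofReal |id τ|
      = ENNReal.ofReal (γ * k) * ∫⁻ x in J, ENNReal.ofReal (|x| ^ q * g x) := by
    rw [← lintegral_const_mul' _ _ ENNReal.ofReal_ne_top]
    refine setLIntegral_congr_fun hJw.isOpen.measurableSet fun x hx => ?_
    simp only [id]
    rw [hderiv x hx, ← ENNReal.ofReal_mul (by have := hp.gaussian_nonneg x; positivity),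
      ← ENNReal.ofReal_mul (by positivity)]
    congr 1
    have habs : |x| ^ (q - 1) * |x| = |x| ^ q := by
      rcases eq_or_ne x 0 with rfl | hx0
      · rw [abs_zero, mul_zero, Real.zero_rpow h0]
      · rw [← Real.rpow_add_one (abs_ne_zero.2 hx0)]; ring_nf
    rw [← habs]; ring
  have hc : 0 ≤ ∫ x, g x ^ γ :=
    integral_nonneg fun x => Real.rpow_nonneg (hp.gaussian_nonneg x) _
  rw [heq, hp.setLIntegral_moment h0, hp.lintegral_gaussian_rpow,
    ← ENNReal.ofReal_mul (by positivity), ENNReal.ofReal_le_ofReal_iff hc] at hle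
  exact hle

end IsProfileParam

/-! ### Fisher integrals of transforms, scalings and the minimizer -/

/-- The integral in the Fisher information (a total variation if `p = 1`). -/
noncomputable def fisherIntegral (p l : ℝ) (w : ℝ → ℝ) : ℝ≥0∞ :=
  if p = 1 then eVariationOn (fun t => w t ^ l / l) univ
  else ∫⁻ t in {t | 0 < w t}, ENNReal.ofReal (|w t ^ (l - 2) * deriv w t| ^ p * w t)

lemma fisherInfo_eq (p l : ℝ) (w : ℝ → ℝ) :
    fisherInfo p l w = (fisherIntegral p l w ^ (1 / p)) ^ (1 / l) := by
  rw [fisherInfo, fisherIntegral, ← ENNReal.rpow_mul, one_div_mul_one_div]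
  split_ifs with hp
  · rw [hp, one_mul]
  · rfl

lemma relFisher_eq (Ω : Set ℝ) (p l : ℝ) (f h : ℝ → ℝ) :
    relFisher Ω p l f h = (relFisherIntegral Ω p l f h ^ (1 / p)) ^ (1 / l) := by
  rw [relFisher, ← ENNReal.rpow_mul, one_div_mul_one_div]

/-- The relative Fisher integral in terms of the transformed density. -/
lemma fisherIntegral_relTransform {Ω : Set ℝ} {f h y : ℝ → ℝ} {α p β : ℝ} (hp : 1 < p)
    (hα : 0 < α) (hy : IsChangeOfVar Ω f h α y) (hf : IsWeight Ω f) (hh : IsWeight Ω h)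
    (hfd : DifferentiableOn ℝ f Ω) (hhd : DifferentiableOn ℝ h Ω) :
    ENNReal.ofReal α * relFisherIntegral Ω p (β * α) f h ^ (1 / p)
      = fisherIntegral p β (relTransform Ω f h α y) ^ (1 / p) := by
  rw [fisherIntegral, if_neg hp.ne', relFisherIntegral, if_neg hp.ne',
    lintegral_fisher_relTransform hy hf hh hfd hhd, abs_of_pos hα,
    ENNReal.mul_rpow_of_nonneg _ _ (by positivity), ← ENNReal.ofReal_rpow_of_pos hα,
    ← ENNReal.rpow_mul, mul_one_div_cancel (by positivity), ENNReal.rpow_one]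

lemma fisherIntegral_scaling {p β r : ℝ} (hp : 1 < p) (hr : 0 < r) {g : ℝ → ℝ}
    (hgm : MeasurableSet {t | 0 < g t}) :
    fisherIntegral p β (scaling r g) = ENNReal.ofReal (r ^ (β * p)) * fisherIntegral p β g := by
  have hm : MeasurableSet {t | 0 < scaling r g t} := by
    rw [setOf_scaling_pos hr]; exact (measurable_const_mul r) hgm
  rw [fisherIntegral, fisherIntegral, if_neg hp.ne', if_neg hp.ne',
    ← lintegral_indicator hm, ← lintegral_indicator hgm]
  set F : ℝ → ℝ≥0∞ := {t | 0 < g t}.indicator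
    (fun t => ENNReal.ofReal (|g t ^ (β - 2) * deriv g t| ^ p * g t)) with hF
  have h1 : ∀ t, {t | 0 < scaling r g t}.indicator (fun t => ENNReal.ofReal
      (|scaling r g t ^ (β - 2) * deriv (scaling r g) t| ^ p * scaling r g t)) t
      = ENNReal.ofReal (r ^ (β * p) * r) * F (r * t) := by
    intro t
    by_cases ht : 0 < g (r * t)
    · have ht' := (scaling_pos_iff hr t).2 ht
      have hd : deriv (scaling r g) t = r * (r * deriv g (r * t)) := by
        have h2 := deriv_comp_mul_left r g t
        have h3 : scaling r g = fun t => r * g (r * t) := rfl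
        rw [h3, deriv_const_mul_field, h2, smul_eq_mul]
      simp only [hF, indicator, mem_ofPred_eq, ht, ht', if_true]
      rw [← ENNReal.ofReal_mul (by positivity), hd, scaling, Real.mul_rpow hr.le ht.le]
      congr 1
      -- The derivative of the scaling brings r², so w^(β-2) w' scales by r^β, while w dt is
      -- invariant.
      have h4 : r ^ (β - 2) * (r * r) = r ^ β := by
        rw [← pow_two, ← Real.rpow_natCast r 2, ← Real.rpow_add hr]; norm_num
      rw [show r ^ (β - 2) * g (r * t) ^ (β - 2) * (r * (r * deriv g (r * t)))
        = r ^ β * (g (r * t) ^ (β - 2) * deriv g (r * t)) by rw [← h4]; ring,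
        abs_mul, abs_of_pos (Real.rpow_pos_of_pos hr β), Real.mul_rpow (by positivity)
        (abs_nonneg _), ← Real.rpow_mul hr.le]
      ring
    · have ht' : ¬ 0 < scaling r g t := fun h' => ht ((scaling_pos_iff hr t).1 h')
      simp only [hF, indicator, mem_ofPred_eq, ht, ht', if_false, mul_zero]
  simp_rw [h1]
  rw [lintegral_const_mul' _ _ ENNReal.ofReal_ne_top, lintegral_comp_mul_left' _ hr, ← mul_assoc,
    ← ENNReal.ofReal_mul (by positivity), mul_assoc, mul_inv_cancel₀ hr.ne', mul_one]

namespace IsProfileParam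

variable {p q γ β θ : ℝ}

/-- The Fisher integral of the Stam minimizer. -/
lemma fisherIntegral_escort (hP : IsProfileParam q γ) (hpq : p.HolderConjugate q) (hθ : θ ≠ 0)
    (hβ : β = γ * θ) :
    fisherIntegral p β (escort (stretchedGaussian (ENNReal.ofReal q) γ) θ) ^ (1 / p)
      = ENNReal.ofReal (|1 / θ| * ((∫ s, stretchedProfile (ENNReal.ofReal q) γ s) ^ (1 - γ) * q)
        * (∫ x, |x| ^ q * stretchedGaussian (ENNReal.ofReal q) γ x) ^ (1 / p)) := by
  have hq := hpq.symm.lt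
  have hp := hpq.lt
  have hg := hP.stamData hq hθ
  have hZ := hP.integral_profile_pos
  have hM := hP.integral_moment_pos hpq.symm.ne_zero
  set k := (∫ s, stretchedProfile (ENNReal.ofReal q) γ s) ^ (1 - γ) * q with hk
  have hk0 : 0 < k := by positivity
  rw [fisherIntegral, if_neg hp.ne', escort, lintegral_fisher_relTransform hg.isChangeOfVar
    hg.density.isWeight hg.isWeight_one hg.differentiableOn (differentiableOn_const 1)]
  -- With β/θ = γ the integrand is the p-th power of the score g^(γ-1)|g'/g| = k|x|^(q-1), times g;
  -- since (q-1)p = q it becomes a q-th moment.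
  have h1 : ∫⁻ x in {x | 0 < stretchedGaussian (ENNReal.ofReal q) γ x}, ENNReal.ofReal
      (stretchedGaussian (ENNReal.ofReal q) γ x ^ (1 + p * (β * (1 / θ) - 1))
        * (1 : ℝ) ^ (-(β * (1 / θ) * p))
        * |deriv (fun s => Real.log (stretchedGaussian (ENNReal.ofReal q) γ s / 1)) x| ^ p)
      = ENNReal.ofReal (k ^ p) * ∫⁻ x in {x | 0 < stretchedGaussian (ENNReal.ofReal q) γ x},
        ENNReal.ofReal (|x| ^ q * stretchedGaussian (ENNReal.ofReal q) γ x) := by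
    rw [← lintegral_const_mul' _ _ ENNReal.ofReal_ne_top]
    refine setLIntegral_congr_fun hg.density.isWeight.isOpen.measurableSet fun x hx => ?_
    have hgx : 0 < stretchedGaussian (ENNReal.ofReal q) γ x := hx
    have hs := hP.gaussian_score hq hgx
    simp only [div_one, Real.one_rpow, mul_one]
    rw [deriv.log (hP.hasDerivAt_gaussian hq hgx).differentiableAt hgx.ne',
      ← ENNReal.ofReal_mul (by positivity), show β * (1 / θ) = γ by rw [hβ]; field_simp,
      Real.rpow_add hgx, Real.rpow_one, mul_comm p, Real.rpow_mul hgx.le, mul_assoc,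
      ← Real.mul_rpow (by positivity) (abs_nonneg _), hs, ← hk, Real.mul_rpow hk0.le
      (by positivity), ← Real.rpow_mul (abs_nonneg x), show (q - 1) * p = q by
        exact hpq.symm.sub_one_mul_conj]
    congr 1; ring
  rw [h1, hP.setLIntegral_moment hpq.symm.ne_zero, ← ENNReal.ofReal_mul (by positivity),
    ← ENNReal.ofReal_mul (by positivity), ENNReal.ofReal_rpow_of_nonneg (by positivity)
    (by positivity), ← mul_assoc, ← Real.mul_rpow (by positivity) hk0.le,
    Real.mul_rpow (by positivity) hM.le, ← Real.rpow_mul (by positivity),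
    mul_one_div_cancel (by positivity), Real.rpow_one]

/-- The powers 1/p and 1/q of the moment recombine to the moment itself and |β|·|1/θ| = γ, so the
claim is `moment_le`. Only this direction is needed by `stam_chain`. -/
lemma fisherIntegral_escort_le (hP : IsProfileParam q γ) (hpq : p.HolderConjugate q)
    (hθ : θ ≠ 0) (hβ : β = γ * θ) :
    ENNReal.ofReal (|β| * (∫ x, |x| ^ q * stretchedGaussian (ENNReal.ofReal q) γ x) ^ (1 / q))
        * fisherIntegral p β (escort (stretchedGaussian (ENNReal.ofReal q) γ) θ) ^ (1 / p)
      ≤ ENNReal.ofReal (∫ x, stretchedGaussian (ENNReal.ofReal q) γ x ^ γ) := by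
  have hM := hP.integral_moment_pos hpq.symm.ne_zero
  rw [hP.fisherIntegral_escort hpq hθ hβ, ← ENNReal.ofReal_mul (by positivity)]
  refine ENNReal.ofReal_le_ofReal (le_trans (le_of_eq ?_) (hP.moment_le hpq.symm.lt))
  have h1 : (∫ x, |x| ^ q * stretchedGaussian (ENNReal.ofReal q) γ x) ^ (1 / q)
      * (∫ x, |x| ^ q * stretchedGaussian (ENNReal.ofReal q) γ x) ^ (1 / p)
      = ∫ x, |x| ^ q * stretchedGaussian (ENNReal.ofReal q) γ x := by
    rw [← Real.rpow_add hM, one_div, one_div, hpq.symm.inv_add_inv_eq_one, Real.rpow_one]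
  have h2 : |β| * |1 / θ| = γ := by
    rw [← abs_mul, hβ, mul_assoc, mul_one_div_cancel hθ, mul_one, abs_of_pos hP.pos]
  calc _ = (|β| * |1 / θ|) * ((∫ s, stretchedProfile (ENNReal.ofReal q) γ s) ^ (1 - γ) * q)
      * ((∫ x, |x| ^ q * stretchedGaussian (ENNReal.ofReal q) γ x) ^ (1 / q)
      * (∫ x, |x| ^ q * stretchedGaussian (ENNReal.ofReal q) γ x) ^ (1 / p)) := by ring
    _ = _ := by rw [h1, h2]

lemma fisherIntegral_escort_ne (hP : IsProfileParam q γ) (hpq : p.HolderConjugate q)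
    (hθ : θ ≠ 0) (hβ : β = γ * θ) :
    fisherIntegral p β (escort (stretchedGaussian (ENNReal.ofReal q) γ) θ) ^ (1 / p) ≠ 0 := by
  have hM := hP.integral_moment_pos hpq.symm.ne_zero
  have hZ := hP.integral_profile_pos
  have hq := hpq.symm.lt
  rw [hP.fisherIntegral_escort hpq hθ hβ]
  have : 0 < |1 / θ| := abs_pos.2 (one_div_ne_zero hθ)
  simp only [ne_eq, ENNReal.ofReal_eq_zero, not_le]
  positivity

end IsProfileParam

/-- The upper bound in the proof of the Stam inequality, for `p > 1`. -/
lemma stam_upper_of_one_lt {Ω : Set ℝ} {f h y : ℝ → ℝ} {α p q β γ θ : ℝ}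
    (hP : IsProfileParam q γ) (hpq : p.HolderConjugate q) (hθ : θ ≠ 0) (hβ : β = γ * θ)
    (hα : 0 < α) (hy : IsChangeOfVar Ω f h α y) (hf : IsWeight Ω f) (hh : IsWeight Ω h)
    (h1 : ∫⁻ x in Ω, ENNReal.ofReal (f x) = 1)
    (hfd : DifferentiableOn ℝ f Ω) (hhd : DifferentiableOn ℝ h Ω)
    (hreg : StamRegular p θ (y '' Ω) (relTransform Ω f h α y)) {s : ℝ → ℝ}
    (hs : IsTransport (y '' Ω) (relTransform Ω f h α y)
      {x | 0 < stretchedGaussian (ENNReal.ofReal q) γ x}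
      (stretchedGaussian (ENNReal.ofReal q) γ) s) :
    ∫⁻ t in y '' Ω, ENNReal.ofReal (relTransform Ω f h α y t ^ (1 + β)
        / stretchedGaussian (ENNReal.ofReal q) γ (s t))
      ≤ ENNReal.ofReal
          (|β| * (∫ x, |x| ^ q * stretchedGaussian (ENNReal.ofReal q) γ x) ^ (1 / q))
        * (ENNReal.ofReal α * relFisherIntegral Ω p (β * α) f h ^ (1 / p)) := by
  have hT := hy.isTransport hf hh
  have hM := hP.integral_moment_pos hpq.symm.ne_zero
  have hpos := setOf_relTransform_pos (α := α) hT.strictMonoOn hf hh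
  have hwd := isIntervalDensity_relTransform hy hf hh h1
  have hg := hP.stamData hpq.symm.lt hθ
  have hd : DifferentiableOn ℝ (relTransform Ω f h α y) (y '' Ω) := by
    rintro _ ⟨x, hx, rfl⟩
    exact (hasDerivAt_relTransform hy hf hh hfd hhd hx).differentiableAt.differentiableWithinAt
  have hβθ : 0 < β * θ := by
    rw [hβ, mul_assoc]
    exact mul_pos hP.pos (mul_self_pos.2 hθ)
  refine (stam_upper_of_regular hs (hpos ▸ hwd.setLIntegral) (fun t ht => relTransform_eq_zero ht)
    hg.zero_pos hd hpq hβθ hreg ?_).trans (le_of_eq ?_)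
  · rw [hP.setLIntegral_moment hpq.symm.ne_zero]
    simpa using hM
  · rw [fisherIntegral_relTransform hpq.lt hα hy hf hh hfd hhd, fisherIntegral,
      if_neg hpq.lt.ne', hpos, hP.setLIntegral_moment hpq.symm.ne_zero,
      ENNReal.ofReal_mul (abs_nonneg β), ENNReal.ofReal_rpow_of_nonneg hM.le
      (one_div_nonneg.2 hpq.symm.nonneg)]
    ring

/-- The Fisher integral of the inverse transform, for `p > 1`. -/
lemma relFisherIntegral_invTransform_of_one_lt {Ω : Set ℝ} {h g : ℝ → ℝ} {α p β : ℝ} (hp : 1 < p)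
    (hα : 0 < α) (hh : IsWeight Ω h) (h1 : ∫⁻ x in Ω, ENNReal.ofReal (h x) = 1)
    (hf : IsWeight Ω (invTransform Ω h α g)) (hg : IsIntervalDensity g)
    (hN : renyiPower ((α - 1) / α) g ≠ ∞)
    (hfd : DifferentiableOn ℝ (invTransform Ω h α g) Ω) (hhd : DifferentiableOn ℝ h Ω) :
    ENNReal.ofReal α * relFisherIntegral Ω p (β * α) (invTransform Ω h α g) h ^ (1 / p)
      = ENNReal.ofReal (invScale α g ^ β) * fisherIntegral p β g ^ (1 / p) := by
  have hr := invScale_pos hα hg hN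
  rw [fisherIntegral_relTransform hp hα (isChangeOfVar_invVar hα hh h1 hg hN) hf hh hfd hhd,
    relTransform_invTransform hα hh h1 hg hN, fisherIntegral_scaling hp hr
    hg.isWeight.isOpen.measurableSet, ENNReal.mul_rpow_of_nonneg _ _ (by positivity),
    ENNReal.ofReal_rpow_of_pos (by positivity), ← Real.rpow_mul hr.le, mul_assoc,
    mul_one_div_cancel (by positivity), mul_one]

/-! ### Absolute continuity and blow-up of the minimizer -/

lemma absolutelyContinuousOnInterval_congr {f g : ℝ → ℝ} {a b : ℝ}
    (hf : AbsolutelyContinuousOnInterval f a b) (h : ∀ x ∈ uIcc a b, f x = g x) :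
    AbsolutelyContinuousOnInterval g a b := by
  rw [absolutelyContinuousOnInterval_iff] at hf ⊢
  intro ε hε
  obtain ⟨δ, hδ, H⟩ := hf ε hε
  refine ⟨δ, hδ, fun E hE hsum => ?_⟩
  refine lt_of_eq_of_lt (Finset.sum_congr rfl fun i hi => ?_) (H E hE hsum)
  rw [h _ (hE.1 i hi).1, h _ (hE.1 i hi).2]

/-- The fundamental theorem tolerates a countable exceptional set for continuous functions, so f is
a constant plus the integral of an integrable function. -/
lemma absolutelyContinuousOnInterval_of_deriv {f : ℝ → ℝ} {a b : ℝ} {N : Set ℝ}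
    (hN : N.Countable) (hc : ContinuousOn f (uIcc a b))
    (hd : ∀ x ∈ uIcc a b \ N, DifferentiableAt ℝ f x)
    (hi : IntervalIntegrable (deriv f) volume a b) : AbsolutelyContinuousOnInterval f a b := by
  have h1 : ∀ x ∈ uIcc a b, (∫ t in a..x, deriv f t) = f x - f a := by
    intro x hx
    have hsub : uIcc a x ⊆ uIcc a b := uIcc_subset_uIcc_left hx
    refine MeasureTheory.integral_eq_of_hasDerivAt_off_countable f (deriv f) hN (hc.mono hsub)
      (fun z hz => (hd z ⟨hsub (Ioo_subset_Icc_self hz.1), hz.2⟩).hasDerivAt)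
      (hi.mono_set hsub)
  have h2 := hi.absolutelyContinuousOnInterval_intervalIntegral (c := a) left_mem_uIcc
  have h3 : AbsolutelyContinuousOnInterval (fun _ : ℝ => f a) a b :=
    LipschitzOnWith.absolutelyContinuousOnInterval (K := 0) (LipschitzWith.const (f a)).lipschitzOnWith
  refine absolutelyContinuousOnInterval_congr (h2.add h3) fun x hx => ?_
  simp only [Pi.add_apply]
  rw [h1 x hx]; ring

/-- A function that is differentiable off a countable set and unimodal is absolutely continuous. -/
lemma absolutelyContinuousOnInterval_of_unimodal {S : Set ℝ} (hS : S.OrdConnected) (h0 : 0 ∈ S)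
    {f : ℝ → ℝ} {N : Set ℝ} (hN : N.Countable) (hc : ContinuousOn f S)
    (hd : ∀ x ∈ S \ N, DifferentiableAt ℝ f x) (hm : ∀ u ∈ S, ∀ t ∈ uIcc 0 u, f u ≤ f t)
    {a b : ℝ} (ha : a ∈ S) (hb : b ∈ S) : AbsolutelyContinuousOnInterval f a b := by
  -- On each side of 0 the function is monotone, and derivatives of monotone functions are
  -- integrable.
  have hi : ∀ c ∈ S, IntervalIntegrable (deriv f) volume 0 c := by
    intro c hcS
    have hsub : uIcc 0 c ⊆ S := hS.uIcc_subset h0 hcS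
    rcases le_total 0 c with h | h
    · have hanti : MonotoneOn (-f) (uIcc 0 c) := by
        intro x hx y hy hxy
        rw [uIcc_of_le h] at hx
        exact neg_le_neg (hm y (hsub hy) x (by
          rw [uIcc_of_le (hx.1.trans hxy)]; exact ⟨hx.1, hxy⟩))
      refine hanti.intervalIntegrable_deriv.neg.congr fun x _ => ?_
      rw [Pi.neg_apply, deriv.neg, neg_neg]
    · refine MonotoneOn.intervalIntegrable_deriv fun x hx y hy hxy => ?_
      rw [uIcc_of_ge h] at hy
      exact hm x (hsub hx) y (by rw [uIcc_of_ge (hxy.trans hy.2)]; exact ⟨hxy, hy.2⟩)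
  have hsub : uIcc a b ⊆ S := hS.uIcc_subset ha hb
  exact absolutelyContinuousOnInterval_of_deriv hN (hc.mono hsub)
    (fun x hx => hd x ⟨hsub hx.1, hx.2⟩) ((hi a ha).symm.trans (hi b hb))

/-- Zeros propagate outwards, so w vanishes near every zero except possibly the first one on each
side of 0. If a side has no zeros, the default value of `sInf` or `sSup` merely enlarges the
exceptional set. -/
lemma differentiableAt_of_unimodal {w : ℝ → ℝ} (hw0 : ∀ x, 0 ≤ w x)
    (hm : ∀ u, ∀ t ∈ uIcc 0 u, w u ≤ w t) (h0 : 0 < w 0)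
    (hd : ∀ x, 0 < w x → DifferentiableAt ℝ w x) :
    ∃ N : Set ℝ, N.Countable ∧ ∀ x ∉ N, DifferentiableAt ℝ w x := by
  refine ⟨{sInf {x | 0 < x ∧ w x = 0}, sSup {x | x < 0 ∧ w x = 0}},
    ((finite_singleton _).insert _).countable, fun x hx => ?_⟩
  simp only [mem_insert_iff, mem_singleton_iff, not_or] at hx
  rcases (hw0 x).lt_or_eq with h | h
  · exact hd x h
  have key : ∀ y z, w y = 0 → y ∈ uIcc 0 z → w z = 0 := fun y z hy hyz =>
    le_antisymm ((hm z y hyz).trans_eq hy) (hw0 z)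
  have hx0 : x ≠ 0 := by rintro rfl; exact h0.ne h
  have hev : w =ᶠ[nhds x] fun _ => 0 := by
    rcases lt_or_gt_of_ne hx0 with hneg | hpos
    · have hmem : x ∈ {x | x < 0 ∧ w x = 0} := ⟨hneg, h.symm⟩
      have hle : x < sSup {x | x < 0 ∧ w x = 0} :=
        lt_of_le_of_ne (le_csSup ⟨0, fun z hz => hz.1.le⟩ hmem) hx.2
      obtain ⟨y, hy, hxy⟩ := exists_lt_of_lt_csSup ⟨x, hmem⟩ hle
      filter_upwards [isOpen_Iio.mem_nhds hxy] with z hz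
      exact key y z hy.2 (by rw [uIcc_of_ge (hz.le.trans hy.1.le)]; exact ⟨le_of_lt hz, hy.1.le⟩)
    · have hmem : x ∈ {x | 0 < x ∧ w x = 0} := ⟨hpos, h.symm⟩
      have hle : sInf {x | 0 < x ∧ w x = 0} < x :=
        lt_of_le_of_ne (csInf_le ⟨0, fun z hz => hz.1.le⟩ hmem) (Ne.symm hx.1)
      obtain ⟨y, hy, hxy⟩ := exists_lt_of_csInf_lt ⟨x, hmem⟩ hle
      filter_upwards [isOpen_Ioi.mem_nhds hxy] with z hz
      exact key y z hy.2 (by rw [uIcc_of_le (hy.1.le.trans hz.le)]; exact ⟨hy.1.le, le_of_lt hz⟩)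
  exact (differentiableAt_const (0 : ℝ)).congr_of_eventuallyEq hev

namespace StamData

variable {g : ℝ → ℝ} {γ θ : ℝ}

lemma escortVar_zero (g : ℝ → ℝ) (θ : ℝ) : escortVar g θ 0 = 0 := by simp [escortVar]

lemma zero_mem_escort (hg : StamData g γ θ) : 0 < escort g θ 0 := by
  have h := hg.escort_apply hg.zero_pos
  rw [escortVar_zero] at h
  rw [h]
  exact Real.rpow_pos_of_pos hg.zero_pos _

/-- Points of the support of the escort density, in the order of their distance to the origin. -/
lemma exists_escortVar_eq (hg : StamData g γ θ) {t u : ℝ} (hu : 0 < escort g θ u)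
    (ht : t ∈ uIcc 0 u) : ∃ a b, 0 < g a ∧ 0 < g b ∧ |a| ≤ |b| ∧ escortVar g θ a = t ∧
      escortVar g θ b = u := by
  have hpos := hg.setOf_escort_pos
  have hm := hg.isTransport.strictMonoOn
  have ht' : 0 < escort g θ t :=
    hg.isIntervalDensity_escort.isWeight.ordConnected.uIcc_subset hg.zero_mem_escort hu ht
  have hu1 : u ∈ escortVar g θ '' {x | 0 < g x} := by rw [← hpos]; exact hu
  have ht1 : t ∈ escortVar g θ '' {x | 0 < g x} := by rw [← hpos]; exact ht'
  obtain ⟨b, hb, rfl⟩ := hu1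
  obtain ⟨a, ha, rfl⟩ := ht1
  refine ⟨a, b, ha, hb, ?_, rfl, rfl⟩
  rw [← escortVar_zero g θ] at ht
  rcases le_total 0 b with h | h
  · rw [uIcc_of_le ((hm.le_iff_le hg.zero_pos hb).2 h), mem_Icc, hm.le_iff_le hg.zero_pos ha,
      hm.le_iff_le ha hb] at ht
    rw [abs_of_nonneg ht.1, abs_of_nonneg h]; exact ht.2
  · rw [uIcc_of_ge ((hm.le_iff_le hb hg.zero_pos).2 h), mem_Icc, hm.le_iff_le ha hg.zero_pos,
      hm.le_iff_le hb ha] at ht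
    rw [abs_of_nonpos ht.2, abs_of_nonpos h]; linarith [ht.1]

lemma isCompact_image_level (hg : StamData g γ θ) (hcomp : ∀ ε > 0, IsCompact {x | ε ≤ g x})
    {ε : ℝ} (hε : 0 < ε) : IsCompact (escortVar g θ '' {x | ε ≤ g x}) :=
  (hcomp ε hε).image_of_continuousOn
    (hg.isTransport.continuousOn.mono fun _ hx => lt_of_lt_of_le hε hx)

lemma differentiableAt_escort (hg : StamData g γ θ) {t : ℝ} (ht : 0 < escort g θ t) :
    DifferentiableAt ℝ (escort g θ) t :=
  (hg.differentiableOn_escort t ht).differentiableAt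
    (hg.isIntervalDensity_escort.isWeight.isOpen.mem_nhds ht)

/-- Continuity at a zero of the escort: for θ > 0 the set where it is at least ε lies in the image
of the compact level set {g ≥ ε^θ}, whose complement is an open neighbourhood of the zero. -/
lemma continuous_escort (hg : StamData g γ θ) (hθ : 0 < θ)
    (hcomp : ∀ ε > 0, IsCompact {x | ε ≤ g x}) : Continuous (escort g θ) := by
  refine continuous_iff_continuousAt.2 fun t => ?_
  have hnn := hg.isIntervalDensity_escort.nonneg
  rcases (hnn t).lt_or_eq with ht | ht
  · exact (hg.differentiableAt_escort ht).continuousAt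
  · rw [Metric.continuousAt_iff']
    intro ε hε
    have hεθ : 0 < ε ^ θ := Real.rpow_pos_of_pos hε θ
    have hlt : ∀ u, u ∉ escortVar g θ '' {x | ε ^ θ ≤ g x} → escort g θ u < ε := by
      intro u hu
      by_contra hge
      rw [not_lt] at hge
      have hu1 : u ∈ {t | 0 < escort g θ t} := lt_of_lt_of_le hε hge
      rw [hg.setOf_escort_pos] at hu1
      obtain ⟨x, hx, rfl⟩ := hu1
      refine hu ⟨x, ?_, rfl⟩
      have hgx : 0 < g x := hx
      rw [hg.escort_apply hgx] at hge
      have := Real.rpow_le_rpow hε.le hge hθ.le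
      rwa [← Real.rpow_mul hgx.le, one_div_mul_cancel hθ.ne', Real.rpow_one] at this
    have htK : t ∉ escortVar g θ '' {x | ε ^ θ ≤ g x} := by
      rintro ⟨x, hx, rfl⟩
      have hgx : 0 < g x := lt_of_lt_of_le hεθ hx
      rw [hg.escort_apply hgx] at ht
      exact (Real.rpow_pos_of_pos hgx _).ne ht
    filter_upwards [(hg.isCompact_image_level hcomp hεθ).isClosed.isOpen_compl.mem_nhds htK]
      with u hu
    rw [← ht, Real.dist_eq, sub_zero, abs_of_nonneg (hnn u)]
    exact hlt u hu

/-- Scalings of the escort density are regular in the sense of the Stam inequality. -/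
lemma stamRegular_scaling_escort (hg : StamData g γ θ)
    (huni : ∀ x y, |x| ≤ |y| → g y ≤ g x) (hcomp : ∀ ε > 0, IsCompact {x | ε ≤ g x})
    {r : ℝ} (hr : 0 < r) (p : ℝ) :
    StamRegular p θ {t | 0 < scaling r (escort g θ) t} (scaling r (escort g θ)) := by
  have hG := hg.isIntervalDensity_escort
  have hW := hG.scaling hr
  have hmem : ∀ {t u : ℝ}, t ∈ uIcc 0 u → r * t ∈ uIcc 0 (r * u) := by
    intro t u ht
    rcases le_total 0 u with h | h
    · rw [uIcc_of_le h] at ht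
      rw [uIcc_of_le (by positivity)]
      exact ⟨mul_nonneg hr.le ht.1, mul_le_mul_of_nonneg_left ht.2 hr.le⟩
    · rw [uIcc_of_ge h] at ht
      rw [uIcc_of_ge (mul_nonpos_of_nonneg_of_nonpos hr.le h)]
      exact ⟨mul_le_mul_of_nonneg_left ht.1 hr.le, mul_nonpos_of_nonneg_of_nonpos hr.le ht.2⟩
  have h0 : 0 < scaling r (escort g θ) 0 := by
    rw [scaling_pos_iff hr, mul_zero]; exact hg.zero_mem_escort
  have hd : ∀ x, 0 < scaling r (escort g θ) x → DifferentiableAt ℝ (scaling r (escort g θ)) x := by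
    intro x hx
    rw [scaling_pos_iff hr] at hx
    have h2 : DifferentiableAt ℝ (fun t => escort g θ (r * t)) x :=
      (hg.differentiableAt_escort hx).comp x ((differentiableAt_id).const_mul _)
    exact h2.const_mul _
  rcases lt_or_gt_of_ne hg.theta_ne with hθ | hθ
  -- A negative power reverses the order, so the negated escort is unimodal, and the escort is large
  -- outside the image of a compact level set of g.
  · refine Or.inr (Or.inr ⟨hθ, fun a ha b hb => ?_, fun M => ?_⟩)
    · have hm : ∀ u ∈ {t | 0 < scaling r (escort g θ) t}, ∀ t ∈ uIcc 0 u,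
          (-scaling r (escort g θ)) u ≤ (-scaling r (escort g θ)) t := by
        intro u hu t ht
        obtain ⟨x, y, hx, hy, hxy, h1, h2⟩ :=
          hg.exists_escortVar_eq ((scaling_pos_iff hr u).1 hu) (hmem ht)
        refine neg_le_neg (mul_le_mul_of_nonneg_left ?_ hr.le)
        rw [← h1, ← h2, hg.escort_apply hx, hg.escort_apply hy]
        exact Real.rpow_le_rpow_of_nonpos hy (huni x y hxy) (one_div_neg.2 hθ).le
      have h1 := absolutelyContinuousOnInterval_of_unimodal hW.isWeight.ordConnected h0
        countable_empty (fun x hx => (hd x hx).neg.continuousAt.continuousWithinAt)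
        (fun x hx => (hd x hx.1).neg) hm ha hb
      simpa using h1.neg
    · have hM : 0 < max (M / r) 1 := lt_max_of_lt_right one_pos
      have hK := hg.isCompact_image_level hcomp (Real.rpow_pos_of_pos hM θ)
      refine ⟨(r⁻¹ * ·) '' (escortVar g θ '' {x | max (M / r) 1 ^ θ ≤ g x}), ?_,
        hK.image (by fun_prop), ?_⟩
      · rintro _ ⟨_, ⟨x, hx, rfl⟩, rfl⟩
        have hgx : 0 < g x := lt_of_lt_of_le (Real.rpow_pos_of_pos hM θ) hx
        change 0 < scaling r (escort g θ) (r⁻¹ * escortVar g θ x)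
        rw [scaling_pos_iff hr, mul_inv_cancel_left₀ hr.ne', hg.escort_apply hgx]
        exact Real.rpow_pos_of_pos hgx _
      · rintro t ⟨ht, htC⟩
        have hu1 : r * t ∈ {t | 0 < escort g θ t} := (scaling_pos_iff hr t).1 ht
        rw [hg.setOf_escort_pos] at hu1
        obtain ⟨x, hx, hxt⟩ := hu1
        have hgx : 0 < g x := hx
        have hlt : g x < max (M / r) 1 ^ θ := by
          by_contra hge
          exact htC ⟨r * t, ⟨x, not_lt.1 hge, hxt⟩, inv_mul_cancel_left₀ hr.ne' t⟩
        have h3 : max (M / r) 1 < g x ^ (1 / θ) := by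
          have := Real.rpow_lt_rpow_of_neg hgx hlt (one_div_neg.2 hθ)
          rwa [← Real.rpow_mul hM.le, mul_one_div_cancel hθ.ne, Real.rpow_one] at this
        rw [scaling, ← hxt, hg.escort_apply hgx, ← div_lt_iff₀' hr]
        exact (le_max_left _ _).trans_lt h3
  -- For θ > 0 the escort is itself unimodal and continuous on the line, and only the two ends of
  -- its support can fail differentiability.
  · refine Or.inr (Or.inl fun a b => ?_)
    have hm : ∀ u, ∀ t ∈ uIcc 0 u, scaling r (escort g θ) u ≤ scaling r (escort g θ) t := by
      intro u t ht
      by_cases hu : 0 < scaling r (escort g θ) u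
      · obtain ⟨x, y, hx, hy, hxy, h1, h2⟩ :=
          hg.exists_escortVar_eq ((scaling_pos_iff hr u).1 hu) (hmem ht)
        refine mul_le_mul_of_nonneg_left ?_ hr.le
        rw [← h1, ← h2, hg.escort_apply hx, hg.escort_apply hy]
        exact Real.rpow_le_rpow hy.le (huni x y hxy) (one_div_pos.2 hθ).le
      · exact (not_lt.1 hu).trans (hW.nonneg t)
    obtain ⟨N, hN, hdN⟩ := differentiableAt_of_unimodal hW.nonneg hm h0 hd
    have hcont : Continuous (scaling r (escort g θ)) :=
      continuous_const.mul ((hg.continuous_escort hθ hcomp).comp (by fun_prop))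
    exact absolutelyContinuousOnInterval_of_unimodal ordConnected_univ (mem_univ 0) hN
      hcont.continuousOn (fun x hx => hdN x hx.2) (fun u _ => hm u) (mem_univ a) (mem_univ b)

end StamData

/-! ### Total variation of functions supported in an interval -/

section Variation

variable {L : Type*} [LinearOrder L]

lemma ofReal_two_mul_abs (k : ℝ) : ENNReal.ofReal (2 * |k|) = edist k 0 + edist k 0 := by
  rw [edist_dist, Real.dist_eq, sub_zero, ← ENNReal.ofReal_add (abs_nonneg k) (abs_nonneg k),
    two_mul]

/-- A function that vanishes on both sides of a point varies by at least twice its value. -/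
lemma le_eVariationOn_of_zeros {F : L → ℝ} {a x b : L} (hax : a ≤ x) (hxb : x ≤ b) (ha : F a = 0)
    (hb : F b = 0) : ENNReal.ofReal (2 * |F x|) ≤ eVariationOn F univ := by
  rw [ofReal_two_mul_abs, ← Iic_union_Ici (a := x),
    eVariationOn.union F (x := x) isGreatest_Iic isLeast_Ici]
  refine add_le_add ?_ ?_
  · rw [← ha]; exact eVariationOn.edist_le F self_mem_Iic hax
  · rw [← hb]; exact eVariationOn.edist_le F self_mem_Ici hxb

/-- Split at a point of the set: the indicator increases up to it and decreases after it, each half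
contributing at most 1. Least and greatest elements serve as endpoints in the variation formula for
monotone functions. -/
lemma eVariationOn_indicator_one_le [BoundedOrder L] {S : Set L} (hS : S.OrdConnected) :
    eVariationOn (S.indicator fun _ => (1 : ℝ)) univ ≤ 2 := by
  rcases S.eq_empty_or_nonempty with rfl | ⟨x, hx⟩
  · rw [indicator_empty]
    have := eVariationOn.constant_on (f := fun _ : L => (0 : ℝ)) (s := univ)
      (by rintro _ ⟨a, -, rfl⟩ _ ⟨b, -, rfl⟩; rfl)
    rw [this]; exact zero_le
  have h01 : ∀ y, 0 ≤ S.indicator (fun _ => (1 : ℝ)) y ∧ S.indicator (fun _ => (1 : ℝ)) y ≤ 1 := by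
    intro y
    by_cases hy : y ∈ S <;> simp [hy]
  have hsub : ∀ y z, ENNReal.ofReal (S.indicator (fun _ => (1 : ℝ)) y
      - S.indicator (fun _ => (1 : ℝ)) z) ≤ 1 := fun y z => by
    rw [← ENNReal.ofReal_one]
    exact ENNReal.ofReal_le_ofReal (by linarith [(h01 y).2, (h01 z).1])
  have h1 : eVariationOn (S.indicator fun _ => (1 : ℝ)) (Iic x) ≤ 1 := by
    have hm : MonotoneOn (S.indicator fun _ => (1 : ℝ)) (Iic x) := by
      intro a _ b hb hab
      by_cases ha : a ∈ S
      · rw [indicator_of_mem ha, indicator_of_mem (hS.out ha hx ⟨hab, hb⟩)]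
      · rw [indicator_of_notMem ha]; exact (h01 b).1
    have h2 := (hm.eVariationOn_eq (a := ⊥) (b := x) (mem_Iic.2 bot_le) self_mem_Iic).le
    rw [Icc_bot, inter_self] at h2
    exact h2.trans (hsub _ _)
  have h2 : eVariationOn (S.indicator fun _ => (1 : ℝ)) (Ici x) ≤ 1 := by
    have hm : AntitoneOn (S.indicator fun _ => (1 : ℝ)) (Ici x) := by
      intro a ha b _ hab
      by_cases hb : b ∈ S
      · rw [indicator_of_mem hb, indicator_of_mem (hS.out hx hb ⟨ha, hab⟩)]
      · rw [indicator_of_notMem hb]; exact (h01 a).1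
    have h3 : MonotoneOn ((S.indicator fun _ => (1 : ℝ)) ∘ OrderDual.ofDual)
        (OrderDual.ofDual ⁻¹' Ici x) := fun a ha b hb hab => hm hb ha hab
    have h4 := (h3.eVariationOn_eq (a := OrderDual.toDual ⊤) (b := OrderDual.toDual x)
      (show x ≤ ⊤ from le_top) (show x ≤ x from le_rfl)).le
    rw [← eVariationOn.comp_ofDual]
    refine le_trans (le_of_eq ?_) (h4.trans (hsub _ _))
    congr 1
    ext y
    simp
  rw [← Iic_union_Ici (a := x), eVariationOn.union _ (x := x) isGreatest_Iic isLeast_Ici]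
  exact (add_le_add h1 h2).trans (by norm_num)

lemma eVariationOn_indicator_le [BoundedOrder L] {S : Set L} (hS : S.OrdConnected) (k : ℝ) :
    eVariationOn (S.indicator fun _ => k) univ ≤ ENNReal.ofReal (2 * |k|) := by
  have h1 : (S.indicator fun _ => k) = (fun z => k * z) ∘ S.indicator fun _ => (1 : ℝ) := by
    ext y
    by_cases hy : y ∈ S <;> simp [hy]
  have hl : LipschitzOnWith ‖k‖₊ (fun z : ℝ => k * z) univ :=
    (LipschitzWith.of_dist_le_mul fun a b => by
      simp only [Real.dist_eq, ← mul_sub, abs_mul, coe_nnnorm, Real.norm_eq_abs,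
        le_refl]).lipschitzOnWith
  rw [h1]
  refine (hl.comp_eVariationOn_le (mapsTo_univ _ _)).trans ?_
  refine (mul_le_mul' le_rfl (eVariationOn_indicator_one_le hS)).trans (le_of_eq ?_)
  rw [mul_comm (2 : ℝ), ENNReal.ofReal_mul (abs_nonneg k), ← Real.norm_eq_abs, ofReal_norm]
  simp [enorm]

end Variation

lemma ordConnected_coe_image {S : Set ℝ} (hS : S.OrdConnected) :
    ((fun x : ℝ => (x : EReal)) '' S).OrdConnected := by
  refine ⟨?_⟩
  rintro _ ⟨a, ha, rfl⟩ _ ⟨b, hb, rfl⟩ z ⟨h1, h2⟩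
  induction z with
  | bot => simp at h1
  | top => simp at h2
  | coe z => exact ⟨z, hS.out ha hb ⟨EReal.coe_le_coe_iff.1 h1, EReal.coe_le_coe_iff.1 h2⟩, rfl⟩

/-- The variation on the extended line of a function that vanishes off a set of reals. -/
lemma le_eVariationOn_coe_indicator {S : Set ℝ} (F : EReal → ℝ) {x : ℝ} (hx : x ∈ S) :
    ENNReal.ofReal (2 * |F x|)
      ≤ eVariationOn (((fun x : ℝ => (x : EReal)) '' S).indicator F) univ := by
  -- Neither infinity is the image of a real, so the extended function vanishes at both ends of the
  -- extended line even if the set is unbounded.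
  have h := le_eVariationOn_of_zeros (F := ((fun x : ℝ => (x : EReal)) '' S).indicator F)
    (a := ⊥) (x := (x : EReal)) (b := ⊤) bot_le le_top (indicator_of_notMem (by simp) _)
    (indicator_of_notMem (by simp) _)
  rwa [indicator_of_mem (mem_image_of_mem _ hx)] at h

lemma eVariationOn_coe_indicator_const {S : Set ℝ} (hS : S.OrdConnected) (hne : S.Nonempty)
    (k : ℝ) : eVariationOn (((fun x : ℝ => (x : EReal)) '' S).indicator fun _ => k) univ
      = ENNReal.ofReal (2 * |k|) := by
  obtain ⟨x, hx⟩ := hne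
  exact le_antisymm (eVariationOn_indicator_le (ordConnected_coe_image hS) k)
    (le_eVariationOn_coe_indicator (fun _ => k) hx)

/-- The upper bound is inherited from the extended line through the monotone inclusion. The lower
bound needs zeros on both sides within ℝ, hence the bounding interval. -/
lemma eVariationOn_indicator_const {S : Set ℝ} (hS : S.OrdConnected) (hne : S.Nonempty)
    {a b : ℝ} (hab : S ⊆ Ioo a b) (k : ℝ) :
    eVariationOn (S.indicator fun _ => k) univ = ENNReal.ofReal (2 * |k|) := by
  obtain ⟨x, hx⟩ := hne
  apply le_antisymm
  · rw [← eVariationOn_coe_indicator_const hS ⟨x, hx⟩]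
    have h := eVariationOn.comp_le_of_monotoneOn
      (((fun x : ℝ => (x : EReal)) '' S).indicator fun _ => k) (s := univ) (t := univ)
      (fun x : ℝ => (x : EReal)) (EReal.coe_strictMono.monotone.monotoneOn _) (mapsTo_univ _ _)
    refine le_trans (le_of_eq ?_) h
    congr 1
    ext y
    by_cases hy : y ∈ S
    · simp [hy]
    · simp [hy]
  · have h := le_eVariationOn_of_zeros (F := S.indicator fun _ => k) (hab hx).1.le (hab hx).2.le
      (indicator_of_notMem (fun h' => (hab h').1.false) _)
      (indicator_of_notMem (fun h' => (hab h').2.false) _)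
    rwa [indicator_of_mem hx] at h

/-! ### The case p = 1: uniform densities -/

lemma stretchedGaussian_top (γ : ℝ) :
    stretchedGaussian ∞ γ = (Ioo (-1 : ℝ) 1).indicator fun _ => (1 / 2 : ℝ) := by
  have h1 : stretchedProfile ∞ γ = (Ioo (-1 : ℝ) 1).indicator fun _ => (1 : ℝ) := by
    ext x; rw [stretchedProfile, if_pos rfl]
  have h2 : ∫ s, stretchedProfile ∞ γ s = 2 := by
    rw [h1, integral_indicator measurableSet_Ioo]
    simp
    norm_num
  ext x
  rw [stretchedGaussian, h2, h1]
  by_cases hx : x ∈ Ioo (-1 : ℝ) 1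
  · rw [indicator_of_mem hx, indicator_of_mem hx]
  · rw [indicator_of_notMem hx, indicator_of_notMem hx, zero_div]

lemma stretchedGaussian_top_apply (γ : ℝ) {x : ℝ} (hx : x ∈ Ioo (-1 : ℝ) 1) :
    stretchedGaussian ∞ γ x = 1 / 2 := by
  rw [stretchedGaussian_top, indicator_of_mem hx]

lemma setOf_stretchedGaussian_top_pos (γ : ℝ) : {x | 0 < stretchedGaussian ∞ γ x} = Ioo (-1) 1 := by
  ext x
  rw [mem_ofPred_eq, stretchedGaussian_top]
  by_cases hx : x ∈ Ioo (-1 : ℝ) 1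
  · simp only [indicator_of_mem hx, hx, iff_true]; norm_num
  · simp only [indicator_of_notMem hx, hx, iff_false]; norm_num

lemma lintegral_uniform_rpow (γ : ℝ) :
    ∫⁻ x in {x | 0 < stretchedGaussian ∞ γ x}, ENNReal.ofReal (stretchedGaussian ∞ γ x ^ γ)
      = ENNReal.ofReal (2 * (1 / 2) ^ γ) := by
  rw [setOf_stretchedGaussian_top_pos, setLIntegral_congr_fun measurableSet_Ioo
    (g := fun _ => ENNReal.ofReal ((1 / 2 : ℝ) ^ γ)) fun x hx => by
      simp only [stretchedGaussian_top_apply γ hx]]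
  rw [setLIntegral_const, Real.volume_Ioo, mul_comm, ← ENNReal.ofReal_mul (by norm_num)]
  norm_num

section Uniform

variable {γ θ β : ℝ}

lemma stamData_uniform (hγ : 0 < γ) (hγ1 : γ ≠ 1) (hθ : θ ≠ 0) :
    StamData (stretchedGaussian ∞ γ) γ θ where
  density := by
    refine ⟨⟨?_, ?_, ?_, fun x hx => hx⟩, fun x => ?_, ?_⟩
    · rw [setOf_stretchedGaussian_top_pos]; exact isOpen_Ioo
    · rw [setOf_stretchedGaussian_top_pos]; exact ordConnected_Ioo
    · rw [stretchedGaussian_top]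
      exact (measurable_const.indicator measurableSet_Ioo).aemeasurable
    · rw [stretchedGaussian_top]
      exact indicator_nonneg (fun _ _ => by norm_num) x
    · have h1 : (fun x => ENNReal.ofReal (stretchedGaussian ∞ γ x))
          = (Ioo (-1 : ℝ) 1).indicator fun _ => ENNReal.ofReal (1 / 2) := by
        ext x
        rw [stretchedGaussian_top]
        by_cases hx : x ∈ Ioo (-1 : ℝ) 1
        · rw [indicator_of_mem hx, indicator_of_mem hx]
        · rw [indicator_of_notMem hx, indicator_of_notMem hx, ENNReal.ofReal_zero]
      rw [h1, lintegral_indicator measurableSet_Ioo, setLIntegral_const, Real.volume_Ioo,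
        ← ENNReal.ofReal_mul (by norm_num)]
      norm_num
  zero_pos := by rw [stretchedGaussian_top_apply γ (by norm_num)]; norm_num
  differentiableOn := by
    rw [setOf_stretchedGaussian_top_pos]
    exact (differentiableOn_const (1 / 2 : ℝ)).congr fun x hx => stretchedGaussian_top_apply γ hx
  gamma_pos := hγ
  gamma_ne := hγ1
  theta_ne := hθ

lemma escort_uniform (hg : StamData (stretchedGaussian ∞ γ) γ θ) :
    escort (stretchedGaussian ∞ γ) θ
      = {t | 0 < escort (stretchedGaussian ∞ γ) θ t}.indicator fun _ => (1 / 2 : ℝ) ^ (1 / θ) := by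
  ext t
  by_cases ht : t ∈ {t | 0 < escort (stretchedGaussian ∞ γ) θ t}
  · rw [indicator_of_mem ht]
    rw [hg.setOf_escort_pos] at ht
    obtain ⟨x, hx, rfl⟩ := ht
    rw [hg.escort_apply hx]
    rw [setOf_stretchedGaussian_top_pos] at hx
    rw [stretchedGaussian_top_apply γ hx]
  · rw [indicator_of_notMem ht]
    exact le_antisymm (not_lt.1 ht) (hg.isIntervalDensity_escort.nonneg t)

/-- The escort variable of a constant is linear, so the support remains bounded and both jumps of
the escort are visible on the real line. -/
lemma setOf_escort_uniform_subset (hg : StamData (stretchedGaussian ∞ γ) γ θ) :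
    {t | 0 < escort (stretchedGaussian ∞ γ) θ t}
      ⊆ Ioo (-(1 / 2 : ℝ) ^ (1 - 1 / θ)) ((1 / 2 : ℝ) ^ (1 - 1 / θ)) := by
  rw [hg.setOf_escort_pos, setOf_stretchedGaussian_top_pos]
  rintro _ ⟨x, hx, rfl⟩
  have h1 : escortVar (stretchedGaussian ∞ γ) θ x = x * (1 / 2 : ℝ) ^ (1 - 1 / θ) := by
    rw [escortVar, intervalIntegral.integral_congr (g := fun _ => (1 / 2 : ℝ) ^ (1 - 1 / θ))]
    · simp
    · intro s hs
      have : s ∈ Ioo (-1 : ℝ) 1 :=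
        ordConnected_Ioo.uIcc_subset (by norm_num : (0 : ℝ) ∈ Ioo (-1 : ℝ) 1) hx hs
      simp only [stretchedGaussian_top_apply γ this]
  have h2 : 0 < (1 / 2 : ℝ) ^ (1 - 1 / θ) := by positivity
  rw [h1]
  constructor <;> nlinarith [hx.1, hx.2]

lemma indicator_rpow_div {L : Type*} (S : Set L) (κ : ℝ) (hβ : β ≠ 0) :
    (fun t => S.indicator (fun _ => κ) t ^ β / β) = S.indicator fun _ => κ ^ β / β := by
  ext t
  by_cases ht : t ∈ S
  · rw [indicator_of_mem ht, indicator_of_mem ht]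
  · rw [indicator_of_notMem ht, indicator_of_notMem ht, Real.zero_rpow hβ, zero_div]

/-- The escort is constant on its support with value (1/2)^(1/θ), so its β-th power is (1/2)^γ; the
variation counts two jumps of this height divided by |β|. -/
lemma fisherIntegral_uniform (hg : StamData (stretchedGaussian ∞ γ) γ θ) (hβ0 : β ≠ 0)
    (hβ : β = γ * θ) : fisherIntegral 1 β (escort (stretchedGaussian ∞ γ) θ) ^ (1 / (1 : ℝ))
      = ENNReal.ofReal (2 * ((1 / 2 : ℝ) ^ γ / |β|)) := by
  have h := setOf_escort_uniform_subset hg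
  have hG := hg.isIntervalDensity_escort
  rw [fisherIntegral, if_pos rfl, div_one, ENNReal.rpow_one, escort_uniform hg,
    indicator_rpow_div _ _ hβ0, eVariationOn_indicator_const hG.isWeight.ordConnected hG.nonempty h,
    abs_div, abs_of_pos (by positivity), ← Real.rpow_mul (by norm_num),
    show 1 / θ * β = γ by rw [hβ]; have := hg.theta_ne; field_simp]

end Uniform

/-- The upper bound in the proof of the Stam inequality, for `p = 1`. -/
lemma stam_upper_one {Ω : Set ℝ} {f h y : ℝ → ℝ} {α β γ : ℝ} (hβ0 : β ≠ 0)
    (hα : 0 < α) (hy : IsChangeOfVar Ω f h α y) (hf : IsWeight Ω f) (hh : IsWeight Ω h)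
    (h1 : ∫⁻ x in Ω, ENNReal.ofReal (f x) = 1) {s : ℝ → ℝ}
    (hs : IsTransport (y '' Ω) (relTransform Ω f h α y)
      {x | 0 < stretchedGaussian ∞ γ x} (stretchedGaussian ∞ γ) s) :
    ∫⁻ t in y '' Ω, ENNReal.ofReal (relTransform Ω f h α y t ^ (1 + β)
        / stretchedGaussian ∞ γ (s t))
      ≤ ENNReal.ofReal |β| * (ENNReal.ofReal α
        * relFisherIntegral Ω 1 (β * α) f h ^ (1 / (1 : ℝ))) := by
  have hT := hy.isTransport hf hh
  have hpos := setOf_relTransform_pos (α := α) hT.strictMonoOn hf hh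
  have hwd := isIntervalDensity_relTransform hy hf hh h1
  rw [div_one, ENNReal.rpow_one]
  set C := ENNReal.ofReal |β| * (ENNReal.ofReal α * relFisherIntegral Ω 1 (β * α) f h) with hC
  -- Here 1/g = 2, and twice a value is at most the variation of a function vanishing at both ends.
  -- This pointwise bound replaces integration by parts and Hölder.
  have hpt : ∀ t ∈ y '' Ω, ENNReal.ofReal (relTransform Ω f h α y t ^ (1 + β)
      / stretchedGaussian ∞ γ (s t)) ≤ C * ENNReal.ofReal (relTransform Ω f h α y t) := by
    intro t ht
    have hst := hs.mem ht
    rw [setOf_stretchedGaussian_top_pos] at hst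
    have hwt := relTransform_pos (α := α) hT.strictMonoOn hf hh ht
    rw [stretchedGaussian_top_apply γ hst, Real.rpow_add hwt, Real.rpow_one,
      mul_div_assoc, ENNReal.ofReal_mul hwt.le, mul_comm]
    refine mul_le_mul' ?_ le_rfl
    obtain ⟨x, hx, rfl⟩ := ht
    have hfx := hf.pos x hx
    have hhx := hh.pos x hx
    rw [relTransform_apply hT.strictMonoOn hx]
    have h2 := le_eVariationOn_coe_indicator (S := Ω)
      (fun x : EReal => (f x.toReal / h x.toReal) ^ (β * α) / (β * α)) hx
    rw [hC, relFisherIntegral, if_pos rfl, ← mul_assoc, ← ENNReal.ofReal_mul (abs_nonneg β)]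
    refine le_trans (le_of_eq ?_) (mul_le_mul' le_rfl h2)
    have hr : 0 < (f x / h x) ^ (β * α) := by positivity
    rw [EReal.toReal_coe, ← ENNReal.ofReal_mul (by positivity), abs_div, abs_of_pos hr, abs_mul,
      abs_of_pos hα, ← Real.rpow_mul (by positivity), mul_comm α β]
    have := abs_ne_zero.2 hβ0
    congr 1
    field_simp
  calc _ ≤ ∫⁻ t in y '' Ω, C * ENNReal.ofReal (relTransform Ω f h α y t) :=
        setLIntegral_mono' hT.target.isOpen.measurableSet hpt
    _ = C := by
        rw [lintegral_const_mul'' _ hwd.aemeasurable.restrict.ennreal_ofReal,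
          ← hpos, hwd.setLIntegral, mul_one]

/-- The variation of the inverse transform of the uniform density. -/
lemma relFisherIntegral_invTransform_uniform {Ω : Set ℝ} {h : ℝ → ℝ} {α β γ θ : ℝ}
    (hα : 0 < α) (hh : IsWeight Ω h) (h1 : ∫⁻ x in Ω, ENNReal.ofReal (h x) = 1)
    (hg : StamData (stretchedGaussian ∞ γ) γ θ) (hβ0 : β ≠ 0) (hβ : β = γ * θ)
    (hN : renyiPower ((α - 1) / α) (escort (stretchedGaussian ∞ γ) θ) ≠ ∞) :
    ENNReal.ofReal α * relFisherIntegral Ω 1 (β * α)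
        (invTransform Ω h α (escort (stretchedGaussian ∞ γ) θ)) h ^ (1 / (1 : ℝ))
      = ENNReal.ofReal (invScale α (escort (stretchedGaussian ∞ γ) θ) ^ β)
        * fisherIntegral 1 β (escort (stretchedGaussian ∞ γ) θ) ^ (1 / (1 : ℝ)) := by
  have hG := hg.isIntervalDensity_escort
  have hr := invScale_pos hα hG hN
  have hT := isTransport_invVar hα hh h1 hG hN
  have hne : Ω.Nonempty := by
    rw [nonempty_iff_ne_empty]
    rintro rfl
    simp at h1
  rw [fisherIntegral_uniform hg hβ0 hβ]
  set r := invScale α (escort (stretchedGaussian ∞ γ) θ)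
  set κ := r * (1 / 2 : ℝ) ^ (1 / θ) with hκ
  have hκ0 : 0 < κ := by positivity
  -- The minimizer has constant ratio to h, so its relative variation consists of the jumps at the
  -- two ends of `Ω`, which may be infinite.
  have hquot : ∀ x ∈ Ω, invTransform Ω h α (escort (stretchedGaussian ∞ γ) θ) x / h x
      = κ ^ (1 / α) := by
    intro x hx
    have hm : invVar Ω h α (escort (stretchedGaussian ∞ γ) θ) x
      ∈ {t | 0 < scaling r (escort (stretchedGaussian ∞ γ) θ) t} := hT.mem hx
    have hm' : r * invVar Ω h α (escort (stretchedGaussian ∞ γ) θ) x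
      ∈ {t | 0 < escort (stretchedGaussian ∞ γ) θ t} := (scaling_pos_iff hr _).1 hm
    have hval : escort (stretchedGaussian ∞ γ) θ
        (r * invVar Ω h α (escort (stretchedGaussian ∞ γ) θ) x) = (1 / 2 : ℝ) ^ (1 / θ) := by
      rw [congrFun (escort_uniform hg), indicator_of_mem hm']
    rw [invTransform_apply hx, mul_div_cancel_right₀ _ (hh.pos x hx).ne']
    change (r * escort (stretchedGaussian ∞ γ) θ (r * _)) ^ (1 / α) = _
    rw [hval]
  rw [relFisherIntegral, if_pos rfl, indicator_congr
    (g := fun _ => (κ ^ (1 / α)) ^ (β * α) / (β * α)),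
    eVariationOn_coe_indicator_const hh.ordConnected hne, div_one, ENNReal.rpow_one,
    ← ENNReal.ofReal_mul hα.le, ← ENNReal.ofReal_mul (by positivity), ← Real.rpow_mul hκ0.le,
    show 1 / α * (β * α) = β by field_simp, abs_div, abs_mul, abs_of_pos hα,
    abs_of_pos (by positivity), hκ, Real.mul_rpow hr.le (by positivity),
    ← Real.rpow_mul (by norm_num), show 1 / θ * β = γ by
      rw [hβ]; have := hg.theta_ne; field_simp]
  · have := abs_ne_zero.2 hβ0
    congr 1
    field_simp
  · rintro _ ⟨x, hx, rfl⟩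
    simp only [EReal.toReal_coe, hquot x hx]

/-! ### The sign condition -/

lemma holderConj_one : holderConj 1 = ∞ := by
  simp [holderConj, ENNReal.conjExponent]

lemma holderConj_of_one_lt {p : ℝ} (hp : 1 < p) :
    holderConj p = ENNReal.ofReal (Real.conjExponent p) := by
  have h1 : ENNReal.ofReal p - 1 = ENNReal.ofReal (p - 1) := by
    rw [ENNReal.ofReal_sub _ zero_le_one, ENNReal.ofReal_one]
  rw [holderConj, ENNReal.conjExponent, h1, ← ENNReal.ofReal_inv_of_pos (by linarith),
    ← ENNReal.ofReal_one, ← ENNReal.ofReal_add zero_le_one (inv_nonneg.2 (by linarith))]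
  congr 1
  have : p - 1 ≠ 0 := by linarith
  rw [Real.conjExponent]
  field_simp
  ring

section SignCond

variable {p β l : ℝ}

lemma SignCond.theta_ne (h : SignCond p β l) : 1 + β - l ≠ 0 := by
  have := sign_ne_zero.1 h.2
  rwa [add_comm 1 β]

lemma div_ne_one_of_ne {θ : ℝ} (hl : l ≠ 1) (hθ : θ = 1 + β - l) (hθ0 : θ ≠ 0) : β / θ ≠ 1 := by
  rw [Ne, div_eq_one_iff_eq hθ0, hθ]
  intro h
  exact hl (by linarith)

/-- With θ = 1+β-l one has qβ + l - 1 = (1+q)β - θ. This has the sign of θ exactly when (1+q)β/θ >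
1, which is the integrability condition for the Gaussian of parameter β/θ. -/
lemma SignCond.isProfileParam (h : SignCond p β l) (hp : 1 < p) (hl : l ≠ 1) :
    IsProfileParam (Real.conjExponent p) (β / (1 + β - l)) := by
  have hpq := Real.HolderConjugate.conjExponent hp
  have hq := hpq.symm.pos
  refine ⟨hq.le, ?_, div_ne_one_of_ne hl rfl h.theta_ne⟩
  have h1 := h.1
  rw [holderConj_of_one_lt hp, EReal.coe_ennreal_ofReal, max_eq_left hq.le, ← EReal.coe_mul,
    ← EReal.coe_add, EReal.sign_coe] at h1
  rcases lt_or_gt_of_ne h.theta_ne with hθ | hθ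
  · rw [sign_neg (show β + 1 - l < 0 by linarith), sign_eq_neg_one_iff] at h1
    rw [lt_div_iff_of_neg hθ, one_div_mul_eq_div, lt_div_iff₀ (by linarith)]
    linarith
  · rw [sign_pos (show 0 < β + 1 - l by linarith), sign_eq_one_iff] at h1
    rw [lt_div_iff₀ hθ, one_div_mul_eq_div, div_lt_iff₀ (by linarith)]
    linarith

/-- For infinite conjugate exponent only the sign of β counts. The case β = 0, where ∞ · 0 = 0,
would require l - 1 and 1 - l to have the same sign. -/
lemma SignCond.div_pos (h : SignCond 1 β l) (hl : l ≠ 1) : 0 < β / (1 + β - l) := by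
  have h1 := h.1
  rw [holderConj_one, EReal.coe_ennreal_top] at h1
  rcases lt_trichotomy β 0 with hβ | rfl | hβ
  · rw [EReal.top_mul_coe_of_neg hβ, EReal.bot_add, sign_neg (by simp), eq_comm,
      sign_eq_neg_one_iff] at h1
    exact div_pos_of_neg_of_neg hβ (by linarith)
  · rw [EReal.coe_zero, mul_zero, zero_add, EReal.sign_coe, zero_add] at h1
    rcases lt_or_gt_of_ne hl with h2 | h2
    · rw [sign_neg (by linarith), sign_pos (by linarith)] at h1
      exact absurd h1 (by decide)
    · rw [sign_pos (by linarith), sign_neg (by linarith)] at h1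
      exact absurd h1 (by decide)
  · rw [EReal.top_mul_coe_of_pos hβ, EReal.top_add_coe, sign_pos (by simp), eq_comm,
      sign_eq_one_iff] at h1
    exact _root_.div_pos hβ (by linarith)

end SignCond

/-! ### Assembly -/

lemma stamConst_eq {g : ℝ → ℝ} {p β l γ θ c : ℝ} (hg : StamData g γ θ)
    (hβ : β = γ * θ) (hθ : θ = 1 + β - l) (hl : l ≠ 1) (hc0 : 0 < c)
    (hc : ∫⁻ x in {x | 0 < g x}, ENNReal.ofReal (g x ^ γ) = ENNReal.ofReal c) :
    (fisherInfo p β (escort g θ) * renyiPower l (escort g θ)) ^ θ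
      = ENNReal.ofReal c ^ (1 / (1 - γ))
        * (fisherIntegral p β (escort g θ) ^ (1 / p)) ^ (1 / γ) := by
  rw [fisherInfo_eq, renyiPower, hg.lintegral_escort_rpow hβ (by linarith), hc,
    fisher_mul_renyi_rpow (by simpa using hc0) ENNReal.ofReal_ne_top hl hθ hg.theta_ne
    (by rw [hβ, mul_div_cancel_right₀ _ hg.theta_ne])]

/-- The Stam inequality, given the upper bound for the transformed densities and the value of the
Fisher functional of the minimizer. -/
theorem relative_stam_of_data {Ω : Set ℝ} (hΩo : IsOpen Ω) (hΩc : Ω.OrdConnected) {h : ℝ → ℝ}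
    (hh : IsDensityOn Ω h) (hhd : DifferentiableOn ℝ h Ω) {α l p β γ θ c D : ℝ} (hα : 0 < α)
    (hl : l ≠ 1) {g : ℝ → ℝ} (hg : StamData g γ θ) (hβ : β = γ * θ) (hθ : θ = 1 + β - l)
    (hc0 : 0 < c) (hD : 0 < D)
    (hc : ∫⁻ x in {x | 0 < g x}, ENNReal.ofReal (g x ^ γ) = ENNReal.ofReal c)
    (hΨ : ENNReal.ofReal D * fisherIntegral p β (escort g θ) ^ (1 / p) ≤ ENNReal.ofReal c)
    (hΨ0 : fisherIntegral p β (escort g θ) ^ (1 / p) ≠ 0)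
    (hup : ∀ f y : ℝ → ℝ, IsWeight Ω f → ∫⁻ x in Ω, ENNReal.ofReal (f x) = 1 →
      DifferentiableOn ℝ f Ω → IsChangeOfVar Ω f h α y →
      StamRegular p θ (y '' Ω) (relTransform Ω f h α y) →
      ∀ s, IsTransport (y '' Ω) (relTransform Ω f h α y) {x | 0 < g x} g s →
        ∫⁻ t in y '' Ω, ENNReal.ofReal (relTransform Ω f h α y t ^ (1 + β) / g (s t))
          ≤ ENNReal.ofReal D
            * (ENNReal.ofReal α * relFisherIntegral Ω p (β * α) f h ^ (1 / p)))
    (hinv : renyiPower ((α - 1) / α) (escort g θ) ≠ ∞ →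
      IsWeight Ω (invTransform Ω h α (escort g θ)) →
      DifferentiableOn ℝ (invTransform Ω h α (escort g θ)) Ω →
      ENNReal.ofReal α
          * relFisherIntegral Ω p (β * α) (invTransform Ω h α (escort g θ)) h ^ (1 / p)
        = ENNReal.ofReal (invScale α (escort g θ) ^ β)
          * fisherIntegral p β (escort g θ) ^ (1 / p))
    (hreg : ∀ r > 0, StamRegular p θ {t | 0 < scaling r (escort g θ) t}
      (scaling r (escort g θ))) {K : ℝ≥0∞}
    (hK : K = (fisherInfo p β (escort g θ) * renyiPower l (escort g θ)) ^ θ) :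
    (∀ f y : ℝ → ℝ, IsDensityOn Ω f → DifferentiableOn ℝ f Ω → IsChangeOfVar Ω f h α y →
      StamRegular p θ (y '' Ω) (relTransform Ω f h α y) → renyiIntegral Ω (xi l α) f h ≠ ∞ →
      ENNReal.ofReal α ^ ((l - β - 1) / (α * β)) * K ^ (1 / α)
        ≤ (EReal.exp (-renyiDiv Ω (xi l α) f h) * relFisher Ω p (β * α) f h) ^ θ) ∧
    (K ≠ 0 ∧ K ≠ ∞) ∧
    (renyiPower ((α - 1) / α) (escort g θ) ≠ ∞ →
      (IsDensityOn Ω (invTransform Ω h α (escort g θ)) ∧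
        DifferentiableOn ℝ (invTransform Ω h α (escort g θ)) Ω ∧
        IsChangeOfVar Ω (invTransform Ω h α (escort g θ)) h α (invVar Ω h α (escort g θ)) ∧
        StamRegular p θ (invVar Ω h α (escort g θ) '' Ω)
          (relTransform Ω (invTransform Ω h α (escort g θ)) h α (invVar Ω h α (escort g θ))) ∧
        renyiIntegral Ω (xi l α) (invTransform Ω h α (escort g θ)) h ≠ ∞ ∧
        (EReal.exp (-renyiDiv Ω (xi l α) (invTransform Ω h α (escort g θ)) h)
            * relFisher Ω p (β * α) (invTransform Ω h α (escort g θ)) h) ^ θ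
          = ENNReal.ofReal α ^ ((l - β - 1) / (α * β)) * K ^ (1 / α)) ∧
      (∀ f y : ℝ → ℝ, IsDensityOn Ω f → DifferentiableOn ℝ f Ω → IsChangeOfVar Ω f h α y →
        StamRegular p θ (y '' Ω) (relTransform Ω f h α y) → renyiIntegral Ω (xi l α) f h ≠ ∞ →
        (EReal.exp (-renyiDiv Ω (xi l α) f h) * relFisher Ω p (β * α) f h) ^ θ
          = ENNReal.ofReal α ^ ((l - β - 1) / (α * β)) * K ^ (1 / α) →
        ∀ x ∈ Ω, f x = invTransform Ω h α (escort g θ) x)) := by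
  have hγ := hg.gamma_pos
  have hβ0 : β ≠ 0 := by rw [hβ]; exact mul_ne_zero hγ.ne' hg.theta_ne
  have hhw := hh.isWeight hΩo hΩc
  have h1 := hh.setLIntegral hΩc
  have hG := hg.isIntervalDensity_escort
  rw [stamConst_eq hg hβ hθ hl hc0 hc] at hK
  have hlθ : l = 1 + β - θ := by linarith
  have key : ∀ f y : ℝ → ℝ, IsDensityOn Ω f → DifferentiableOn ℝ f Ω →
      IsChangeOfVar Ω f h α y → StamRegular p θ (y '' Ω) (relTransform Ω f h α y) →
      renyiIntegral Ω (xi l α) f h ≠ ∞ → _ := fun f y hf hfd hy hr hKf =>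
    relative_stam hΩo hΩc hh hα hl hg hβ0 hβ hlθ hc0 hD hc hΨ hf hy hKf
      (relFisher_eq Ω p (β * α) f h)
      (hup f y (hf.isWeight hΩo hΩc) (hf.setLIntegral hΩc) hfd hy hr)
  refine ⟨fun f y hf hfd hy hr hKf => ?_, ?_, fun hN => ?_⟩
  · rw [hK]; exact (key f y hf hfd hy hr hKf).1
  · have hΨT : fisherIntegral p β (escort g θ) ^ (1 / p) ≠ ∞ := by
      intro h
      rw [h, ENNReal.mul_top (by simpa using hD)] at hΨ
      exact ENNReal.ofReal_ne_top (top_le_iff.1 hΨ)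
    rw [hK, ENNReal.ofReal_rpow_of_pos hc0]
    constructor
    · refine mul_ne_zero (by simpa using Real.rpow_pos_of_pos hc0 _) ?_
      rw [Ne, ENNReal.rpow_eq_zero_iff_of_pos (by positivity)]
      exact hΨ0
    · exact ENNReal.mul_ne_top ENNReal.ofReal_ne_top
        (ENNReal.rpow_ne_top_of_nonneg (by positivity) hΨT)
  · have hfd := differentiableOn_invTransform hα hhw h1 hhd hG hg.differentiableOn_escort hN
    have hf := isDensityOn_invTransform hΩo hΩc hα hh hG hN
    have hfw := hf.isWeight hΩo hΩc
    have hsharp := relative_stam_sharp hΩo hΩc hh hα hl hg hβ0 hβ hlθ hc0 hc hN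
      (relFisher_eq Ω p (β * α) _ h) (hinv hN hfw hfd)
    refine ⟨⟨hf, hfd, isChangeOfVar_invVar hα hhw h1 hG hN, ?_, hsharp.1, ?_⟩, ?_⟩
    · rw [relTransform_invTransform hα hhw h1 hG hN,
        (isTransport_invVar hα hhw h1 hG hN).image]
      exact hreg _ (invScale_pos hα hG hN)
    · rw [hK]; exact hsharp.2
    · intro f y hf' hfd' hy hr hKf heq
      rw [hK] at heq
      -- Both densities are differentiable, hence continuous, on the open set `Ω`, so almost
      -- everywhere equality is equality.
      exact Measure.eqOn_open_of_ae_eq ((key f y hf' hfd' hy hr hKf).2 hN heq) hΩo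
        hfd'.continuousOn hfd.continuousOn

end RelEscort

theorem theorem1 (Ω : Set ℝ) (hΩo : IsOpen Ω) (hΩc : Ω.OrdConnected)
    (h : ℝ → ℝ) (hh : IsDensityOn Ω h)
    (α : ℝ) (hα : 0 < α) (l : ℝ) (hl : l ≠ 1) :
    -- moment-entropy-like inequality; `q` is the exponent `p^*`
    (∀ q : ℝ, 0 ≤ q → 1 / (1 + q) < l →
      (∀ f y : ℝ → ℝ, IsDensityOn Ω f → IsChangeOfVar Ω f h α y →
        renyiIntegral Ω (xi l α) f h ≠ ∞ →
        momentConst q l ^ (1 / α)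
          ≤ EReal.exp (renyiDiv Ω (xi l α) f h) * relDeviation Ω f h α y q) ∧
      (momentConst q l ≠ 0 ∧ momentConst q l ≠ ∞) ∧
      (∀ g : ℝ → ℝ, g = stretchedGaussian (ENNReal.ofReal q) l →
        renyiPower ((α - 1) / α) g ≠ ∞ →
        -- the inverse transform of `g` is an admissible density attaining equality
        (IsDensityOn Ω (invTransform Ω h α g) ∧
          IsChangeOfVar Ω (invTransform Ω h α g) h α (invVar Ω h α g) ∧
          renyiIntegral Ω (xi l α) (invTransform Ω h α g) h ≠ ∞ ∧
          EReal.exp (renyiDiv Ω (xi l α) (invTransform Ω h α g) h)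
              * relDeviation Ω (invTransform Ω h α g) h α (invVar Ω h α g) q
            = momentConst q l ^ (1 / α)) ∧
        -- and it is the only one
        (∀ f y : ℝ → ℝ, IsDensityOn Ω f → IsChangeOfVar Ω f h α y →
          renyiIntegral Ω (xi l α) f h ≠ ∞ →
          EReal.exp (renyiDiv Ω (xi l α) f h) * relDeviation Ω f h α y q
            = momentConst q l ^ (1 / α) →
          ∀ᵐ x ∂(volume.restrict Ω), f x = invTransform Ω h α g x))) ∧
    -- Stam-like inequality
    (∀ p β : ℝ, 1 ≤ p → SignCond p β l → DifferentiableOn ℝ h Ω →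
      (∀ f y : ℝ → ℝ, IsDensityOn Ω f → DifferentiableOn ℝ f Ω → IsChangeOfVar Ω f h α y →
        StamRegular p (1 + β - l) (y '' Ω) (relTransform Ω f h α y) →
        renyiIntegral Ω (xi l α) f h ≠ ∞ →
        ENNReal.ofReal α ^ ((l - β - 1) / (α * β)) * stamConst p β l ^ (1 / α)
          ≤ (EReal.exp (-renyiDiv Ω (xi l α) f h) * relFisher Ω p (β * α) f h)
              ^ (1 + β - l)) ∧
      (stamConst p β l ≠ 0 ∧ stamConst p β l ≠ ∞) ∧
      (∀ g : ℝ → ℝ, g = stamMinimizer (holderConj p) β l →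
        renyiPower ((α - 1) / α) g ≠ ∞ →
        -- the inverse transform of `g` is an admissible density attaining equality
        (IsDensityOn Ω (invTransform Ω h α g) ∧
          DifferentiableOn ℝ (invTransform Ω h α g) Ω ∧
          IsChangeOfVar Ω (invTransform Ω h α g) h α (invVar Ω h α g) ∧
          StamRegular p (1 + β - l) (invVar Ω h α g '' Ω)
            (relTransform Ω (invTransform Ω h α g) h α (invVar Ω h α g)) ∧
          renyiIntegral Ω (xi l α) (invTransform Ω h α g) h ≠ ∞ ∧
          (EReal.exp (-renyiDiv Ω (xi l α) (invTransform Ω h α g) h)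
              * relFisher Ω p (β * α) (invTransform Ω h α g) h) ^ (1 + β - l)
            = ENNReal.ofReal α ^ ((l - β - 1) / (α * β)) * stamConst p β l ^ (1 / α)) ∧
        -- and it is the only one
        (∀ f y : ℝ → ℝ, IsDensityOn Ω f → DifferentiableOn ℝ f Ω → IsChangeOfVar Ω f h α y →
          StamRegular p (1 + β - l) (y '' Ω) (relTransform Ω f h α y) →
          renyiIntegral Ω (xi l α) f h ≠ ∞ →
          (EReal.exp (-renyiDiv Ω (xi l α) f h) * relFisher Ω p (β * α) f h) ^ (1 + β - l)
            = ENNReal.ofReal α ^ ((l - β - 1) / (α * β)) * stamConst p β l ^ (1 / α) →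
          ∀ x ∈ Ω, f x = invTransform Ω h α g x))) := by
  have hhw := hh.isWeight hΩo hΩc
  have h1 := hh.setLIntegral hΩc
  refine ⟨fun q hq hlt => ?_, fun p β hp hs hhd => ?_⟩
  · have hP : IsProfileParam q l := ⟨hq, hlt, hl⟩
    refine ⟨fun f y hf hy hK => relative_moment_entropy hΩo hΩc hh hα hP hf hy hK,
      hP.momentConst_ne, fun g hg hN => ?_⟩
    subst hg
    have hsharp := relative_moment_entropy_sharp hΩo hΩc hh hα hP hN
    exact ⟨⟨isDensityOn_invTransform hΩo hΩc hα hh hP.isIntervalDensity hN,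
      isChangeOfVar_invVar hα hhw h1 hP.isIntervalDensity hN, hsharp.1, hsharp.2⟩,
      fun f y hf hy hK heq => relative_moment_entropy_eq hΩo hΩc hh hα hP hf hy hK hN heq⟩
  · have hθ := hs.theta_ne
    have hβ : β = β / (1 + β - l) * (1 + β - l) := (div_mul_cancel₀ β hθ).symm
    rcases hp.eq_or_lt with rfl | hp1
    · have hγ := hs.div_pos hl
      have hβ0 : β ≠ 0 := by
        rintro rfl
        simp at hγ
      have hg := stamData_uniform hγ (div_ne_one_of_ne hl rfl hθ) hθ
      -- For p = 1 the factor D is |β| alone: the q-norm of x under g becomes its supremum on (-1,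
      -- 1), which is 1.
      have hD : 0 < |β| := abs_pos.2 hβ0
      have hmain := relative_stam_of_data (p := 1) hΩo hΩc hh hhd hα hl hg hβ rfl
        (c := 2 * (1 / 2) ^ (β / (1 + β - l))) (by positivity) hD (lintegral_uniform_rpow _)
        (by
          rw [fisherIntegral_uniform hg hβ0 hβ, ← ENNReal.ofReal_mul hD.le]
          refine ENNReal.ofReal_le_ofReal (le_of_eq ?_)
          field_simp)
        (by
          rw [fisherIntegral_uniform hg hβ0 hβ]
          simp only [ne_eq, ENNReal.ofReal_eq_zero, not_le]
          positivity)
        (fun f y hf hf1 _ hy _ s hs => stam_upper_one hβ0 hα hy hf hhw hf1 hs)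
        (fun hN _ _ => relFisherIntegral_invTransform_uniform hα hhw h1 hg hβ0 hβ hN)
        (fun r _ => Or.inl rfl) (K := stamConst 1 β l)
        (by rw [stamConst, stamMinimizer, holderConj_one]; rfl)
      refine ⟨hmain.1, hmain.2.1, fun g' hg' => ?_⟩
      have hgE : g' = escort (stretchedGaussian ∞ (β / (1 + β - l))) (1 + β - l) := by
        rw [hg', holderConj_one]; rfl
      rw [hgE]
      exact hmain.2.2
    · have hP := hs.isProfileParam hp1 hl
      have hpq := Real.HolderConjugate.conjExponent hp1
      have hq0 := hpq.symm.ne_zero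
      have hβ0 : β ≠ 0 := by
        rintro rfl
        simpa using hP.pos
      have hM := hP.integral_moment_pos hq0
      have hg := hP.stamData hpq.symm.lt hθ
      have hmain := relative_stam_of_data (p := p) hΩo hΩc hh hhd hα hl hg hβ rfl
        (hP.isIntervalDensity.isDensity.integral_rpow_pos hP.integrable_gaussian_rpow)
        -- The factor in `stam_upper`: |β| times the q-norm of x under the Gaussian.
        (D := |β| * (∫ x, |x| ^ Real.conjExponent p * stretchedGaussian
          (ENNReal.ofReal (Real.conjExponent p)) (β / (1 + β - l)) x) ^ (1 / Real.conjExponent p))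
        (mul_pos (abs_pos.2 hβ0) (Real.rpow_pos_of_pos hM _))
        hP.lintegral_gaussian_rpow (hP.fisherIntegral_escort_le hpq hθ hβ)
        (hP.fisherIntegral_escort_ne hpq hθ hβ)
        (fun f y hf hf1 hfd hy hreg s hs =>
          stam_upper_of_one_lt hP hpq hθ hβ hα hy hf hhw hf1 hfd hhd hreg hs)
        (fun hN hf hfd => relFisherIntegral_invTransform_of_one_lt hp1 hα hhw h1 hf
          hg.isIntervalDensity_escort hN hfd hhd)
        (fun r hr => hg.stamRegular_scaling_escort (fun x y hxy => hP.gaussian_le hq0 hxy)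
          (fun ε hε => hP.isCompact_level hq0 hε) hr p) (K := stamConst p β l)
        (by rw [stamConst, stamMinimizer, holderConj_of_one_lt hp1]; rfl)
      refine ⟨hmain.1, hmain.2.1, fun g' hg' => ?_⟩
      have hgE : g' = escort (stretchedGaussian (ENNReal.ofReal (Real.conjExponent p))
          (β / (1 + β - l))) (1 + β - l) := by
        rw [hg', holderConj_of_one_lt hp1]; rfl
      rw [hgE]
      exact hmain.2.2
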